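/- Let $M$ be a smooth $4$-manifold and let $\pi\colon P\to M$ be a smooth principal bundle with structure group $T_1=\mathbb{R}$ or $U(1)=\mathbb{R}/2\pi\mathbb{Z}$ and fundamental vector field $k$. Let $\hbar,m,a_0>0$, $\beta\neq 0$, $\epsilon\in\{-1,0,1\}$, $\varepsilon\in\{-1,1\}$ be constants. Let $g_0$ be a Lorentzian metric on $M$ of signature $(+,-,-,-)$, $a>0$ a smooth function on $M$, $\tilde\omega$ a connection one-form on $P$ (real valued, invariant, $\tilde\omega(k)=1$), and put $$\tilde g=\varepsilon\,\pi^*g_0-a^2\,\tilde\omega\otimes\tilde\omega ,\qquad g_E=\frac{a}{a_0}\,g_0 .$$ Let the complex $C^2$ function $\Psi$ solve the Klein-Gordon equation $\hbar^2\,\tilde g^{AB}\tilde\nabla_A\tilde\nabla_B\Psi+\epsilon m^2\Psi=0$ on $(P,\tilde g)$. Let the charge $q$ range over $\mathbb{R}$ with the measure $d\mu(q)=dq/2\pi$ if the group is $T_1$, and over $\hbar\beta\,\mathbb{Z}$ with the counting measure if it is $U(1)$. For each such $q$ let $\alpha_{(q,m)}$ be a nowhere vanishing real $C^2$ function on $M$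 that is a stationary point (with respect to smooth variations supported in compact coordinate regions) of the action with Lagrangian density $$\sqrt{|\det g_E|}\,\Big[\frac{\hbar^2}{2}\,g_E^{\mu\nu}\partial_\mu\alpha\,\partial_\nu\alpha-\varepsilon\,\frac{a_0}{2a}\Big(\epsilon m^2+\frac{q^2}{\beta^2a^2}\Big)\alpha^2+\frac14\,\alpha^4\Big].$$ Let $s\colon U\to P$ be a smooth section over an open set $U\subseteq M$, let $y$ be the fiber coordinate with origin $s$ (the point $(x,y)$ is obtained from $s(x)$ by the action of $y$), and let $A=s^*\tilde\omega/\beta$ be the potential. Let $$\Psi(x,y)=\int d\mu(q)\,\psi_q(x)\,\alpha_{(q,m)}(x)\,e^{i\frac{q}{\hbar\beta}y},\qquad x\in U,$$ be the Fourier expansion of $\Psi$ along the fiber, absolutely convergent and with coefficients $\psi_q\alpha_{(q,m)}$ continuous in $q$; if the group is $T_1$, suppose moreover that the derivatives of order at most two of $\Psi(x,y)$ are bounded, locally uniformly in $x\in U$, by integrable functions of $y$. Then for every charge $q$ the function $\psi_q$ is $C^2$ on $U$ and satisfies the Klein-Gordon equation of a particle of mass $m$ and charge $q$ $$g_{(q,m)}^{\mu\nu}D_\mu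 D_\nu\psi_q+m^2\psi_q=0,\qquad D_\mu=\hbar\nabla_\mu-iqA_\mu ,$$ where $\nabla$ is the Levi-Civita connection of the metric $g_{(q,m)}=\alpha_{(q,m)}^2\,g_E/m^2$. -/

import Mathlib

open scoped Manifold ContDiff Topology
open MeasureTheory

noncomputable section

namespace KaluzaKlein

/-! Tensor calculus in `ℝⁿ`: a metric is given by its matrix of components. -/

/-- The partial derivative `∂_i f`. -/
def pd {n : ℕ} {F : Type*} [NormedAddCommGroup F] [NormedSpace ℝ F]
    (i : Fin n) (f : (Fin n → ℝ) → F) (x : Fin n → ℝ) : F :=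
  fderiv ℝ f x (Pi.single i 1)

/-- The Christoffel symbols `Γ^k_{ij}` of the Levi-Civita connection of `g`. -/
def christoffel {n : ℕ} (g : (Fin n → ℝ) → Matrix (Fin n) (Fin n) ℝ)
    (k i j : Fin n) (x : Fin n → ℝ) : ℝ :=
  (1 / 2) * ∑ l, (g x)⁻¹ k l *
    (pd i (fun z => g z j l) x + pd j (fun z => g z i l) x - pd l (fun z => g z i j) x)

/-- The covariant derivative `∇_i B_j` of a complex one-form `B`. -/
def covDeriv {n : ℕ} (g : (Fin n → ℝ) → Matrix (Fin n) (Fin n) ℝ)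
    (B : Fin n → (Fin n → ℝ) → ℂ) (i j : Fin n) (x : Fin n → ℝ) : ℂ :=
  pd i (B j) x - ∑ k, (christoffel g k i j x : ℂ) * B k x

/-- The d'Alembertian `g^{ij} ∇_i ∇_j f`. -/
def box {n : ℕ} (g : (Fin n → ℝ) → Matrix (Fin n) (Fin n) ℝ)
    (f : (Fin n → ℝ) → ℂ) (x : Fin n → ℝ) : ℂ :=
  ∑ i, ∑ j, ((g x)⁻¹ i j : ℂ) * covDeriv g (fun l => pd l f) i j x

/-- The gauge covariant derivative `D_j f = ħ ∂_j f - i q A_j f` of a function. -/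
def gaugeD {n : ℕ} (hbar q : ℝ) (A : Fin n → (Fin n → ℝ) → ℝ)
    (f : (Fin n → ℝ) → ℂ) (j : Fin n) (x : Fin n → ℝ) : ℂ :=
  hbar * pd j f x - Complex.I * q * A j x * f x

/-- The charged d'Alembertian `D^j D_j f`, where `D_i = ħ ∇_i - i q A_i`. -/
def gaugeBox {n : ℕ} (hbar q : ℝ) (A : Fin n → (Fin n → ℝ) → ℝ)
    (g : (Fin n → ℝ) → Matrix (Fin n) (Fin n) ℝ)
    (f : (Fin n → ℝ) → ℂ) (x : Fin n → ℝ) : ℂ :=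
  ∑ i, ∑ j, ((g x)⁻¹ i j : ℂ) *
    (hbar * covDeriv g (gaugeD hbar q A f) i j x
      - Complex.I * q * A i x * gaugeD hbar q A f j x)

/-! Tensor fields on manifolds and their components. -/

section Manifolds

variable (n : ℕ) (N : Type*) [TopologicalSpace N] [ChartedSpace (EuclideanSpace ℝ (Fin n)) N]

/-- A smooth local coordinate system of `N`, given by the inverse of its coordinate map: a smooth
injective map with invertible differential from an open set of `ℝⁿ` to `N`. -/
structure CoordSystem where
  dom : Set (Fin n → ℝ)
  isOpen_dom : IsOpen dom
  param : (Fin n → ℝ) → N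
  smooth : ContMDiffOn 𝓘(ℝ, Fin n → ℝ) (𝓡 n) ∞ param dom
  injOn : Set.InjOn param dom
  bijective_mfderiv : ∀ x ∈ dom,
    Function.Bijective (mfderiv 𝓘(ℝ, Fin n → ℝ) (𝓡 n) param x)

/-- A field of bilinear forms on the tangent spaces of `N`. -/
abbrev BilinField := ∀ p : N, LinearMap.BilinForm ℝ (TangentSpace (𝓡 n) p)

/-- A field of linear forms on the tangent spaces of `N`. -/
abbrev OneForm := ∀ p : N, Module.Dual ℝ (TangentSpace (𝓡 n) p)

variable {n N}

/-- The coordinate vector field `∂/∂x^i`. -/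
def CoordSystem.basisVec (c : CoordSystem n N) (i : Fin n) (x : Fin n → ℝ) :
    TangentSpace (𝓡 n) (c.param x) :=
  mfderiv 𝓘(ℝ, Fin n → ℝ) (𝓡 n) c.param x (Pi.single i 1 : Fin n → ℝ)

/-- The components `g_{ij}` in a coordinate system. -/
def BilinField.comp (g : BilinField n N) (c : CoordSystem n N) (x : Fin n → ℝ) :
    Matrix (Fin n) (Fin n) ℝ :=
  Matrix.of fun i j => g (c.param x) (c.basisVec i x) (c.basisVec j x)

/-- The components `A_i` in a coordinate system. -/
def OneForm.comp (A : OneForm n N) (c : CoordSystem n N) (i : Fin n) (x : Fin n → ℝ) : ℝ :=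
  A (c.param x) (c.basisVec i x)

/-- The field of bilinear forms is smooth: its components are, in every coordinate system. -/
def BilinField.IsSmooth (g : BilinField n N) : Prop :=
  ∀ c : CoordSystem n N, ∀ i j, ContDiffOn ℝ ∞ (fun x => g.comp c x i j) c.dom

/-- The one-form is smooth: its components are, in every coordinate system. -/
def OneForm.IsSmooth (A : OneForm n N) : Prop :=
  ∀ c : CoordSystem n N, ∀ i, ContDiffOn ℝ ∞ (A.comp c i) c.dom

/-- `g` is a smooth Lorentzian metric of signature `(+ - ⋯ -)`. -/
structure IsLorentzMetric (g : BilinField n N) : Prop where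
  symm : ∀ p v w, g p v w = g p w v
  smooth : g.IsSmooth
  signature : ∀ p, ∃ b : Module.Basis (Fin n) ℝ (TangentSpace (𝓡 n) p), ∀ i j,
    g p (b i) (b j) = if i = j then (if i.val = 0 then 1 else -1) else 0

/-- `Ψ` is a `C²` solution of the neutral Klein-Gordon equation `ħ² □Ψ + μ Ψ = 0`. -/
def SolvesNeutralKG (hbar : ℝ) (g : BilinField n N) (μ : ℝ) (Ψ : N → ℂ) : Prop :=
  ContMDiff (𝓡 n) 𝓘(ℝ, ℂ) 2 Ψ ∧
    ∀ c : CoordSystem n N, ∀ x ∈ c.dom,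
      hbar ^ 2 * box (g.comp c) (Ψ ∘ c.param) x + μ * Ψ (c.param x) = 0

/-- `ψ` is, on the open set `U`, a `C²` solution of the Klein-Gordon equation
`D^j D_j ψ + m² ψ = 0`, `D = ħ ∇ - i q A`, of a particle of charge `q` and mass `m` coupled to the
metric `g` and to the potential `A`. -/
def SolvesChargedKGOn (hbar q m : ℝ) (A : OneForm n N) (g : BilinField n N) (U : Set N)
    (ψ : N → ℂ) : Prop :=
  ContMDiffOn (𝓡 n) 𝓘(ℝ, ℂ) 2 ψ U ∧
    ∀ c : CoordSystem n N, Set.MapsTo c.param c.dom U → ∀ x ∈ c.dom,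
      gaugeBox hbar q (A.comp c) (g.comp c) (ψ ∘ c.param) x + m ^ 2 * ψ (c.param x) = 0

/-- The Lagrangian density
`√|det g| [ħ²/2 g^{ij} ∂_i f ∂_j f - W/2 f² + f⁴/4]` of a scalar field `f` in a coordinate system,
with a given function `W` on `N`. -/
def quarticLagrangian (hbar : ℝ) (g : BilinField n N) (W : N → ℝ) (c : CoordSystem n N)
    (f : (Fin n → ℝ) → ℝ) (x : Fin n → ℝ) : ℝ :=
  √|(g.comp c x).det| *
    (hbar ^ 2 / 2 * (∑ i, ∑ j, (g.comp c x)⁻¹ i j * pd i f x * pd j f x)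
      - W (c.param x) / 2 * f x ^ 2 + 1 / 4 * f x ^ 4)

/-- `α` is a stationary point of the action with the above Lagrangian density: the first variation
of the action over every compact coordinate region vanishes, for all smooth variations supported in
that region. -/
def IsStationaryPoint (hbar : ℝ) (g : BilinField n N) (W : N → ℝ) (α : N → ℝ) : Prop :=
  ∀ c : CoordSystem n N, ∀ K : Set (Fin n → ℝ), IsCompact K → K ⊆ c.dom →
    ∀ η : (Fin n → ℝ) → ℝ, ContDiff ℝ ∞ η → tsupport η ⊆ K →
      HasDerivAt (fun t : ℝ => ∫ x in K,
        quarticLagrangian hbar g W c (fun z => α (c.param z) + t * η z) x) 0 0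

end Manifolds

/-! The principal bundle. -/

/-- The two possible structure groups: the translations `ℝ`, and `U(1) = ℝ / 2πℤ`. -/
inductive StructureGroup
  | T1
  | U1

/-- The structure group is the quotient of `ℝ` by this subgroup. -/
def StructureGroup.periods : StructureGroup → AddSubgroup ℝ
  | T1 => ⊥
  | U1 => AddSubgroup.zmultiples (2 * Real.pi)

/-- The charges `q` that occur in the Fourier expansion along the fiber: all of them, or those
with `q / (ħ β)` an integer. -/
def StructureGroup.charges (hbar β : ℝ) : StructureGroup → Set ℝ
  | T1 => Set.univ
  | U1 => Set.range fun k : ℤ => k * (hbar * β)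

/-- The measure `dμ(q)` of the Fourier expansion: `dq / 2π`, or the sum over the integers
`k = q / (ħ β)`. -/
def StructureGroup.chargeMeasure (hbar β : ℝ) : StructureGroup → Measure ℝ
  | T1 => ENNReal.ofReal (1 / (2 * Real.pi)) • volume
  | U1 => Measure.sum fun k : ℤ => Measure.dirac (k * (hbar * β))

section Bundle

variable (M P : Type*)
  [TopologicalSpace M] [ChartedSpace (EuclideanSpace ℝ (Fin 4)) M]
  [TopologicalSpace P] [ChartedSpace (EuclideanSpace ℝ (Fin 5)) P] [AddAction ℝ P]

/-- A smooth principal bundle `P → M` with structure group `G`. The action of `G` is given as an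
action of `ℝ` whose stabilizers are all equal to the period subgroup of `G`. -/
structure PrincipalBundle (G : StructureGroup) where
  proj : P → M
  smooth_proj : ContMDiff (𝓡 5) (𝓡 4) ∞ proj
  smooth_vadd : ContMDiff (𝓘(ℝ, ℝ).prod (𝓡 5)) (𝓡 5) ∞ (fun z : ℝ × P => z.1 +ᵥ z.2)
  proj_eq_iff : ∀ p p' : P, proj p = proj p' ↔ ∃ y : ℝ, y +ᵥ p = p'
  vadd_eq_iff : ∀ (y : ℝ) (p : P), y +ᵥ p = p ↔ y ∈ G.periods
  exists_section : ∀ x : M, ∃ U : Set M, IsOpen U ∧ x ∈ U ∧ ∃ s : M → P,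
    ContMDiffOn (𝓡 4) (𝓡 5) ∞ s U ∧ ∀ z ∈ U, proj (s z) = z

variable {M P}

/-- The vector field `k` that generates the action. -/
def fundamentalField (p : P) : TangentSpace (𝓡 5) p :=
  mfderiv 𝓘(ℝ, ℝ) (𝓡 5) (fun y : ℝ => y +ᵥ p) 0 (1 : ℝ)

/-- `conn` is a real-valued connection one-form: `conn(k) = 1`, and `conn` is invariant. -/
structure IsConnectionForm (conn : OneForm 5 P) : Prop where
  smooth : conn.IsSmooth
  apply_fundamentalField : ∀ p, conn p (fundamentalField p) = 1
  invariant : ∀ (y : ℝ) (p : P) (v : TangentSpace (𝓡 5) p),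
    conn (y +ᵥ p) (mfderiv (𝓡 5) (𝓡 5) (fun p' : P => y +ᵥ p') p v) = conn p v

/-- The metric `σ π^* g₀ - a² conn ⊗ conn` on `P`. -/
def kkMetric {G : StructureGroup} (B : PrincipalBundle M P G) (σ : ℝ) (g₀ : BilinField 4 M)
    (a : M → ℝ) (conn : OneForm 5 P) : BilinField 5 P := fun p =>
  σ • LinearMap.compl₁₂ (g₀ (B.proj p))
      (mfderiv (𝓡 5) (𝓡 4) B.proj p).toLinearMap (mfderiv (𝓡 5) (𝓡 4) B.proj p).toLinearMap
    - a (B.proj p) ^ 2 • LinearMap.BilinForm.linMulLin (conn p) (conn p)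

/-- The electromagnetic potential `A = s^* conn / β` of a local section `s`. -/
def gaugePotential (β : ℝ) (conn : OneForm 5 P) (s : M → P) : OneForm 4 M := fun x =>
  β⁻¹ • (conn (s x)).comp (mfderiv (𝓡 4) (𝓡 5) s x).toLinearMap

/-- `Ψ` has the Fourier expansion `Ψ = ∫ dμ(q) φ_q(x) e^{i q y / (ħ β)}` along the fibers over
`U`, where `y` is the coordinate of the fiber whose origin is the section `s`. The coefficients are
taken continuous in `q` (for `U(1)` the set of charges is discrete, and this says nothing). -/
def IsFiberFourierExpansion (G : StructureGroup) (hbar β : ℝ) (s : M → P) (U : Set M)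
    (Ψ : P → ℂ) (φ : ℝ → M → ℂ) : Prop :=
  ∀ x ∈ U, ContinuousOn (fun q => φ q x) (G.charges hbar β) ∧
    Integrable (fun q => φ q x) (G.chargeMeasure hbar β) ∧
    ∀ y : ℝ, Ψ (y +ᵥ s x) =
      ∫ q, φ q x * Complex.exp (Complex.I * (q / (hbar * β) * y : ℝ)) ∂(G.chargeMeasure hbar β)

/-- For the noncompact fiber `ℝ`: the derivatives of order at most two of `Ψ(x, y)` are integrable
along the fiber, locally uniformly in the base point. For `U(1)` there is no condition. -/
def FiberIntegrable (G : StructureGroup) (s : M → P) (U : Set M) (Ψ : P → ℂ) : Prop :=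
  match G with
  | .T1 => ∀ c : CoordSystem 4 M, Set.MapsTo c.param c.dom U → ∀ x₀ ∈ c.dom,
      ∃ b : ℝ → ℝ, Integrable b ∧ ∀ᶠ x in 𝓝 x₀, ∀ y : ℝ, ∀ k ≤ 2,
        ‖iteratedFDeriv ℝ k
          (fun z : (Fin 4 → ℝ) × ℝ => Ψ (z.2 +ᵥ s (c.param z.1))) (x, y)‖ ≤ b y
  | .U1 => True

end Bundle

end KaluzaKlein

end

open KaluzaKlein

/-! In coordinates (y, x) adapted to the section, the metric on the bundle is σ g₀ - a² (dy + βA)².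
Its coefficients do not depend on y, its volume density is a √|det g₀|, and its inverse is diagonal
in the frame formed by ∂_y and the horizontal lifts ∂_i - βA_i ∂_y (`det_kkMatrix`, `kkMatrix_inv`).
The d'Alembertian in divergence form (`sqrt_det_mul_gaugeBox`) therefore turns the equation for Ψ
into a horizontal divergence, plus a multiple of ∂_y²Ψ, plus a multiple of Ψ
(`SectionCoord.horizontal_equation`).

The coefficient φ = αψ of charge q is an integral of Ψ along the fiber against e^{-iky}, with k =
q/(ħβ) (`fourier_inversion`). This gives its regularity in x, by differentiation under the integral,
and replaces ∂_y by ik (`fiberCoeff_pd_zero`). Hence ħ times the horizontal lift of ∂_j becomes D_j,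
while -ħ²∂_y² becomes q²/β². The result is a charged equation for φ with a position-dependent mass
(`gaugeDiv_fiberCoeff`).

The mass is made constant by two conformal changes, both resting on one fact of dimension four: the
density H^{ij} = √|det g| g^{ij} is multiplied by r, and √|det g| by r², when g is multiplied by r >
0 (`invDensity_smul`, `sqrt_abs_det_smul`). First, a times the density of g₀ is a₀ times that of
g_E, so φ obeys D_i(H^{ij} D_j φ) + √|det g_E| W φ = 0, with the same W as in the action for α.
Secondly, the Euler-Lagrange equation ħ² ∂_i(H^{ij} ∂_j α) = √|det g_E| (α³ - Wα) and the identity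
D_i(α² H^{ij} D_j ψ) = α D_i(H^{ij} D_j(αψ)) - ħ² αψ ∂_i(H^{ij} ∂_j α) make W cancel. The right side
is -√|det g_E| α⁴ ψ, which is the equation of constant mass m for the metric α² g_E/m²
(`gaugeBox_conformal`). -/

noncomputable section

namespace KaluzaKlein

/-! ### Partial derivatives -/

section Calculus

variable {n : ℕ} {F : Type*} [NormedAddCommGroup F] [NormedSpace ℝ F] {x : Fin n → ℝ}

lemma pd_congr {f g : (Fin n → ℝ) → F} (h : f =ᶠ[𝓝 x] g) (i : Fin n) : pd i f x = pd i g x := by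
  simp only [pd, h.fderiv_eq]

lemma pd_add {f g : (Fin n → ℝ) → F} (hf : DifferentiableAt ℝ f x) (hg : DifferentiableAt ℝ g x)
    (i : Fin n) : pd i (fun z => f z + g z) x = pd i f x + pd i g x := by
  simp [pd, fderiv_fun_add hf hg]

lemma pd_sum {ι : Type*} {s : Finset ι} {f : ι → (Fin n → ℝ) → F}
    (hf : ∀ j ∈ s, DifferentiableAt ℝ (f j) x) (i : Fin n) :
    pd i (fun z => ∑ j ∈ s, f j z) x = ∑ j ∈ s, pd i (f j) x := by
  simp [pd, fderiv_fun_sum hf]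

lemma pd_mul {𝔸 : Type*} [NormedCommRing 𝔸] [NormedAlgebra ℝ 𝔸] {f g : (Fin n → ℝ) → 𝔸}
    (hf : DifferentiableAt ℝ f x) (hg : DifferentiableAt ℝ g x) (i : Fin n) :
    pd i (fun z => f z * g z) x = pd i f x * g x + f x * pd i g x := by
  simp [pd, fderiv_fun_mul hf hg, add_comm, mul_comm]

lemma pd_const_mul {𝔸 : Type*} [NormedCommRing 𝔸] [NormedAlgebra ℝ 𝔸] {f : (Fin n → ℝ) → 𝔸}
    (hf : DifferentiableAt ℝ f x) (b : 𝔸) (i : Fin n) :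
    pd i (fun z => b * f z) x = b * pd i f x := by
  simp [pd, fderiv_const_mul hf]

lemma pd_ofReal {f : (Fin n → ℝ) → ℝ} (hf : DifferentiableAt ℝ f x) (i : Fin n) :
    pd i (fun z => (f z : ℂ)) x = ((pd i f x : ℝ) : ℂ) := by
  have := (Complex.ofRealCLM.hasFDerivAt.comp x hf.hasFDerivAt).fderiv
  simp only [pd]
  erw [this]
  simp

lemma differentiableAt_ofReal {E : Type*} [NormedAddCommGroup E] [NormedSpace ℝ E] {x : E}
    {f : E → ℝ} (hf : DifferentiableAt ℝ f x) :
    DifferentiableAt ℝ (fun z => (f z : ℂ)) x :=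
  Complex.ofRealCLM.differentiableAt.comp x hf

lemma contDiffOn_ofReal {E : Type*} [NormedAddCommGroup E] [NormedSpace ℝ E] {s : Set E}
    {k : WithTop ℕ∞} {f : E → ℝ} (hf : ContDiffOn ℝ k f s) :
    ContDiffOn ℝ k (fun z => (f z : ℂ)) s :=
  Complex.ofRealCLM.contDiff.comp_contDiffOn hf

lemma contDiffOn_pd {f : (Fin n → ℝ) → F} {s : Set (Fin n → ℝ)} (hs : IsOpen s) {k l : WithTop ℕ∞}
    (hf : ContDiffOn ℝ k f s) (hkl : l + 1 ≤ k) (i : Fin n) : ContDiffOn ℝ l (pd i f) s :=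
  (hf.fderiv_of_isOpen hs hkl).clm_apply contDiffOn_const

/-- In finite dimension the differential applied to a fixed vector is a finite linear combination of
partial derivatives. This is how the Fourier coefficients gain regularity: their partial derivatives
are again Fourier coefficients. -/
lemma contDiffOn_of_pd {f : (Fin n → ℝ) → F} {s : Set (Fin n → ℝ)} (hs : IsOpen s)
    {k : ℕ} (hf : ∀ x ∈ s, DifferentiableAt ℝ f x) (h : ∀ i, ContDiffOn ℝ k (pd i f) s) :
    ContDiffOn ℝ (k + 1) f s := by
  rw [contDiffOn_succ_iff_fderiv_of_isOpen hs]
  refine ⟨fun x hx => (hf x hx).differentiableWithinAt, by simp, ?_⟩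
  rw [contDiffOn_clm_apply]
  intro v
  have : (fun y => fderiv ℝ f y v) = fun y => ∑ i, v i • pd i f y := by
    ext y
    conv_lhs => rw [pi_eq_sum_univ' v]
    simp only [pd, ← map_smul, map_sum]
  rw [this]
  exact ContDiffOn.sum fun i _ => contDiffOn_const.smul (h i)

end Calculus

/-! ### Derivatives of determinants and inverse matrices -/

section Determinant

variable {E : Type*} [NormedAddCommGroup E] [NormedSpace ℝ E]
  {ι : Type*} [Fintype ι] [DecidableEq ι] {g : E → Matrix ι ι ℝ}

lemma contDiffOn_det {k : WithTop ℕ∞} {s : Set E}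
    (hg : ∀ i j, ContDiffOn ℝ k (fun z => g z i j) s) :
    ContDiffOn ℝ k (fun z => (g z).det) s := by
  simp only [Matrix.det_apply']
  exact ContDiffOn.sum fun σ _ => contDiffOn_const.mul (contDiffOn_prod fun i _ => hg _ _)

/-- Cramer's rule: an entry of the inverse is a quotient of two determinants with regular entries.
-/
lemma contDiffOn_inv {k : WithTop ℕ∞} {s : Set E}
    (hg : ∀ i j, ContDiffOn ℝ k (fun z => g z i j) s) (hdet : ∀ z ∈ s, (g z).det ≠ 0) (i j : ι) :
    ContDiffOn ℝ k (fun z => (g z)⁻¹ i j) s := by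
  have : (fun z => (g z)⁻¹ i j) =
      fun z => (g z).det⁻¹ * ((g z).updateRow j (Pi.single i 1)).det := by
    ext z
    simp [Matrix.inv_def, Matrix.adjugate_apply]
  rw [this]
  refine ((contDiffOn_det hg).inv hdet).mul (contDiffOn_det fun a b => ?_)
  by_cases h : a = j
  · subst h; simpa using contDiffOn_const
  · simpa [Matrix.updateRow_ne h] using hg a b

lemma contDiffOn_sqrt_abs_det {k : ℕ∞} {s : Set E}
    (hg : ∀ i j, ContDiffOn ℝ k (fun z => g z i j) s) (hdet : ∀ z ∈ s, (g z).det ≠ 0) :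
    ContDiffOn ℝ k (fun z => √|(g z).det|) s := fun z hz =>
  ContDiffWithinAt.sqrt (ContDiffAt.comp_contDiffWithinAt (g := fun t : ℝ => |t|) z
    (contDiffAt_abs (hdet z hz)) (contDiffOn_det hg z hz)) (abs_ne_zero.2 (hdet z hz))

/-- Jacobi's formula. Differentiating the Leibniz expansion gives the sum over i of the determinants
with column i differentiated, and Cramer's rule expresses each by the inverse matrix. -/
lemma fderiv_det {x : E} (hg : ∀ i j, DifferentiableAt ℝ (fun z => g z i j) x)
    (hdet : (g x).det ≠ 0) (v : E) :
    fderiv ℝ (fun z => (g z).det) x v =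
      (g x).det * ∑ i, ∑ j, (g x)⁻¹ i j * fderiv ℝ (fun z => g z j i) x v := by
  have h : HasFDerivAt (fun z => (g z).det) (∑ σ : Equiv.Perm ι, ((Equiv.Perm.sign σ : ℤ) : ℝ) •
      ∑ i, (∏ j ∈ Finset.univ.erase i, g x (σ j) j) • fderiv ℝ (fun z => g z (σ i) i) x) x := by
    simp only [Matrix.det_apply']
    exact HasFDerivAt.fun_sum fun σ _ =>
      (HasFDerivAt.finsetProd fun i _ => (hg (σ i) i).hasFDerivAt).const_mul _
  have h2 : ∀ i, ((g x).updateCol i fun j => fderiv ℝ (fun z => g z j i) x v).det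
      = (g x).det * ∑ j, (g x)⁻¹ i j * fderiv ℝ (fun z => g z j i) x v := by
    intro i
    rw [← Matrix.cramer_apply, Matrix.cramer_eq_adjugate_mulVec, Matrix.mulVec, dotProduct,
      Finset.mul_sum]
    refine Finset.sum_congr rfl fun j _ => ?_
    rw [Matrix.inv_def, Matrix.smul_apply, Ring.inverse_eq_inv', smul_eq_mul, ← mul_assoc,
      ← mul_assoc, mul_inv_cancel₀ hdet, one_mul]
  rw [h.fderiv, Finset.mul_sum]
  simp only [← h2]
  simp only [Matrix.det_apply', sum_apply, smul_apply]
  rw [Finset.sum_comm]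
  refine Finset.sum_congr rfl fun σ _ => ?_
  rw [← Finset.mul_sum, smul_eq_mul]
  congr 1
  refine Finset.sum_congr rfl fun i _ => ?_
  rw [← Finset.mul_prod_erase Finset.univ _ (Finset.mem_univ i), mul_comm]
  simp only [Matrix.updateCol_self, smul_eq_mul]
  congr 1
  refine Finset.prod_congr rfl fun j hj => ?_
  rw [Matrix.updateCol_ne (Finset.ne_of_mem_erase hj)]

lemma fderiv_sqrt_abs_det {x : E} (hg : ∀ i j, DifferentiableAt ℝ (fun z => g z i j) x)
    (hdet : (g x).det ≠ 0) (hd : DifferentiableAt ℝ (fun z => (g z).det) x) (v : E) :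
    fderiv ℝ (fun z => √|(g z).det|) x v =
      √|(g x).det| * (1 / 2 * ∑ i, ∑ j, (g x)⁻¹ i j * fderiv ℝ (fun z => g z j i) x v) := by
  have h0 : |(g x).det| ≠ 0 := abs_ne_zero.2 hdet
  have h1 := (HasFDerivAt.sqrt (f := fun z => |(g z).det|)
    (HasDerivAt.comp_hasFDerivAt (h₂ := fun t : ℝ => |t|) x (hasDerivAt_abs hdet)
      hd.hasFDerivAt) h0).fderiv
  have h2 : √|(g x).det| ≠ 0 := (Real.sqrt_pos.2 (abs_pos.2 hdet)).ne'
  have h3 := Real.mul_self_sqrt (abs_nonneg (g x).det)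
  have h4 : (SignType.sign (g x).det : ℝ) * (g x).det = |(g x).det| := sign_mul_self _
  rw [h1]
  simp only [smul_apply, smul_eq_mul, fderiv_det hg hdet]
  set S := ∑ i, ∑ j, (g x)⁻¹ i j * fderiv ℝ (fun z => g z j i) x v
  field_simp
  linear_combination S * h4 - S * h3

/-- Differentiate g⁻¹ g = 1 and multiply by g⁻¹ on the right. -/
lemma fderiv_inv {x : E} (hg : ∀ i j, DifferentiableAt ℝ (fun z => g z i j) x)
    (hi : ∀ i j, DifferentiableAt ℝ (fun z => (g z)⁻¹ i j) x)
    (hdet : ∀ᶠ z in 𝓝 x, (g z).det ≠ 0) (v : E) (i j : ι) :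
    fderiv ℝ (fun z => (g z)⁻¹ i j) x v =
      -∑ k, ∑ l, (g x)⁻¹ i k * fderiv ℝ (fun z => g z k l) x v * (g x)⁻¹ l j := by
  have hx := hdet.self_of_nhds
  have h1 : ∀ a b, ∑ k, (fderiv ℝ (fun z => (g z)⁻¹ a k) x v * g x k b
      + (g x)⁻¹ a k * fderiv ℝ (fun z => g z k b) x v) = 0 := by
    intro a b
    have h : (fun z => ∑ k, (g z)⁻¹ a k * g z k b) =ᶠ[𝓝 x] fun _ => (1 : Matrix ι ι ℝ) a b := by
      filter_upwards [hdet] with z hz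
      rw [← Matrix.mul_apply, Matrix.nonsing_inv_mul _ (isUnit_iff_ne_zero.2 hz)]
    have h' : fderiv ℝ (fun z => ∑ k, (g z)⁻¹ a k * g z k b) x v = 0 := by
      rw [h.fderiv_eq]; simp
    rw [fderiv_fun_sum fun k _ => DifferentiableAt.fun_mul (hi a k) (hg k b)] at h'
    simp only [sum_apply, fderiv_fun_mul (hi a _) (hg _ b)] at h'
    simpa [add_comm, mul_comm] using h'
  let D : Matrix ι ι ℝ := Matrix.of fun a b => fderiv ℝ (fun z => (g z)⁻¹ a b) x v
  let D' : Matrix ι ι ℝ := Matrix.of fun a b => fderiv ℝ (fun z => g z a b) x v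
  have h2 : D * g x + (g x)⁻¹ * D' = 0 := by
    ext a b
    simp only [Matrix.add_apply, Matrix.mul_apply, ← Finset.sum_add_distrib]
    exact h1 a b
  have h3 : D = -((g x)⁻¹ * D' * (g x)⁻¹) := by
    have := congrArg (· * (g x)⁻¹) h2
    simp only [add_mul, Matrix.zero_mul] at this
    rw [Matrix.mul_assoc D, Matrix.mul_nonsing_inv _ (isUnit_iff_ne_zero.2 hx), Matrix.mul_one]
      at this
    exact eq_neg_of_add_eq_zero_left this
  have h4 := congrFun (congrFun h3 i) j
  simp only [Matrix.neg_apply, Matrix.mul_apply, Finset.sum_mul] at h4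
  rw [Finset.sum_comm] at h4
  exact h4

end Determinant

/-! ### The d'Alembertian in divergence form -/

section Divergence

variable {n : ℕ} {g : (Fin n → ℝ) → Matrix (Fin n) (Fin n) ℝ} {s : Set (Fin n → ℝ)}

/-- The density-weighted inverse metric `√|det g| g^{ij}`. -/
def invDensity (g : (Fin n → ℝ) → Matrix (Fin n) (Fin n) ℝ) (i j : Fin n) (x : Fin n → ℝ) : ℝ :=
  √|(g x).det| * (g x)⁻¹ i j

lemma contDiffOn_invDensity {k : ℕ∞} (hg : ∀ i j, ContDiffOn ℝ k (fun z => g z i j) s)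
    (hdet : ∀ z ∈ s, (g z).det ≠ 0) (i j : Fin n) : ContDiffOn ℝ k (invDensity g i j) s :=
  (contDiffOn_sqrt_abs_det hg hdet).mul (contDiffOn_inv hg hdet i j)

lemma invDensity_symm {x : Fin n → ℝ} (hsymm : (g x).IsSymm) (i j : Fin n) :
    invDensity g i j x = invDensity g j i x := by
  have h : ((g x)⁻¹).IsSymm := by
    rw [Matrix.IsSymm, Matrix.transpose_nonsing_inv, hsymm.eq]
  rw [invDensity, invDensity, h.apply]

/-- The derivative of √|det g| produces the third term of the Christoffel symbol. The derivative of
g⁻¹ produces the first two, which coincide after contraction with the symmetric g⁻¹. -/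
lemma sum_pd_invDensity (hs : IsOpen s) (hg : ∀ i j, ContDiffOn ℝ 1 (fun z => g z i j) s)
    (hdet : ∀ z ∈ s, (g z).det ≠ 0) {x : Fin n → ℝ} (hx : x ∈ s) (hsymm : (g x).IsSymm)
    (k : Fin n) :
    ∑ i, pd i (invDensity g i k) x =
      -(√|(g x).det| * ∑ i, ∑ j, (g x)⁻¹ i j * christoffel g k i j x) := by
  have hsi : ∀ i j, (g x)⁻¹ i j = (g x)⁻¹ j i := fun i j => by
    have h : ((g x)⁻¹).IsSymm := by
      rw [Matrix.IsSymm, Matrix.transpose_nonsing_inv, hsymm.eq]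
    rw [h.apply]
  have diff : ∀ {f : (Fin n → ℝ) → ℝ}, ContDiffOn ℝ 1 f s → DifferentiableAt ℝ f x := fun hf =>
    (hf.contDiffAt (hs.mem_nhds hx)).differentiableAt one_ne_zero
  have hgd := fun i j => diff (hg i j)
  have hid := fun i j => diff (contDiffOn_inv hg hdet i j)
  have hwd := diff (contDiffOn_sqrt_abs_det (k := 1) hg hdet)
  have hdd := diff (contDiffOn_det hg)
  have hev : ∀ᶠ z in 𝓝 x, (g z).det ≠ 0 := by
    filter_upwards [hs.mem_nhds hx] with z hz using hdet z hz
  have h1 : ∀ i, pd i (invDensity g i k) x = √|(g x).det| *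
      ((1 / 2 * ∑ a, ∑ b, (g x)⁻¹ a b * pd i (fun z => g z b a) x) * (g x)⁻¹ i k
        - ∑ a, ∑ b, (g x)⁻¹ i a * pd i (fun z => g z a b) x * (g x)⁻¹ b k) := by
    intro i
    have : pd i (invDensity g i k) x = _ := pd_mul hwd (hid i k) i
    rw [this]
    simp only [pd]
    rw [fderiv_sqrt_abs_det hgd (hdet x hx) hdd, fderiv_inv hgd hid hev]
    ring
  simp only [h1, ← Finset.mul_sum, ← mul_neg]
  congr 1
  rw [Finset.sum_sub_distrib]
  have e1 : ∑ i, (1 / 2 * ∑ a, ∑ b, (g x)⁻¹ a b * pd i (fun z => g z b a) x) * (g x)⁻¹ i k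
      = ∑ i, ∑ j, ∑ l, 1 / 2 * ((g x)⁻¹ i j * (g x)⁻¹ k l * pd l (fun z => g z i j) x) := by
    simp only [Finset.mul_sum, Finset.sum_mul]
    rw [Finset.sum_comm]
    rw [Finset.sum_congr rfl fun i _ => Finset.sum_comm]
    rw [Finset.sum_comm]
    refine Finset.sum_congr rfl fun i _ => Finset.sum_congr rfl fun j _ =>
      Finset.sum_congr rfl fun l _ => ?_
    rw [hsi k l, hsi i j]
    ring
  have e2 : ∑ i, ∑ a, ∑ b, (g x)⁻¹ i a * pd i (fun z => g z a b) x * (g x)⁻¹ b k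
      = ∑ i, ∑ j, ∑ l, (g x)⁻¹ i j * (g x)⁻¹ k l * pd i (fun z => g z j l) x := by
    refine Finset.sum_congr rfl fun i _ => Finset.sum_congr rfl fun j _ =>
      Finset.sum_congr rfl fun l _ => ?_
    rw [hsi k l]
    ring
  -- The first two Christoffel terms contribute equally, so their two halves add up to the single
  -- term of `e2`.
  have e3 : ∑ i, ∑ j, ∑ l, (g x)⁻¹ i j * (g x)⁻¹ k l * pd i (fun z => g z j l) x
      = ∑ i, ∑ j, ∑ l, (g x)⁻¹ i j * (g x)⁻¹ k l * pd j (fun z => g z i l) x := by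
    rw [Finset.sum_comm]
    refine Finset.sum_congr rfl fun i _ => Finset.sum_congr rfl fun j _ =>
      Finset.sum_congr rfl fun l _ => ?_
    rw [hsi i j]
  have e4 : ∑ i, ∑ j, (g x)⁻¹ i j * christoffel g k i j x =
      1 / 2 * (∑ i, ∑ j, ∑ l, (g x)⁻¹ i j * (g x)⁻¹ k l * pd i (fun z => g z j l) x)
      + 1 / 2 * (∑ i, ∑ j, ∑ l, (g x)⁻¹ i j * (g x)⁻¹ k l * pd j (fun z => g z i l) x)
      - ∑ i, ∑ j, ∑ l, 1 / 2 * ((g x)⁻¹ i j * (g x)⁻¹ k l * pd l (fun z => g z i j) x) := by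
    simp only [christoffel, Finset.mul_sum, ← Finset.sum_add_distrib, ← Finset.sum_sub_distrib]
    refine Finset.sum_congr rfl fun i _ => Finset.sum_congr rfl fun j _ =>
      Finset.sum_congr rfl fun l _ => ?_
    ring
  rw [e1, e2, e4, ← e3]
  ring

lemma contDiffOn_gaugeD {hbar q : ℝ} {A : Fin n → (Fin n → ℝ) → ℝ} {f : (Fin n → ℝ) → ℂ}
    (hs : IsOpen s) (hA : ∀ i, ContDiffOn ℝ 1 (A i) s) (hf : ContDiffOn ℝ 2 f s) (j : Fin n) :
    ContDiffOn ℝ 1 (gaugeD hbar q A f j) s :=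
  (contDiffOn_const.mul (contDiffOn_pd hs hf (by norm_num) j)).sub
    ((contDiffOn_const.mul (contDiffOn_ofReal (hA j))).mul (hf.of_le (by norm_num)))

/-- The gauge covariant divergence `Σ_i (ħ ∂_i - i q A_i) V^i` of a vector density. -/
def gaugeDiv (hbar q : ℝ) (A : Fin n → (Fin n → ℝ) → ℝ) (V : Fin n → (Fin n → ℝ) → ℂ)
    (x : Fin n → ℝ) : ℂ :=
  ∑ i, gaugeD hbar q A (V i) i x

/-- By the product rule the divergence of the flux differs from the contracted second derivatives
only through the derivatives of the density, and `sum_pd_invDensity` identifies these with the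
contracted Christoffel term. Everything later is done with fluxes, so no Christoffel symbol is
computed for a Kaluza-Klein or rescaled metric. -/
lemma sqrt_det_mul_gaugeBox (hs : IsOpen s) (hg : ∀ i j, ContDiffOn ℝ 1 (fun z => g z i j) s)
    (hdet : ∀ z ∈ s, (g z).det ≠ 0) {x : Fin n → ℝ} (hx : x ∈ s) (hsymm : (g x).IsSymm)
    {hbar q : ℝ} {A : Fin n → (Fin n → ℝ) → ℝ} (hA : ∀ i, ContDiffOn ℝ 1 (A i) s)
    {f : (Fin n → ℝ) → ℂ} (hf : ContDiffOn ℝ 2 f s) :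
    (√|(g x).det| : ℂ) * gaugeBox hbar q A g f x =
      gaugeDiv hbar q A (fun i z => ∑ j, (invDensity g i j z : ℂ) * gaugeD hbar q A f j z) x := by
  have hHd : ∀ i j, DifferentiableAt ℝ (invDensity g i j) x := fun i j =>
    ((contDiffOn_invDensity (k := 1) hg hdet i j).contDiffAt (hs.mem_nhds hx)).differentiableAt
      one_ne_zero
  have hDd : ∀ j, DifferentiableAt ℝ (gaugeD hbar q A f j) x := fun j =>
    ((contDiffOn_gaugeD hs hA hf j).contDiffAt (hs.mem_nhds hx)).differentiableAt one_ne_zero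
  have h1 : ∀ i, pd i (fun z => ∑ j, (invDensity g i j z : ℂ) * gaugeD hbar q A f j z) x =
      ∑ j, (((pd i (invDensity g i j) x : ℝ) : ℂ) * gaugeD hbar q A f j x
        + (invDensity g i j x : ℂ) * pd i (gaugeD hbar q A f j) x) := by
    intro i
    rw [pd_sum fun j _ => DifferentiableAt.fun_mul (differentiableAt_ofReal (hHd i j)) (hDd j)]
    refine Finset.sum_congr rfl fun j _ => ?_
    rw [pd_mul (differentiableAt_ofReal (hHd i j)) (hDd j), pd_ofReal (hHd i j)]
  have h2 : ∀ k, ∑ i, ((pd i (invDensity g i k) x : ℝ) : ℂ) =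
      -((√|(g x).det| : ℂ) * ∑ i, ∑ j, ((g x)⁻¹ i j : ℂ) * (christoffel g k i j x : ℂ)) := by
    intro k
    have := congrArg (fun r : ℝ => (r : ℂ)) (sum_pd_invDensity hs hg hdet hx hsymm k)
    push_cast at this
    exact this
  have h3 : ∑ i, ∑ j, ((pd i (invDensity g i j) x : ℝ) : ℂ) * gaugeD hbar q A f j x =
      -((√|(g x).det| : ℂ) * ∑ i, ∑ j, ((g x)⁻¹ i j : ℂ) *
        ∑ k, (christoffel g k i j x : ℂ) * gaugeD hbar q A f k x) := by
    rw [Finset.sum_comm]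
    simp only [← Finset.sum_mul, h2]
    simp only [Finset.mul_sum, Finset.sum_mul, ← Finset.sum_neg_distrib]
    rw [Finset.sum_comm]
    refine Finset.sum_congr rfl fun i _ => ?_
    rw [Finset.sum_comm]
    refine Finset.sum_congr rfl fun j _ => Finset.sum_congr rfl fun k _ => ?_
    ring
  simp only [gaugeDiv, gaugeBox, covDeriv]
  have h4 : ∀ i, gaugeD hbar q A
      (fun z => ∑ j, (invDensity g i j z : ℂ) * gaugeD hbar q A f j z) i x =
      hbar * ∑ j, ((pd i (invDensity g i j) x : ℝ) : ℂ) * gaugeD hbar q A f j x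
      + ∑ j, (invDensity g i j x : ℂ) * (hbar * pd i (gaugeD hbar q A f j) x
        - Complex.I * q * A i x * gaugeD hbar q A f j x) := by
    intro i
    rw [gaugeD, h1]
    simp only [Finset.mul_sum, ← Finset.sum_add_distrib, ← Finset.sum_sub_distrib]
    refine Finset.sum_congr rfl fun j _ => ?_
    ring
  simp only [h4, Finset.sum_add_distrib]
  rw [← Finset.mul_sum, h3]
  simp only [invDensity, Finset.mul_sum, ← Finset.sum_add_distrib, ← Finset.sum_neg_distrib]
  refine Finset.sum_congr rfl fun i _ => Finset.sum_congr rfl fun j _ => ?_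
  push_cast
  rw [← Finset.mul_sum]
  simp only [← Finset.mul_sum, Finset.sum_neg_distrib]
  ring

lemma gaugeD_one_zero (A : Fin n → (Fin n → ℝ) → ℝ) (f : (Fin n → ℝ) → ℂ) (j : Fin n) :
    gaugeD 1 0 A f j = pd j f := by
  ext x; simp [gaugeD]

lemma gaugeBox_one_zero (A : Fin n → (Fin n → ℝ) → ℝ)
    (g : (Fin n → ℝ) → Matrix (Fin n) (Fin n) ℝ) (f : (Fin n → ℝ) → ℂ) (x : Fin n → ℝ) :
    gaugeBox 1 0 A g f x = box g f x := by
  have : gaugeD 1 0 A f = fun l => pd l f := by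
    ext j x; simp [gaugeD]
  simp [gaugeBox, box, this]

lemma sqrt_det_mul_box (hs : IsOpen s) (hg : ∀ i j, ContDiffOn ℝ 1 (fun z => g z i j) s)
    (hdet : ∀ z ∈ s, (g z).det ≠ 0) {x : Fin n → ℝ} (hx : x ∈ s) (hsymm : (g x).IsSymm)
    {f : (Fin n → ℝ) → ℂ} (hf : ContDiffOn ℝ 2 f s) :
    (√|(g x).det| : ℂ) * box g f x =
      ∑ i, pd i (fun z => ∑ j, (invDensity g i j z : ℂ) * pd j f z) x := by
  -- With ħ = 1 and q = 0 the gauge derivative is the partial derivative, so the charged computation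
  -- also covers the neutral field on the bundle.
  have h := sqrt_det_mul_gaugeBox hs hg hdet hx hsymm (hbar := 1) (q := 0) (A := 0)
    (fun _ => contDiffOn_const) hf
  simpa only [gaugeBox_one_zero, gaugeDiv, gaugeD_one_zero] using h

end Divergence

/-! ### The Euler-Lagrange equation of the conformal factor -/

section Variation

variable {n : ℕ} {s : Set (Fin n → ℝ)}

lemma integrable_mul_of_tsupport_subset {f g : (Fin n → ℝ) → ℝ} (hf : ContinuousOn f s)
    (hg : Continuous g) (hc : HasCompactSupport g) (hsub : tsupport g ⊆ s) :
    Integrable (fun x => f x * g x) := by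
  rw [← integrableOn_iff_integrable_of_support_subset (s := tsupport g)]
  · exact ((hf.mono hsub).mul hg.continuousOn).integrableOn_compact hc
  · exact fun x hx => subset_tsupport _ (right_ne_zero_of_mul hx)

lemma tsupport_pd_subset (i : Fin n) (f : (Fin n → ℝ) → ℝ) : tsupport (pd i f) ⊆ tsupport f := by
  refine closure_minimal (fun x hx => ?_) isClosed_closure
  refine support_fderiv_subset ℝ (f := f) ?_
  intro h
  exact hx (by simp [pd, h])

/-- There is no boundary term because `g` is compactly supported inside `s`. Nothing is required of
`f` outside `s`. -/
lemma integral_mul_pd_eq_neg {f g : (Fin n → ℝ) → ℝ} (hs : IsOpen s) (hf : ContDiffOn ℝ 1 f s)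
    (hg : ContDiff ℝ ∞ g) (hc : HasCompactSupport g) (hsub : tsupport g ⊆ s) (i : Fin n) :
    ∫ x, f x * pd i g x = -∫ x, pd i f x * g x := by
  have hpg : Continuous (pd i g) := (hg.continuous_fderiv (by simp)).clm_apply continuous_const
  refine integral_mul_fderiv_eq_neg_fderiv_mul_of_integrable ?_ ?_ ?_ ?_ ?_
  · exact integrable_mul_of_tsupport_subset
      (contDiffOn_pd (l := 0) hs hf (by norm_num) i).continuousOn hg.continuous hc hsub
  · exact integrable_mul_of_tsupport_subset hf.continuousOn hpg
      (hc.of_isClosed_subset (isClosed_tsupport _) (tsupport_pd_subset i g))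
      ((tsupport_pd_subset i g).trans hsub)
  · exact integrable_mul_of_tsupport_subset hf.continuousOn hg.continuous hc hsub
  · exact fun x hx => (hf.contDiffAt (hs.mem_nhds (hsub hx))).differentiableAt one_ne_zero
  · exact fun x _ => (hg.differentiable (by simp)) x

/-- The fundamental lemma of the calculus of variations for a first-order integrand. -/
lemma eq_sum_pd_of_forall_integral_eq_zero (hs : IsOpen s) {V : Fin n → (Fin n → ℝ) → ℝ}
    (hV : ∀ i, ContDiffOn ℝ 1 (V i) s) {Q : (Fin n → ℝ) → ℝ} (hQ : ContinuousOn Q s)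
    (h : ∀ η : (Fin n → ℝ) → ℝ, ContDiff ℝ ∞ η → HasCompactSupport η → tsupport η ⊆ s →
      ∫ x in tsupport η, ((∑ i, V i x * pd i η x) + Q x * η x) = 0) {x : Fin n → ℝ} (hx : x ∈ s) :
    Q x = ∑ i, pd i (V i) x := by
  have hpV := fun i => (contDiffOn_pd (l := 0) hs (hV i) (by norm_num) i).continuousOn
  have hcont : ContinuousOn (fun x => Q x - ∑ i, pd i (V i) x) s :=
    hQ.sub (continuousOn_finsetSum _ fun i _ => hpV i)
  have h0 : ∀ᵐ x, x ∈ s → Q x - ∑ i, pd i (V i) x = 0 := by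
    refine hs.ae_eq_zero_of_integral_contDiff_smul_eq_zero
      (hcont.locallyIntegrableOn hs.measurableSet) fun η hη hc hsub => ?_
    have hpη : ∀ i, Continuous (pd i η) := fun i =>
      (hη.continuous_fderiv (by simp)).clm_apply continuous_const
    have i1 : ∀ i, Integrable fun x => V i x * pd i η x := fun i =>
      integrable_mul_of_tsupport_subset (hV i).continuousOn (hpη i)
        (hc.of_isClosed_subset (isClosed_tsupport _) (tsupport_pd_subset i η))
        ((tsupport_pd_subset i η).trans hsub)
    have i2 : Integrable fun x => Q x * η x :=
      integrable_mul_of_tsupport_subset hQ hη.continuous hc hsub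
    have i3 : ∀ i, Integrable fun x => pd i (V i) x * η x := fun i =>
      integrable_mul_of_tsupport_subset (hpV i) hη.continuous hc hsub
    have h1 := h η hη hc hsub
    -- Off the support of `η` both `η` and its partial derivatives vanish, so the integral may be
    -- taken over the whole space.
    rw [setIntegral_eq_integral_of_forall_compl_eq_zero] at h1
    · rw [integral_add (integrable_finsetSum _ fun i _ => i1 i) i2,
        integral_finsetSum _ fun i _ => i1 i] at h1
      simp only [fun i => integral_mul_pd_eq_neg hs (hV i) hη hc hsub i] at h1
      have h2 : ∀ x, η x • (Q x - ∑ i, pd i (V i) x) = Q x * η x - ∑ i, pd i (V i) x * η x := by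
        intro x
        rw [smul_eq_mul, ← Finset.sum_mul]; ring
      simp only [h2]
      rw [integral_sub i2 (integrable_finsetSum _ fun i _ => i3 i),
        integral_finsetSum _ fun i _ => i3 i]
      rw [Finset.sum_neg_distrib] at h1
      linarith
    · intro x hx
      have e1 : η x = 0 := image_eq_zero_of_notMem_tsupport hx
      have e2 : ∀ i, pd i η x = 0 := fun i =>
        image_eq_zero_of_notMem_tsupport fun h => hx (tsupport_pd_subset i η h)
      simp [e1, e2]
  have h1 : Set.EqOn (fun x => Q x - ∑ i, pd i (V i) x) (fun _ => 0) s :=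
    Measure.eqOn_open_of_ae_eq ((ae_restrict_iff' hs.measurableSet).2 h0) hs hcont
      continuousOn_const
  exact sub_eq_zero.1 (h1 hx)

/-- The action at α + tη is a polynomial of degree four in t. Its first variation is the linear
coefficient, and no differentiation under the integral is needed. -/
lemma eq_zero_of_hasDerivAt_quartic {c₀ c₁ c₂ c₃ c₄ : ℝ}
    (h : HasDerivAt (fun t : ℝ => c₀ + t * c₁ + t ^ 2 * c₂ + t ^ 3 * c₃ + t ^ 4 * c₄) 0 0) :
    c₁ = 0 := by
  have h1 : HasDerivAt (fun t : ℝ => c₀ + t * c₁ + t ^ 2 * c₂ + t ^ 3 * c₃ + t ^ 4 * c₄) c₁ 0 := by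
    have := (((((hasDerivAt_id' (0 : ℝ)).mul_const c₁).const_add c₀).fun_add
      (((hasDerivAt_id' (0 : ℝ)).fun_pow 2).mul_const c₂)).fun_add
      (((hasDerivAt_id' (0 : ℝ)).fun_pow 3).mul_const c₃)).fun_add
      (((hasDerivAt_id' (0 : ℝ)).fun_pow 4).mul_const c₄)
    simpa using this
  exact h1.unique h

variable {N : Type*} [TopologicalSpace N] [ChartedSpace (EuclideanSpace ℝ (Fin n)) N]

lemma IsStationaryPoint.euler_lagrange {hbar : ℝ} {g : BilinField n N} {W α : N → ℝ}
    (h : IsStationaryPoint hbar g W α) (c : CoordSystem n N)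
    (hg : ∀ i j, ContDiffOn ℝ 1 (fun z => g.comp c z i j) c.dom)
    (hdet : ∀ z ∈ c.dom, (g.comp c z).det ≠ 0) (hsymm : ∀ z ∈ c.dom, (g.comp c z).IsSymm)
    (hW : ContinuousOn (fun z => W (c.param z)) c.dom)
    (hα : ContDiffOn ℝ 2 (fun z => α (c.param z)) c.dom) {x : Fin n → ℝ} (hx : x ∈ c.dom) :
    hbar ^ 2 * ∑ i, pd i (fun z => ∑ j, invDensity (g.comp c) i j z *
        pd j (fun z => α (c.param z)) z) x =
      √|(g.comp c x).det| * (α (c.param x) ^ 3 - W (c.param x) * α (c.param x)) := by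
  set a := fun z => α (c.param z) with ha
  set w := fun z => √|(g.comp c z).det| with hw
  set H := invDensity (g.comp c) with hH
  have hHc : ∀ i j, ContDiffOn ℝ 1 (H i j) c.dom := contDiffOn_invDensity (k := 1) hg hdet
  have hpa : ∀ i, ContDiffOn ℝ 1 (pd i a) c.dom :=
    contDiffOn_pd c.isOpen_dom hα (by norm_num)
  have hV : ∀ i, ContDiffOn ℝ 1 (fun z => ∑ j, H i j z * pd j a z) c.dom := fun i =>
    ContDiffOn.sum fun j _ => (hHc i j).mul (hpa j)
  have hwc : ContinuousOn w c.dom := (contDiffOn_sqrt_abs_det (k := 1) hg hdet).continuousOn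
  have hac := hα.continuousOn
  have key := eq_sum_pd_of_forall_integral_eq_zero c.isOpen_dom
    (V := fun i z => hbar ^ 2 * ∑ j, H i j z * pd j a z) (fun i => contDiffOn_const.mul (hV i))
    (Q := fun z => w z * (a z ^ 3 - W (c.param z) * a z))
    (hwc.mul ((hac.pow 3).sub (hW.mul hac))) ?_ hx
  · rw [Finset.mul_sum]
    refine Eq.trans (Finset.sum_congr rfl fun i _ => ?_) key.symm
    rw [pd_const_mul]
    exact ((hV i).contDiffAt (c.isOpen_dom.mem_nhds hx)).differentiableAt one_ne_zero
  · intro η hη hc hsub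
    -- The compact region is taken to be the support of the variation itself.
    have hd := h c (tsupport η) hc hsub η hη subset_rfl
    have hpη : ∀ i, Continuous (pd i η) := fun i =>
      (hη.continuous_fderiv (by simp)).clm_apply continuous_const
    have hηc := hη.continuous
    -- The coefficients of 1, t, …, t⁴ in the Lagrangian density at α + tη. Only `P₁`, linear in η
    -- and its partial derivatives, enters the conclusion.
    let P₀ := fun z => hbar ^ 2 / 2 * (∑ i, ∑ j, H i j z * pd i a z * pd j a z)
      + w z * (-(W (c.param z) / 2 * a z ^ 2) + 1 / 4 * a z ^ 4)
    let P₁ := fun z => (∑ i, (hbar ^ 2 * ∑ j, H i j z * pd j a z) * pd i η z)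
      + w z * (a z ^ 3 - W (c.param z) * a z) * η z
    let P₂ := fun z => hbar ^ 2 / 2 * (∑ i, ∑ j, H i j z * pd i η z * pd j η z)
      + w z * (-(W (c.param z) / 2 * η z ^ 2) + 3 / 2 * a z ^ 2 * η z ^ 2)
    let P₃ := fun z => w z * (a z * η z ^ 3)
    let P₄ := fun z => w z * (1 / 4 * η z ^ 4)
    have hexp : ∀ t : ℝ, ∀ z ∈ tsupport η,
        quarticLagrangian hbar g W c (fun z => α (c.param z) + t * η z) z =
          P₀ z + t * P₁ z + t ^ 2 * P₂ z + t ^ 3 * P₃ z + t ^ 4 * P₄ z := by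
      intro t z hz
      have hzd := hsub hz
      have hpd : ∀ i, pd i (fun z => α (c.param z) + t * η z) z = pd i a z + t * pd i η z := by
        intro i
        rw [pd_add ((hα.contDiffAt (c.isOpen_dom.mem_nhds hzd)).differentiableAt two_ne_zero)
          ((hη.differentiable (by simp) z).const_mul t),
          pd_const_mul (hη.differentiable (by simp) z)]
      have hsum : w z * (∑ i, ∑ j, (g.comp c z)⁻¹ i j * (pd i a z + t * pd i η z) *
            (pd j a z + t * pd j η z)) =
          (∑ i, ∑ j, H i j z * pd i a z * pd j a z)
          + t * (2 * ∑ i, (∑ j, H i j z * pd j a z) * pd i η z)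
          + t ^ 2 * ∑ i, ∑ j, H i j z * pd i η z * pd j η z := by
        -- By symmetry of the metric the two mixed terms of the kinetic form agree, whence the
        -- factor 2 in `hsum`.
        have hs1 : ∑ i, (∑ j, H i j z * pd j a z) * pd i η z
            = ∑ i, ∑ j, H i j z * pd i a z * pd j η z := by
          simp only [Finset.sum_mul]
          rw [Finset.sum_comm]
          refine Finset.sum_congr rfl fun i _ => Finset.sum_congr rfl fun j _ => ?_
          rw [hH, invDensity_symm (hsymm z hzd) i j]
        rw [two_mul]
        nth_rewrite 1 [hs1]
        simp only [Finset.sum_mul, Finset.mul_sum, ← Finset.sum_add_distrib]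
        refine Finset.sum_congr rfl fun i _ => Finset.sum_congr rfl fun j _ => ?_
        simp only [hH, hw, invDensity]
        ring
      simp only [quarticLagrangian, hpd]
      change w z * (hbar ^ 2 / 2 * _ - W (c.param z) / 2 * (a z + t * η z) ^ 2
        + 1 / 4 * (a z + t * η z) ^ 4) = _
      have hsum2 : ∑ i, (hbar ^ 2 * ∑ j, H i j z * pd j a z) * pd i η z
          = hbar ^ 2 * ∑ i, (∑ j, H i j z * pd j a z) * pd i η z := by
        rw [Finset.mul_sum]
        exact Finset.sum_congr rfl fun i _ => by ring
      simp only [P₀, P₁, P₂, P₃, P₄, hsum2]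
      linear_combination hbar ^ 2 / 2 * hsum
    have hHc' := fun i j => (hHc i j).continuousOn
    have hpa' := fun i => (hpa i).continuousOn
    have int : ∀ {f : (Fin n → ℝ) → ℝ}, ContinuousOn f c.dom → IntegrableOn f (tsupport η) :=
      fun hf => (hf.mono hsub).integrableOn_compact hc
    have i0 : IntegrableOn P₀ (tsupport η) := int <| (continuousOn_const.mul <|
      continuousOn_finsetSum _ fun i _ => continuousOn_finsetSum _ fun j _ => by fun_prop).add
      (hwc.mul (((hW.div_const 2).mul (hac.pow 2)).neg.add (by fun_prop)))
    have i1 : IntegrableOn P₁ (tsupport η) := int <| (continuousOn_finsetSum _ fun i _ =>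
      (continuousOn_const.mul <| continuousOn_finsetSum _ fun j _ => by fun_prop).mul
        (hpη i).continuousOn).add
      ((hwc.mul ((hac.pow 3).sub (hW.mul hac))).mul hηc.continuousOn)
    have i2 : IntegrableOn P₂ (tsupport η) := int <| (continuousOn_const.mul <|
      continuousOn_finsetSum _ fun i _ => continuousOn_finsetSum _ fun j _ => by fun_prop).add
      (hwc.mul (((hW.div_const 2).mul (hηc.continuousOn.pow 2)).neg.add (by fun_prop)))
    have i3 : IntegrableOn P₃ (tsupport η) := int (by fun_prop)
    have i4 : IntegrableOn P₄ (tsupport η) := int (by fun_prop)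
    refine eq_zero_of_hasDerivAt_quartic (c₀ := ∫ z in tsupport η, P₀ z)
      (c₁ := ∫ z in tsupport η, P₁ z) (c₂ := ∫ z in tsupport η, P₂ z)
      (c₃ := ∫ z in tsupport η, P₃ z) (c₄ := ∫ z in tsupport η, P₄ z) ?_
    convert! hd using 2 with t
    have j1 : IntegrableOn (fun z => P₀ z + t * P₁ z) (tsupport η) := i0.add (i1.const_mul t)
    have j2 : IntegrableOn (fun z => P₀ z + t * P₁ z + t ^ 2 * P₂ z) (tsupport η) :=
      j1.add (i2.const_mul _)
    have j3 : IntegrableOn (fun z => P₀ z + t * P₁ z + t ^ 2 * P₂ z + t ^ 3 * P₃ z)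
      (tsupport η) := j2.add (i3.const_mul _)
    rw [setIntegral_congr_fun (isClosed_tsupport η).measurableSet (hexp t),
      integral_add j3 (i4.const_mul _), integral_add j2 (i3.const_mul _),
      integral_add j1 (i2.const_mul _), integral_add i0 (i1.const_mul _), integral_const_mul, integral_const_mul,
      integral_const_mul, integral_const_mul]

end Variation

/-! ### Linear algebra of base and fiber coordinates -/

section FiberCoordinates

variable {n : ℕ}

/-- The point of `ℝ × ℝⁿ = ℝⁿ⁺¹` with fiber coordinate `y` and base point `x`. -/
def fiberPoint (y : ℝ) (x : Fin n → ℝ) : Fin (n + 1) → ℝ := Fin.cons y x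

@[simp] lemma fiberPoint_zero (y : ℝ) (x : Fin n → ℝ) : fiberPoint y x 0 = y := rfl

@[simp] lemma fiberPoint_succ (y : ℝ) (x : Fin n → ℝ) (i : Fin n) :
    fiberPoint y x i.succ = x i := rfl

/-- The projection `ℝⁿ⁺¹ → ℝⁿ` to the base point. -/
def basePoint (n : ℕ) : (Fin (n + 1) → ℝ) →L[ℝ] (Fin n → ℝ) :=
  ContinuousLinearMap.pi fun i => ContinuousLinearMap.proj i.succ

@[simp] lemma basePoint_apply (z : Fin (n + 1) → ℝ) (i : Fin n) : basePoint n z i = z i.succ := rfl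

@[simp] lemma basePoint_fiberPoint (y : ℝ) (x : Fin n → ℝ) : basePoint n (fiberPoint y x) = x := rfl

lemma fiberPoint_basePoint (z : Fin (n + 1) → ℝ) : fiberPoint (z 0) (basePoint n z) = z := by
  ext i
  induction i using Fin.cases <;> simp

/-- The inclusion `ℝⁿ → ℝⁿ⁺¹` of the base. -/
def baseIncl (n : ℕ) : (Fin n → ℝ) →L[ℝ] (Fin (n + 1) → ℝ) :=
  ContinuousLinearMap.pi (Fin.cases 0 fun i => ContinuousLinearMap.proj i)

lemma baseIncl_apply (v : Fin n → ℝ) : baseIncl n v = fiberPoint 0 v := by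
  ext i
  induction i using Fin.cases <;> simp [baseIncl]

lemma fiberPoint_eq (y : ℝ) (x : Fin n → ℝ) :
    fiberPoint y x = y • Pi.single 0 1 + baseIncl n x := by
  ext i
  induction i using Fin.cases <;> simp [baseIncl]

lemma baseIncl_single (i : Fin n) : baseIncl n (Pi.single i 1) = Pi.single i.succ 1 := by
  rw [baseIncl_apply]
  ext j
  induction j using Fin.cases with
  | zero => simp
  | succ j => by_cases h : j = i <;> simp [h]

lemma basePoint_single_zero : basePoint n (Pi.single 0 1) = 0 := by
  ext i; simp

lemma basePoint_single_succ (i : Fin n) : basePoint n (Pi.single i.succ 1) = Pi.single i 1 := by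
  ext j
  by_cases h : j = i <;> simp [h]

lemma norm_baseIncl_le : ‖baseIncl n‖ ≤ 1 := by
  refine ContinuousLinearMap.opNorm_le_bound _ zero_le_one fun v => ?_
  rw [one_mul, baseIncl_apply, pi_norm_le_iff_of_nonneg (norm_nonneg _)]
  intro i
  induction i using Fin.cases with
  | zero => simp
  | succ i => exact norm_le_pi_norm v i

lemma norm_basePoint_le : ‖basePoint n‖ ≤ 1 := by
  refine ContinuousLinearMap.opNorm_le_bound _ zero_le_one fun v => ?_
  rw [one_mul, pi_norm_le_iff_of_nonneg (norm_nonneg _)]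
  exact fun i => norm_le_pi_norm v i.succ

lemma continuous_fiberPoint : Continuous fun p : ℝ × (Fin n → ℝ) => fiberPoint p.1 p.2 :=
  Continuous.finCons (A := fun _ => ℝ) continuous_fst continuous_snd

lemma hasFDerivAt_fiberPoint (y : ℝ) (x : Fin n → ℝ) :
    HasFDerivAt (fun x => fiberPoint y x) (baseIncl n) x := by
  simp only [fiberPoint_eq]
  exact (baseIncl n).hasFDerivAt.const_add _

lemma hasDerivAt_fiberPoint (y : ℝ) (x : Fin n → ℝ) :
    HasDerivAt (fun y => fiberPoint y x) (Pi.single 0 1) y := by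
  simp only [fiberPoint_eq]
  simpa using ((hasDerivAt_id y).smul_const (Pi.single (0 : Fin (n + 1)) (1 : ℝ))).add_const
    (baseIncl n x)

variable {F : Type*} [NormedAddCommGroup F] [NormedSpace ℝ F]

lemma pd_zero_comp_basePoint {h : (Fin n → ℝ) → F} {z : Fin (n + 1) → ℝ}
    (hh : DifferentiableAt ℝ h (basePoint n z)) : pd 0 (fun z => h (basePoint n z)) z = 0 := by
  have := (hh.hasFDerivAt.comp z (basePoint n).hasFDerivAt).fderiv
  simp only [Function.comp_def] at this
  rw [pd, this, ContinuousLinearMap.comp_apply, basePoint_single_zero, map_zero]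

end FiberCoordinates

/-! ### Regularity and domination along the fibers -/

/-- A fundamental domain of the action of the periods on the fiber. -/
def StructureGroup.fiberDomain : StructureGroup → Set ℝ
  | T1 => Set.univ
  | U1 => Set.Ioc 0 (2 * Real.pi)

lemma StructureGroup.measurableSet_fiberDomain (G : StructureGroup) :
    MeasurableSet G.fiberDomain := by
  cases G
  · exact MeasurableSet.univ
  · exact measurableSet_Ioc

/-- `u` is a `C¹` function on the fibers over `D`, periodic along them, which together with its
differential is integrable along the fibers, locally uniformly in the base point. -/
structure FiberRegular {n : ℕ} (G : StructureGroup) (D : Set (Fin n → ℝ))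
    (u : (Fin (n + 1) → ℝ) → ℂ) : Prop where
  contDiffOn : ContDiffOn ℝ 1 u (basePoint n ⁻¹' D)
  dominated : ∀ x₀ ∈ D, ∃ b : ℝ → ℝ, IntegrableOn b G.fiberDomain ∧
    ∀ᶠ x in 𝓝 x₀, ∀ y ∈ G.fiberDomain,
      ‖u (fiberPoint y x)‖ ≤ b y ∧ ‖fderiv ℝ u (fiberPoint y x)‖ ≤ b y
  periodic : ∀ p ∈ G.periods, ∀ x ∈ D, ∀ y : ℝ, u (fiberPoint (y + p) x) = u (fiberPoint y x)

namespace FiberRegular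

variable {n : ℕ} {G : StructureGroup} {D : Set (Fin n → ℝ)} {u v : (Fin (n + 1) → ℝ) → ℂ}

lemma isOpen_preimage (hD : IsOpen D) : IsOpen (basePoint n ⁻¹' D) :=
  hD.preimage (basePoint n).continuous

lemma differentiableAt (hu : FiberRegular G D u) (hD : IsOpen D) {z : Fin (n + 1) → ℝ}
    (hz : basePoint n z ∈ D) : DifferentiableAt ℝ u z :=
  (hu.contDiffOn.contDiffAt ((isOpen_preimage hD).mem_nhds hz)).differentiableAt one_ne_zero

lemma zero : FiberRegular G D (fun _ => 0) where
  contDiffOn := contDiffOn_const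
  dominated := fun _ _ => ⟨fun _ => 0, integrableOn_zero, by simp⟩
  periodic := by simp

lemma add (hD : IsOpen D) (hu : FiberRegular G D u) (hv : FiberRegular G D v) :
    FiberRegular G D (fun z => u z + v z) where
  contDiffOn := hu.contDiffOn.add hv.contDiffOn
  dominated := by
    intro x₀ hx₀
    obtain ⟨b, hb, hbu⟩ := hu.dominated x₀ hx₀
    obtain ⟨c, hc, hcv⟩ := hv.dominated x₀ hx₀
    refine ⟨fun y => b y + c y, hb.add hc, ?_⟩
    filter_upwards [hbu, hcv, hD.mem_nhds hx₀] with x h1 h2 hx y hy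
    refine ⟨(norm_add_le _ _).trans (add_le_add (h1 y hy).1 (h2 y hy).1), ?_⟩
    rw [fderiv_fun_add (hu.differentiableAt hD hx) (hv.differentiableAt hD hx)]
    exact (norm_add_le _ _).trans (add_le_add (h1 y hy).2 (h2 y hy).2)
  periodic := fun p hp x hx y => by rw [hu.periodic p hp x hx, hv.periodic p hp x hx]

lemma sum (hD : IsOpen D) {ι : Type*} {s : Finset ι} {u : ι → (Fin (n + 1) → ℝ) → ℂ}
    (hu : ∀ i ∈ s, FiberRegular G D (u i)) : FiberRegular G D (fun z => ∑ i ∈ s, u i z) := by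
  classical
  induction s using Finset.induction_on with
  | empty => simpa using zero
  | insert a s ha ih =>
    simp only [Finset.sum_insert ha]
    exact (hu a (Finset.mem_insert_self a s)).add hD
      (ih fun i hi => hu i (Finset.mem_insert_of_mem hi))

lemma base_mul (hD : IsOpen D) {h : (Fin n → ℝ) → ℂ} (hh : ContDiffOn ℝ 1 h D)
    (hu : FiberRegular G D u) : FiberRegular G D (fun z => h (basePoint n z) * u z) where
  contDiffOn := (hh.comp (basePoint n).contDiff.contDiffOn fun _ hz => hz).mul hu.contDiffOn
  dominated := by
    intro x₀ hx₀
    obtain ⟨b, hb, hbu⟩ := hu.dominated x₀ hx₀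
    have hD₀ := hD.mem_nhds hx₀
    have hf : ContinuousAt (fderiv ℝ h) x₀ :=
      (hh.continuousOn_fderiv_of_isOpen hD le_rfl).continuousAt hD₀
    have hc : ContinuousAt h x₀ := hh.continuousOn.continuousAt hD₀
    set C := ‖h x₀‖ + 1
    set C' := ‖fderiv ℝ h x₀‖ + 1
    -- By continuity `C` and `C'` bound `h` and its differential near `x₀`. The product rule for the
    -- differential needs both of them.
    refine ⟨fun y => (C + C') * b y, hb.const_mul _, ?_⟩
    filter_upwards [hbu, hD₀, hc.norm.eventually_le_const (lt_add_one ‖h x₀‖),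
      hf.norm.eventually_le_const (lt_add_one ‖fderiv ℝ h x₀‖)] with x h1 hx hC hC' y hy
    obtain ⟨h2, h3⟩ := h1 y hy
    have hb0 : 0 ≤ b y := (norm_nonneg _).trans h2
    have hC0 : 0 ≤ C := by positivity
    have hC0' : 0 ≤ C' := by positivity
    have hd : DifferentiableAt ℝ h x := (hh.contDiffAt (hD.mem_nhds hx)).differentiableAt
      one_ne_zero
    have hd' : HasFDerivAt (fun z => h (basePoint n z)) ((fderiv ℝ h x).comp (basePoint n))
        (fiberPoint y x) :=
      HasFDerivAt.comp (g := h) (fiberPoint y x) hd.hasFDerivAt (basePoint n).hasFDerivAt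
    constructor
    · rw [norm_mul]
      calc ‖h x‖ * ‖u (fiberPoint y x)‖ ≤ C * b y := by gcongr
        _ ≤ (C + C') * b y := by gcongr; linarith
    · rw [fderiv_fun_mul hd'.differentiableAt (hu.differentiableAt hD hx), hd'.fderiv]
      refine (norm_add_le _ _).trans ?_
      rw [norm_smul, norm_smul, add_mul]
      have h4 : ‖(fderiv ℝ h x).comp (basePoint n)‖ ≤ C' * 1 :=
        (ContinuousLinearMap.opNorm_comp_le _ _).trans (by gcongr; exact norm_basePoint_le)
      rw [mul_comm C' (b y)]
      rw [mul_one] at h4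
      gcongr
      exact hC
  periodic := fun p hp x hx y => by
    simp only [basePoint_fiberPoint, hu.periodic p hp x hx]

lemma continuous_fiber (hu : FiberRegular G D u) {x : Fin n → ℝ} (hx : x ∈ D) :
    Continuous fun y => u (fiberPoint y x) :=
  hu.contDiffOn.continuousOn.comp_continuous
    (continuous_fiberPoint.comp (by fun_prop : Continuous fun y : ℝ => (y, x))) fun _ => hx

lemma continuous_fderiv_fiber (hD : IsOpen D) (hu : FiberRegular G D u) {x : Fin n → ℝ}
    (hx : x ∈ D) : Continuous fun y => fderiv ℝ u (fiberPoint y x) :=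
  (hu.contDiffOn.continuousOn_fderiv_of_isOpen (isOpen_preimage hD) le_rfl).comp_continuous
    (continuous_fiberPoint.comp (by fun_prop : Continuous fun y : ℝ => (y, x))) fun _ => hx

lemma hasDerivAt_fiber (hD : IsOpen D) (hu : FiberRegular G D u) {x : Fin n → ℝ}
    (hx : x ∈ D) (y : ℝ) :
    HasDerivAt (fun y => u (fiberPoint y x)) (pd 0 u (fiberPoint y x)) y :=
  HasFDerivAt.comp_hasDerivAt (l := u) y (hu.differentiableAt hD hx).hasFDerivAt
    (hasDerivAt_fiberPoint y x)

end FiberRegular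

/-- The Fourier coefficient `κ ∫ u(x, y) e^{-iky} dy` along the fiber. -/
def fiberCoeff {n : ℕ} (G : StructureGroup) (κ : ℂ) (k : ℝ) (u : (Fin (n + 1) → ℝ) → ℂ)
    (x : Fin n → ℝ) : ℂ :=
  κ * ∫ y in G.fiberDomain, Complex.exp (-(Complex.I * k * y)) * u (fiberPoint y x)

/-! ### Fourier coefficients along the fiber -/

section Coeff

variable {n : ℕ} {G : StructureGroup} {D : Set (Fin n → ℝ)} {u v : (Fin (n + 1) → ℝ) → ℂ}
  {κ : ℂ} {k : ℝ}

lemma norm_exp_neg_I_mul (k y : ℝ) : ‖Complex.exp (-(Complex.I * k * y))‖ = 1 := by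
  rw [show -(Complex.I * k * y) = ((-(k * y) : ℝ) : ℂ) * Complex.I by push_cast; ring]
  exact Complex.norm_exp_ofReal_mul_I _

lemma continuous_exp_neg_I_mul (k : ℝ) :
    Continuous fun y : ℝ => Complex.exp (-(Complex.I * k * y)) := by fun_prop

lemma integrableOn_exp_mul {f : ℝ → ℂ} {b : ℝ → ℝ} (hf : Continuous f)
    (hb : IntegrableOn b G.fiberDomain) (hfb : ∀ y ∈ G.fiberDomain, ‖f y‖ ≤ b y) :
    IntegrableOn (fun y : ℝ => Complex.exp (-(Complex.I * k * y)) * f y) G.fiberDomain := by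
  refine hb.mono' ((continuous_exp_neg_I_mul k).mul hf).aestronglyMeasurable ?_
  refine (ae_restrict_iff' G.measurableSet_fiberDomain).2 (Filter.Eventually.of_forall ?_)
  intro y hy
  rw [norm_mul, norm_exp_neg_I_mul, one_mul]
  exact hfb y hy

/-- The Fourier integral of `u` along the fiber over `x` converges absolutely. -/
def FiberIntegrableAt (G : StructureGroup) (k : ℝ) (u : (Fin (n + 1) → ℝ) → ℂ) (x : Fin n → ℝ) :
    Prop :=
  IntegrableOn (fun y : ℝ => Complex.exp (-(Complex.I * k * y)) * u (fiberPoint y x))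
    G.fiberDomain

lemma FiberRegular.integrableAt (hu : FiberRegular G D u) {x : Fin n → ℝ} (hx : x ∈ D) :
    FiberIntegrableAt G k u x := by
  obtain ⟨b, hb, hbu⟩ := hu.dominated x hx
  exact integrableOn_exp_mul (hu.continuous_fiber hx) hb fun y hy => (hbu.self_of_nhds y hy).1

lemma FiberRegular.integrableAt_pd (hD : IsOpen D) (hu : FiberRegular G D u) {x : Fin n → ℝ}
    (hx : x ∈ D) (i : Fin (n + 1)) : FiberIntegrableAt G k (pd i u) x := by
  obtain ⟨b, hb, hbu⟩ := hu.dominated x hx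
  refine integrableOn_exp_mul ((hu.continuous_fderiv_fiber hD hx).clm_apply continuous_const) hb
    fun y hy => ?_
  refine ((fderiv ℝ u (fiberPoint y x)).le_opNorm _).trans ?_
  rw [Pi.norm_single, norm_one, mul_one]
  exact (hbu.self_of_nhds y hy).2

lemma FiberIntegrableAt.add {x : Fin n → ℝ} (hu : FiberIntegrableAt G k u x)
    (hv : FiberIntegrableAt G k v x) : FiberIntegrableAt G k (fun z => u z + v z) x := by
  simp only [FiberIntegrableAt, mul_add]
  exact Integrable.add hu hv

lemma FiberIntegrableAt.base_mul {x : Fin n → ℝ} (h : (Fin n → ℝ) → ℂ)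
    (hu : FiberIntegrableAt G k u x) :
    FiberIntegrableAt G k (fun z => h (basePoint n z) * u z) x := by
  simp only [FiberIntegrableAt, basePoint_fiberPoint, mul_left_comm _ (h x)]
  exact Integrable.const_mul hu _

lemma FiberIntegrableAt.sum {ι : Type*} {s : Finset ι} {u : ι → (Fin (n + 1) → ℝ) → ℂ}
    {x : Fin n → ℝ} (hu : ∀ i ∈ s, FiberIntegrableAt G k (u i) x) :
    FiberIntegrableAt G k (fun z => ∑ i ∈ s, u i z) x := by
  simp only [FiberIntegrableAt, Finset.mul_sum]
  exact integrable_finsetSum _ hu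

lemma fiberCoeff_congr {x : Fin n → ℝ} (h : ∀ y, u (fiberPoint y x) = v (fiberPoint y x)) :
    fiberCoeff G κ k u x = fiberCoeff G κ k v x := by
  simp only [fiberCoeff, h]

lemma fiberCoeff_add {x : Fin n → ℝ} (hu : FiberIntegrableAt G k u x)
    (hv : FiberIntegrableAt G k v x) : fiberCoeff G κ k (fun z => u z + v z) x =
      fiberCoeff G κ k u x + fiberCoeff G κ k v x := by
  simp only [fiberCoeff, mul_add]
  rw [integral_add hu hv, mul_add]

lemma fiberCoeff_sum {ι : Type*} {s : Finset ι} {u : ι → (Fin (n + 1) → ℝ) → ℂ}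
    {x : Fin n → ℝ} (hu : ∀ i ∈ s, FiberIntegrableAt G k (u i) x) :
    fiberCoeff G κ k (fun z => ∑ i ∈ s, u i z) x = ∑ i ∈ s, fiberCoeff G κ k (u i) x := by
  simp only [fiberCoeff, Finset.mul_sum]
  rw [integral_finsetSum _ hu, Finset.mul_sum]

lemma fiberCoeff_base_mul (h : (Fin n → ℝ) → ℂ) (u : (Fin (n + 1) → ℝ) → ℂ) (x : Fin n → ℝ) :
    fiberCoeff G κ k (fun z => h (basePoint n z) * u z) x = h x * fiberCoeff G κ k u x := by
  simp only [fiberCoeff, basePoint_fiberPoint, mul_left_comm _ (h x)]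
  rw [integral_const_mul]
  ring

/-- Differentiation under the integral. The phase has modulus one and the inclusion of the base has
norm at most one, so the bound for the differential of `u` dominates unchanged. The integrability is
recorded because evaluating the integral on a basis vector requires it. -/
lemma hasFDerivAt_fiberCoeff (hD : IsOpen D) (hu : FiberRegular G D u) {x₀ : Fin n → ℝ}
    (hx₀ : x₀ ∈ D) :
    IntegrableOn (fun y : ℝ => Complex.exp (-(Complex.I * k * y)) •
        (fderiv ℝ u (fiberPoint y x₀)).comp (baseIncl n)) G.fiberDomain ∧
    HasFDerivAt (fiberCoeff G κ k u) (κ • ∫ y in G.fiberDomain,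
      Complex.exp (-(Complex.I * k * y)) • (fderiv ℝ u (fiberPoint y x₀)).comp (baseIncl n)) x₀ := by
  obtain ⟨b, hb, hbu⟩ := hu.dominated x₀ hx₀
  have hnorm : ∀ x, (∀ y ∈ G.fiberDomain, ‖u (fiberPoint y x)‖ ≤ b y ∧
      ‖fderiv ℝ u (fiberPoint y x)‖ ≤ b y) → ∀ y ∈ G.fiberDomain,
      ‖Complex.exp (-(Complex.I * k * y)) • (fderiv ℝ u (fiberPoint y x)).comp (baseIncl n)‖
        ≤ b y := by
    intro x h y hy
    rw [norm_smul, norm_exp_neg_I_mul, one_mul]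
    refine (ContinuousLinearMap.opNorm_comp_le _ _).trans ?_
    calc _ ≤ ‖fderiv ℝ u (fiberPoint y x)‖ * 1 := by gcongr; exact norm_baseIncl_le
      _ ≤ b y := by rw [mul_one]; exact (h y hy).2
  have hmeas : AEStronglyMeasurable (fun y : ℝ => Complex.exp (-(Complex.I * k * y)) •
      (fderiv ℝ u (fiberPoint y x₀)).comp (baseIncl n)) (volume.restrict G.fiberDomain) :=
    ((continuous_exp_neg_I_mul k).smul
      ((hu.continuous_fderiv_fiber hD hx₀).clm_comp continuous_const)).aestronglyMeasurable
  constructor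
  · refine hb.mono' hmeas ((ae_restrict_iff' G.measurableSet_fiberDomain).2
      (Filter.Eventually.of_forall (hnorm x₀ hbu.self_of_nhds)))
  · refine HasFDerivAt.const_mul (hasFDerivAt_integral_of_dominated_of_fderiv_le
      (F := fun x (y : ℝ) => Complex.exp (-(Complex.I * k * y)) * u (fiberPoint y x))
      (F' := fun x (y : ℝ) => Complex.exp (-(Complex.I * k * y)) •
        (fderiv ℝ u (fiberPoint y x)).comp (baseIncl n))
      (hbu.and (hD.mem_nhds hx₀)) (bound := b) ?_ (hu.integrableAt hx₀) hmeas ?_ hb ?_) κ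
    · filter_upwards [hD.mem_nhds hx₀] with x hx
      exact ((continuous_exp_neg_I_mul k).mul (hu.continuous_fiber hx)).aestronglyMeasurable
    · exact (ae_restrict_iff' G.measurableSet_fiberDomain).2
        (Filter.Eventually.of_forall fun y hy x hx => hnorm x hx.1 y hy)
    · refine Filter.Eventually.of_forall fun y x hx => HasFDerivAt.const_mul ?_ _
      exact HasFDerivAt.comp (g := u) x
        (hu.differentiableAt hD (z := fiberPoint y x) hx.2).hasFDerivAt (hasFDerivAt_fiberPoint y x)

lemma pd_fiberCoeff (hD : IsOpen D) (hu : FiberRegular G D u) {x : Fin n → ℝ} (hx : x ∈ D)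
    (i : Fin n) : pd i (fiberCoeff G κ k u) x = fiberCoeff G κ k (pd i.succ u) x := by
  obtain ⟨h1, h2⟩ := hasFDerivAt_fiberCoeff (κ := κ) (k := k) hD hu hx
  rw [pd, h2.fderiv, smul_apply, ContinuousLinearMap.integral_apply h1, fiberCoeff]
  simp only [smul_apply, ContinuousLinearMap.comp_apply, baseIncl_single, smul_eq_mul, pd]

lemma contDiffOn_fiberCoeff (hD : IsOpen D) (hu : FiberRegular G D u) :
    ContDiffOn ℝ 1 (fiberCoeff G κ k u) D := by
  refine contDiffOn_of_pd (k := 0) hD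
    (fun x hx => (hasFDerivAt_fiberCoeff hD hu hx).2.differentiableAt) fun i => ?_
  rw [Nat.cast_zero, contDiffOn_zero]
  have : ContinuousOn (fiberCoeff G κ k (pd i.succ u)) D := by
    intro x₀ hx₀
    obtain ⟨b, hb, hbu⟩ := hu.dominated x₀ hx₀
    refine ContinuousAt.continuousWithinAt (ContinuousAt.mul continuousAt_const ?_)
    refine continuousAt_of_dominated (bound := b) ?_ ?_ hb ?_
    · filter_upwards [hD.mem_nhds hx₀] with x hx
      exact ((continuous_exp_neg_I_mul k).mul ((hu.continuous_fderiv_fiber hD hx).clm_apply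
        continuous_const)).aestronglyMeasurable
    · filter_upwards [hbu] with x hx
      refine (ae_restrict_iff' G.measurableSet_fiberDomain).2
        (Filter.Eventually.of_forall fun y hy => ?_)
      rw [norm_mul, norm_exp_neg_I_mul, one_mul, pd]
      refine ((fderiv ℝ u (fiberPoint y x)).le_opNorm _).trans ?_
      rw [Pi.norm_single, norm_one, mul_one]
      exact (hx y hy).2
    · refine Filter.Eventually.of_forall fun y => ContinuousAt.mul continuousAt_const ?_
      have h1 : ContinuousAt (fderiv ℝ u) (fiberPoint y x₀) :=
        (hu.contDiffOn.continuousOn_fderiv_of_isOpen (FiberRegular.isOpen_preimage hD)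
          le_rfl).continuousAt ((FiberRegular.isOpen_preimage hD).mem_nhds hx₀)
      exact (ContinuousAt.comp (f := fun x => fiberPoint y x) h1
        (hasFDerivAt_fiberPoint y x₀).continuousAt).clm_apply continuousAt_const
  exact this.congr fun x hx => pd_fiberCoeff hD hu hx i

/-- The partial derivatives are Fourier coefficients of the functions `pd i u`, which are themselves
regular along the fibers and hence have C¹ coefficients. -/
lemma contDiffOn_two_fiberCoeff (hD : IsOpen D) (hu : FiberRegular G D u)
    (hpu : ∀ i, FiberRegular G D (pd i u)) : ContDiffOn ℝ 2 (fiberCoeff G κ k u) D := by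
  have := contDiffOn_of_pd (k := 1) (f := fiberCoeff G κ k u) hD
    (fun x hx => (hasFDerivAt_fiberCoeff hD hu hx).2.differentiableAt) fun i =>
      (contDiffOn_fiberCoeff hD (hpu i.succ)).congr fun x hx => pd_fiberCoeff hD hu hx i
  norm_num at this
  exact this

/-- Integration by parts along the fiber. The integral of the total derivative vanishes: on the line
because the function and its derivative are integrable, on the circle because both `u` and the phase
are periodic. The latter is where the quantization `hk` of the charge is used. -/
lemma fiberCoeff_pd_zero (hD : IsOpen D) (hu : FiberRegular G D u) {x : Fin n → ℝ} (hx : x ∈ D)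
    (hk : ∀ p ∈ G.periods, Complex.exp (-(Complex.I * k * p)) = 1) :
    fiberCoeff G κ k (pd 0 u) x = Complex.I * k * fiberCoeff G κ k u x := by
  have hi : IntegrableOn (fun y : ℝ => Complex.exp (-(Complex.I * k * y)) * pd 0 u (fiberPoint y x))
      G.fiberDomain := hu.integrableAt_pd hD hx 0
  have hi0 : IntegrableOn (fun y : ℝ => Complex.exp (-(Complex.I * k * y)) *
      u (fiberPoint y x)) G.fiberDomain := hu.integrableAt hx
  have hderiv : ∀ y : ℝ, HasDerivAt
      (fun y : ℝ => Complex.exp (-(Complex.I * k * y)) * u (fiberPoint y x))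
      (-(Complex.I * k) * (Complex.exp (-(Complex.I * k * y)) * u (fiberPoint y x))
        + Complex.exp (-(Complex.I * k * y)) * pd 0 u (fiberPoint y x)) y := by
    intro y
    have h1 : HasDerivAt (fun y : ℝ => -(Complex.I * k * y)) (-(Complex.I * k)) y := by
      simpa using ((Complex.ofRealCLM.hasDerivAt (x := y)).const_mul (Complex.I * k)).fun_neg
    refine (h1.cexp.mul (hu.hasDerivAt_fiber hD hx y)).congr_deriv ?_
    ring
  have hi1 : IntegrableOn (fun y : ℝ =>
      -(Complex.I * k) * (Complex.exp (-(Complex.I * k * y)) * u (fiberPoint y x))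
        + Complex.exp (-(Complex.I * k * y)) * pd 0 u (fiberPoint y x)) G.fiberDomain :=
    (hi0.const_mul (-(Complex.I * k))).add hi
  have hint : ∫ y in G.fiberDomain,
      (-(Complex.I * k) * (Complex.exp (-(Complex.I * k * y)) * u (fiberPoint y x))
        + Complex.exp (-(Complex.I * k * y)) * pd 0 u (fiberPoint y x)) = 0 := by
    cases G with
    | T1 =>
      simp only [StructureGroup.fiberDomain, Measure.restrict_univ, integrableOn_univ] at hi1 hi0 ⊢
      exact integral_eq_zero_of_hasDerivAt_of_integrable hderiv hi1 hi0
    | U1 =>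
      have hp : (0 : ℝ) ≤ 2 * Real.pi := Real.two_pi_pos.le
      have hmem : 2 * Real.pi ∈ StructureGroup.U1.periods := AddSubgroup.mem_zmultiples _
      simp only [StructureGroup.fiberDomain] at hi1 ⊢
      rw [← intervalIntegral.integral_of_le hp,
        intervalIntegral.integral_eq_sub_of_hasDerivAt (fun y _ => hderiv y)
          ((intervalIntegrable_iff_integrableOn_Ioc_of_le hp).2 hi1), hk _ hmem]
      have := hu.periodic _ hmem x hx 0
      rw [zero_add] at this
      simp [this]
  rw [integral_add (hi0.const_mul _) hi, integral_const_mul] at hint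
  simp only [fiberCoeff]
  linear_combination κ * hint

end Coeff

/-! ### Fourier inversion along the fiber -/

section Inversion

open scoped FourierTransform

variable {hbar β : ℝ}

/-- The normalization of the Fourier coefficients along the fiber. -/
def StructureGroup.coeffNorm (hbar β : ℝ) : StructureGroup → ℂ
  | T1 => (|(hbar * β)⁻¹| : ℝ)
  | U1 => ((2 * Real.pi)⁻¹ : ℝ)

/-- The allowed charges are exactly those whose phase is a character of the quotient group: on U(1),
q/(ħβ) is an integer and a period is an integer multiple of 2π. -/
lemma exp_charge_period (hc : hbar * β ≠ 0) {G : StructureGroup} {q : ℝ}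
    (hq : q ∈ G.charges hbar β) {p : ℝ} (hp : p ∈ G.periods) :
    Complex.exp (-(Complex.I * (q / (hbar * β) : ℝ) * p)) = 1 := by
  cases G with
  | T1 =>
    have : p = 0 := by simpa [StructureGroup.periods] using hp
    simp [this]
  | U1 =>
    obtain ⟨k, rfl⟩ := hq
    obtain ⟨l, rfl⟩ := AddSubgroup.mem_zmultiples_iff.1 hp
    rw [mul_div_cancel_right₀ _ hc, Complex.exp_eq_one_iff]
    exact ⟨-(k * l), by push_cast [zsmul_eq_mul]; ring⟩

lemma integral_exp_int (j k : ℤ) :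
    ∫ y in Set.Ioc 0 (2 * Real.pi),
      Complex.exp (-(Complex.I * (j : ℝ) * y)) * Complex.exp (Complex.I * (k * y : ℝ)) =
      if k = j then ((2 * Real.pi : ℝ) : ℂ) else 0 := by
  have h : ∀ y : ℝ, Complex.exp (-(Complex.I * (j : ℝ) * y)) * Complex.exp (Complex.I * (k * y : ℝ))
      = Complex.exp (Complex.I * (k - j : ℤ) * y) := by
    intro y
    rw [← Complex.exp_add]
    congr 1
    push_cast
    ring
  simp only [h]
  rw [← intervalIntegral.integral_of_le Real.two_pi_pos.le]
  split_ifs with hkj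
  · simp [hkj]
  · have h0 : Complex.I * (k - j : ℤ) ≠ 0 :=
      mul_ne_zero Complex.I_ne_zero (Int.cast_ne_zero.2 (sub_ne_zero.2 hkj))
    rw [integral_exp_mul_complex h0]
    have : Complex.exp (Complex.I * (k - j : ℤ) * (2 * Real.pi : ℝ)) = 1 := by
      rw [Complex.exp_eq_one_iff]
      exact ⟨k - j, by push_cast; ring⟩
    rw [this]
    simp

/-- The inversion theorem after rescaling. The factor |ħβ|⁻¹ is what remains of the Jacobian
|2πħβ|⁻¹ once the 1/2π of the charge measure is accounted for. -/
lemma fourier_inversion_T1 (hc : hbar * β ≠ 0) {φ Φ : ℝ → ℂ} (hφ : Continuous φ)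
    (hint : Integrable φ) (hΦint : Integrable Φ)
    (hΦ : ∀ y : ℝ, Φ y = ((2 * Real.pi)⁻¹ : ℝ) *
      ∫ q, φ q * Complex.exp (Complex.I * (q / (hbar * β) * y : ℝ))) (q : ℝ) :
    φ q = (|(hbar * β)⁻¹| : ℝ) *
      ∫ y : ℝ, Complex.exp (-(Complex.I * (q / (hbar * β) : ℝ) * y)) * Φ y := by
  have hpi : (2 * Real.pi) ≠ 0 := Real.two_pi_pos.ne'
  have hh := left_ne_zero_of_mul hc
  have hb := right_ne_zero_of_mul hc
  have hpi' : ((2 * Real.pi : ℝ) : ℂ) ≠ 0 := Complex.ofReal_ne_zero.2 hpi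
  -- Putting y = c w turns the phase qy/(ħβ) into 2πqw, the convention of `𝓕`.
  set c := 2 * Real.pi * (hbar * β) with hcdef
  have hc0 : c ≠ 0 := mul_ne_zero hpi hc
  have h1 : 𝓕⁻ φ = fun w => ((2 * Real.pi : ℝ) : ℂ) * Φ (c * w) := by
    ext w
    rw [Real.fourierInv_eq', hΦ, Complex.ofReal_inv, mul_inv_cancel_left₀ hpi']
    refine integral_congr_ae (Filter.Eventually.of_forall fun v => ?_)
    simp only [smul_eq_mul, RCLike.inner_apply, conj_trivial]
    rw [mul_comm]
    congr 2
    rw [mul_comm]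
    congr 2
    rw [hcdef]
    field_simp
  have h2 : Integrable (𝓕⁻ φ) := by
    rw [h1]
    exact (hΦint.comp_mul_left' hc0).const_mul _
  -- Inversion needs an integrable transform. The transform of `φ` is the reflection of `𝓕⁻ φ`,
  -- which is a rescaling of the integrable `Φ`.
  have h3 : Integrable (𝓕 φ) := by
    have := h2.comp_neg
    simpa only [Real.fourierInv_eq_fourier_neg, neg_neg] using this
  rw [← congrFun (hφ.fourier_fourierInv_eq hint h3) q, h1, Real.fourier_real_eq_integral_exp_smul]
  have h4 := Measure.integral_comp_mul_left
    (fun y : ℝ => Complex.exp (-(Complex.I * (q / (hbar * β) : ℝ) * y)) * Φ y) c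
  have h5 : ∀ v : ℝ, Complex.exp ((-2 * Real.pi * v * q : ℝ) * Complex.I) •
      (((2 * Real.pi : ℝ) : ℂ) * Φ (c * v)) = ((2 * Real.pi : ℝ) : ℂ) *
      (Complex.exp (-(Complex.I * (q / (hbar * β) : ℝ) * (c * v : ℝ))) * Φ (c * v)) := by
    intro v
    rw [smul_eq_mul, mul_left_comm]
    congr 3
    have : -2 * Real.pi * v * q = -(q / (hbar * β) * (c * v)) := by
      rw [hcdef]; field_simp
    rw [this]
    push_cast
    ring
  simp only [h5]
  rw [integral_const_mul, h4, hcdef, mul_inv, abs_mul, abs_inv (2 * Real.pi),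
    abs_of_pos Real.two_pi_pos, Complex.real_smul, ← mul_assoc, ← Complex.ofReal_mul,
    mul_inv_cancel_left₀ hpi]

/-- Absolute convergence allows integration term by term, and orthogonality of the exponentials
leaves a single term. -/
lemma fourier_inversion_U1 {a : ℤ → ℂ} {Φ : ℝ → ℂ} (ha : Summable fun k => ‖a k‖)
    (hΦ : ∀ y : ℝ, HasSum (fun k : ℤ => a k * Complex.exp (Complex.I * (k * y : ℝ))) (Φ y))
    (j : ℤ) :
    a j = ((2 * Real.pi)⁻¹ : ℝ) *
      ∫ y in Set.Ioc 0 (2 * Real.pi), Complex.exp (-(Complex.I * (j : ℝ) * y)) * Φ y := by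
  have hpi : ((2 * Real.pi : ℝ) : ℂ) ≠ 0 := Complex.ofReal_ne_zero.2 Real.two_pi_pos.ne'
  let f : ℤ → ℝ → ℂ := fun k y => Complex.exp (-(Complex.I * (j : ℝ) * y)) *
    (a k * Complex.exp (Complex.I * (k * y : ℝ)))
  have hnorm : ∀ k y, ‖f k y‖ = ‖a k‖ := by
    intro k y
    rw [norm_mul, norm_mul, norm_exp_neg_I_mul, one_mul, mul_comm Complex.I,
      Complex.norm_exp_ofReal_mul_I, mul_one]
  have hcont : ∀ k, Continuous (f k) := fun k => by
    simp only [f]; fun_prop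
  have h := hasSum_integral_of_summable_integral_norm
    (μ := volume.restrict (Set.Ioc 0 (2 * Real.pi))) (F := f)
    (fun k => (hcont k).integrableOn_Ioc) (by
      simp only [hnorm, integral_const, smul_eq_mul]
      exact ha.mul_left _)
  have h1 : ∀ y, ∑' k, f k y = Complex.exp (-(Complex.I * (j : ℝ) * y)) * Φ y := fun y =>
    ((hΦ y).mul_left _).tsum_eq
  have h2 : ∀ k, ∫ y in Set.Ioc 0 (2 * Real.pi), f k y =
      if k = j then a j * ((2 * Real.pi : ℝ) : ℂ) else 0 := by
    intro k
    simp only [f, mul_left_comm _ (a k)]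
    rw [integral_const_mul, integral_exp_int]
    split_ifs with hk
    · rw [hk]
    · rw [mul_zero]
  simp only [h1, h2] at h
  rw [h.unique (hasSum_ite_eq j _), mul_comm (a j), Complex.ofReal_inv, inv_mul_cancel_left₀ hpi]

/-- The expansion says nothing about how the coefficients depend on the base point. Recovering them
as integrals of Ψ is what gives their differentiability. On the line, continuity in q turns an
almost everywhere identity into one for every charge. -/
lemma fourier_inversion (hc : hbar * β ≠ 0) (G : StructureGroup) {φ Φ : ℝ → ℂ}
    (hφ : ContinuousOn φ (G.charges hbar β)) (hint : Integrable φ (G.chargeMeasure hbar β))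
    (hΦint : IntegrableOn Φ G.fiberDomain)
    (hΦ : ∀ y : ℝ, Φ y = ∫ q, φ q * Complex.exp (Complex.I * (q / (hbar * β) * y : ℝ))
      ∂(G.chargeMeasure hbar β)) {q : ℝ} (hq : q ∈ G.charges hbar β) :
    φ q = G.coeffNorm hbar β * ∫ y in G.fiberDomain,
      Complex.exp (-(Complex.I * (q / (hbar * β) : ℝ) * y)) * Φ y := by
  cases G with
  | T1 =>
    have hpi : (0 : ℝ) < 1 / (2 * Real.pi) := one_div_pos.2 Real.two_pi_pos
    simp only [StructureGroup.charges, continuousOn_univ, StructureGroup.chargeMeasure,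
      StructureGroup.fiberDomain, IntegrableOn, Measure.restrict_univ,
      StructureGroup.coeffNorm] at hφ hint hΦint hΦ ⊢
    refine fourier_inversion_T1 hc hφ ?_ hΦint (fun y => ?_) q
    · exact (integrable_smul_measure (by simpa using hpi) ENNReal.ofReal_ne_top).1 hint
    · rw [hΦ, integral_smul_measure, ENNReal.toReal_ofReal hpi.le, Complex.real_smul, one_div]
  | U1 =>
    obtain ⟨j, rfl⟩ := hq
    simp only [StructureGroup.chargeMeasure] at hint hΦ
    have hn : ∀ (k : ℤ) (y : ℝ), ‖Complex.exp (Complex.I *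
        ((k * (hbar * β) : ℝ) / (hbar * β) * y : ℝ))‖ = 1 := by
      intro k y
      rw [mul_comm Complex.I, Complex.norm_exp_ofReal_mul_I]
    -- Integrability against a sum of Dirac measures is absolute summability.
    have hsum : Summable fun k : ℤ => ‖φ (k * (hbar * β))‖ := by
      simpa using hint.summable_integral
    have hI : ∀ y : ℝ, Integrable (fun q => φ q *
        Complex.exp (Complex.I * (q / (hbar * β) * y : ℝ)))
        (Measure.sum fun k : ℤ => Measure.dirac (k * (hbar * β))) := by
      intro y
      refine hint.mul_bdd (c := 1) (Continuous.aestronglyMeasurable (by fun_prop))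
        (Filter.Eventually.of_forall fun q => ?_)
      rw [mul_comm Complex.I, Complex.norm_exp_ofReal_mul_I]
    rw [mul_div_cancel_right₀ _ hc]
    refine fourier_inversion_U1 (a := fun k : ℤ => φ (k * (hbar * β))) hsum (fun y => ?_) j
    have h := hasSum_integral_measure (hI y)
    rw [← hΦ] at h
    simpa only [integral_dirac, mul_div_cancel_right₀ _ hc] using h

end Inversion

/-! ### Metrics in coordinate systems -/

section CoordSystems

variable {n : ℕ} {N : Type*} [TopologicalSpace N] [ChartedSpace (EuclideanSpace ℝ (Fin n)) N]

lemma CoordSystem.contMDiffAt (c : CoordSystem n N) {x : Fin n → ℝ} (hx : x ∈ c.dom) :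
    ContMDiffAt 𝓘(ℝ, Fin n → ℝ) (𝓡 n) ∞ c.param x :=
  c.smooth.contMDiffAt (c.isOpen_dom.mem_nhds hx)

lemma CoordSystem.mdifferentiableAt (c : CoordSystem n N) {x : Fin n → ℝ} (hx : x ∈ c.dom) :
    MDifferentiableAt 𝓘(ℝ, Fin n → ℝ) (𝓡 n) c.param x :=
  (c.contMDiffAt hx).mdifferentiableAt (by simp)

lemma CoordSystem.contDiffOn_comp (c : CoordSystem n N) {F : Type*} [NormedAddCommGroup F]
    [NormedSpace ℝ F] {k : WithTop ℕ∞} (hk : k ≤ ∞) {f : N → F} (hf : ContMDiff (𝓡 n) 𝓘(ℝ, F) k f) :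
    ContDiffOn ℝ k (fun z => f (c.param z)) c.dom :=
  contMDiffOn_iff_contDiffOn.1 (hf.comp_contMDiffOn (c.smooth.of_le hk))

lemma IsLorentzMetric.isSymm_comp {g : BilinField n N} (hg : IsLorentzMetric g)
    (c : CoordSystem n N) (x : Fin n → ℝ) : (g.comp c x).IsSymm := by
  ext i j
  exact hg.symm _ _ _

/-- Nondegeneracy does not depend on the basis. It is read off from the orthonormal basis, where the
matrix is diagonal with entries ±1, and transferred to the basis of coordinate vectors. -/
lemma IsLorentzMetric.det_comp_ne_zero {g : BilinField n N} (hg : IsLorentzMetric g)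
    (c : CoordSystem n N) {x : Fin n → ℝ} (hx : x ∈ c.dom) : (g.comp c x).det ≠ 0 := by
  obtain ⟨b, hb⟩ := hg.signature (c.param x)
  have h1 : (LinearMap.BilinForm.toMatrix b (g (c.param x))).det ≠ 0 := by
    have : LinearMap.BilinForm.toMatrix b (g (c.param x)) =
        Matrix.diagonal fun i : Fin n => if i.val = 0 then (1 : ℝ) else -1 := by
      ext i j
      rw [LinearMap.BilinForm.toMatrix_apply, hb, Matrix.diagonal_apply]
    rw [this, Matrix.det_diagonal, Finset.prod_ne_zero_iff]
    intro i _
    split_ifs <;> norm_num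
  have h2 := (LinearMap.BilinForm.nondegenerate_iff_det_ne_zero b).2 h1
  let e : (Fin n → ℝ) ≃ₗ[ℝ] TangentSpace (𝓡 n) (c.param x) :=
    LinearEquiv.ofBijective
      (mfderiv 𝓘(ℝ, Fin n → ℝ) (𝓡 n) c.param x : (Fin n → ℝ) →L[ℝ] _).toLinearMap
      (c.bijective_mfderiv x hx)
  have h3 := (LinearMap.BilinForm.nondegenerate_iff_det_ne_zero
    ((Pi.basisFun ℝ (Fin n)).map e)).1 h2
  have h4 : LinearMap.BilinForm.toMatrix ((Pi.basisFun ℝ (Fin n)).map e) (g (c.param x)) =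
      g.comp c x := by
    ext i j
    rw [LinearMap.BilinForm.toMatrix_apply, Module.Basis.map_apply, Module.Basis.map_apply,
      Pi.basisFun_apply, Pi.basisFun_apply]
    rfl
  rwa [h4] at h3

end CoordSystems

/-! ### Inverse and determinant of the Kaluza-Klein matrix -/

section KaluzaKleinMatrix

variable {n : ℕ}

/-- The matrix of the bilinear form `σ g - a² (dy + b) ⊗ (dy + b)` in the coordinates `(y, x)`. -/
def kkMatrix (σ a : ℝ) (b : Fin n → ℝ) (g : Matrix (Fin n) (Fin n) ℝ) :
    Matrix (Fin (n + 1)) (Fin (n + 1)) ℝ :=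
  Matrix.of fun i j => σ * Fin.cases (motive := fun _ => ℝ) 0
    (fun i' => Fin.cases (motive := fun _ => ℝ) 0 (fun j' => g i' j') j) i
      - a ^ 2 * (fiberPoint 1 b i * fiberPoint 1 b j)

/-- The inverse of `kkMatrix`. -/
def kkInv (σ a : ℝ) (b : Fin n → ℝ) (g : Matrix (Fin n) (Fin n) ℝ) :
    Matrix (Fin (n + 1)) (Fin (n + 1)) ℝ :=
  Matrix.of <| Fin.cons
    (Fin.cons (-(a ^ 2)⁻¹ + σ * ∑ i, ∑ j, b i * g⁻¹ i j * b j)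
      fun j => -(σ * ∑ i, b i * g⁻¹ i j))
    fun i => Fin.cons (-(σ * ∑ j, g⁻¹ i j * b j)) fun j => σ * g⁻¹ i j

/-- In the coframe dy + b, dx the form is block diagonal, with dual frame ∂_y, ∂_i - b_i ∂_y. Its
inverse is therefore -a⁻² ∂_y ⊗ ∂_y + σ g^{ij} (∂_i - b_i ∂_y) ⊗ (∂_j - b_j ∂_y), where σ⁻¹ = σ. The
proof checks the four blocks of the product. -/
lemma kkMatrix_inv {σ a : ℝ} (hσ : σ ^ 2 = 1) (ha : a ≠ 0) (b : Fin n → ℝ)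
    {g : Matrix (Fin n) (Fin n) ℝ} (hg : g.det ≠ 0) : (kkMatrix σ a b g)⁻¹ = kkInv σ a b g := by
  refine Matrix.inv_eq_right_inv ?_
  have h1 : ∀ i j, ∑ k, g i k * g⁻¹ k j = (1 : Matrix (Fin n) (Fin n) ℝ) i j := fun i j => by
    rw [← Matrix.mul_apply, Matrix.mul_nonsing_inv _ (isUnit_iff_ne_zero.2 hg)]
  ext i j
  rw [Matrix.mul_apply, Fin.sum_univ_succ]
  have h2 : ∑ i, ∑ j, b i * g⁻¹ i j * b j = ∑ i, b i * ∑ j, g⁻¹ i j * b j := by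
    simp only [Finset.mul_sum, mul_assoc]
  have h3 : ∀ i, ∑ k, g i k * ∑ j, g⁻¹ k j * b j = b i := fun i => by
    simp only [Finset.mul_sum, ← mul_assoc]
    rw [Finset.sum_comm]
    simp only [← Finset.sum_mul, h1, Matrix.one_apply, ite_mul, one_mul, zero_mul,
      Finset.sum_ite_eq, Finset.mem_univ, if_true]
  induction i using Fin.cases with
  | zero =>
    induction j using Fin.cases with
    | zero =>
      simp only [kkMatrix, kkInv, Matrix.of_apply, Fin.cases_zero, Fin.cases_succ, Fin.cons_zero,
        Fin.cons_succ, fiberPoint_zero, fiberPoint_succ, Matrix.one_apply_eq, h2]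
      have h4 : ∑ k, (σ * 0 - a ^ 2 * (1 * b k)) * -(σ * ∑ j, g⁻¹ k j * b j) =
          a ^ 2 * σ * ∑ i, b i * ∑ j, g⁻¹ i j * b j := by
        rw [Finset.mul_sum]
        exact Finset.sum_congr rfl fun k _ => by ring
      rw [h4]
      field_simp
      ring
    | succ j =>
      simp only [kkMatrix, kkInv, Matrix.of_apply, Fin.cases_zero, Fin.cases_succ, Fin.cons_zero,
        Fin.cons_succ, fiberPoint_zero, fiberPoint_succ]
      have h4 : ∑ k, (σ * 0 - a ^ 2 * (1 * b k)) * (σ * g⁻¹ k j) =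
          -(a ^ 2 * σ * ∑ i, b i * g⁻¹ i j) := by
        rw [Finset.mul_sum, ← Finset.sum_neg_distrib]
        exact Finset.sum_congr rfl fun k _ => by ring
      rw [h4, Matrix.one_apply_ne (Fin.succ_ne_zero j).symm]
      ring
  | succ i =>
    induction j using Fin.cases with
    | zero =>
      simp only [kkMatrix, kkInv, Matrix.of_apply, Fin.cases_zero, Fin.cases_succ, Fin.cons_zero,
        Fin.cons_succ, fiberPoint_zero, fiberPoint_succ, h2]
      have h4 : ∑ k, (σ * g i k - a ^ 2 * (b i * b k)) * -(σ * ∑ j, g⁻¹ k j * b j) =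
          -(σ ^ 2 * ∑ k, g i k * ∑ j, g⁻¹ k j * b j) +
          a ^ 2 * b i * σ * ∑ i, b i * ∑ j, g⁻¹ i j * b j := by
        rw [Finset.mul_sum, Finset.mul_sum, ← Finset.sum_neg_distrib, ← Finset.sum_add_distrib]
        exact Finset.sum_congr rfl fun k _ => by ring
      rw [h4, h3, hσ, Matrix.one_apply_ne (Fin.succ_ne_zero i)]
      field_simp
      ring
    | succ j =>
      simp only [kkMatrix, kkInv, Matrix.of_apply, Fin.cases_zero, Fin.cases_succ, Fin.cons_zero,
        Fin.cons_succ, fiberPoint_zero, fiberPoint_succ]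
      have h4 : ∑ k, (σ * g i k - a ^ 2 * (b i * b k)) * (σ * g⁻¹ k j) =
          σ ^ 2 * ∑ k, g i k * g⁻¹ k j - a ^ 2 * b i * σ * ∑ i, b i * g⁻¹ i j := by
        rw [Finset.mul_sum, Finset.mul_sum, ← Finset.sum_sub_distrib]
        exact Finset.sum_congr rfl fun k _ => by ring
      rw [h4, h1, hσ]
      simp only [Matrix.one_apply, Fin.succ_inj]
      ring

/-- The matrix is `Lᵀ K L` with `L` unipotent, the change of coframe from (dy, dx) to (dy + b, dx),
and `K` block diagonal with blocks -a² and σ g. -/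
lemma det_kkMatrix (σ a : ℝ) (b : Fin n → ℝ) (g : Matrix (Fin n) (Fin n) ℝ) :
    (kkMatrix σ a b g).det = -a ^ 2 * (σ ^ n * g.det) := by
  let L : Matrix (Fin (n + 1)) (Fin (n + 1)) ℝ :=
    Matrix.of <| Fin.cons (fiberPoint 1 b) fun i => Pi.single i.succ 1
  let K : Matrix (Fin (n + 1)) (Fin (n + 1)) ℝ :=
    Matrix.of <| Fin.cons (Fin.cons (-a ^ 2) 0) fun i => Fin.cons 0 fun j => σ * g i j
  have hL : L.det = 1 := by
    rw [Matrix.det_of_isUpperTriangular]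
    · rw [Fin.prod_univ_succ]
      simp [L]
    · intro i j hij
      induction i using Fin.cases with
      | zero => exact absurd hij (by simp)
      | succ i => exact Pi.single_eq_of_ne (by exact hij.ne) _
  have hK : K.det = -a ^ 2 * (σ ^ n * g.det) := by
    rw [Matrix.det_succ_row_zero, Fin.sum_univ_succ]
    have : K.submatrix Fin.succ (Fin.succAbove 0) = σ • g := by
      ext i j
      simp [K]
    rw [this, Matrix.det_smul]
    simp [K]
  have h : kkMatrix σ a b g = L.transpose * K * L := by
    have hc : ∀ i j, (L.transpose * K * L) i j = fiberPoint 1 b i * (-a ^ 2) * fiberPoint 1 b j +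
        ∑ l : Fin n, (∑ k : Fin n, (Pi.single k.succ 1 : Fin (n + 1) → ℝ) i * (σ * g k l)) *
          (Pi.single l.succ 1 : Fin (n + 1) → ℝ) j := by
      intro i j
      simp [Matrix.mul_apply, Fin.sum_univ_succ, L, K]
    ext i j
    rw [hc]
    induction i using Fin.cases with
    | zero => simp [kkMatrix]
    | succ i =>
      induction j using Fin.cases with
      | zero => simp [kkMatrix]; ring
      | succ j =>
        simp [kkMatrix, Pi.single_apply]
        ring
  rw [h, Matrix.det_mul, Matrix.det_mul, Matrix.det_transpose, hL, hK]
  ring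

end KaluzaKleinMatrix

/-! ### Adapted coordinates on the bundle -/

section BundleCoordinates

variable {M P : Type*}
  [TopologicalSpace M] [ChartedSpace (EuclideanSpace ℝ (Fin 4)) M]
  [TopologicalSpace P] [ChartedSpace (EuclideanSpace ℝ (Fin 5)) P] [AddAction ℝ P]
  {G : StructureGroup}

/-- The map `(y, x) ↦ y + s(x)` in the coordinates `c` of the base. -/
def bundleParam (c : CoordSystem 4 M) (s : M → P) (z : Fin 5 → ℝ) : P :=
  z 0 +ᵥ s (c.param (basePoint 4 z))

/-- A coordinate system of the base over whose domain the smooth section `s` is defined. -/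
structure SectionCoord (B : PrincipalBundle M P G) (c : CoordSystem 4 M) (s : M → P)
    (U : Set M) : Prop where
  isOpen : IsOpen U
  smooth : ContMDiffOn (𝓡 4) (𝓡 5) ∞ s U
  proj : ∀ x ∈ U, B.proj (s x) = x
  mapsTo : Set.MapsTo c.param c.dom U

namespace SectionCoord

variable {B : PrincipalBundle M P G} {c : CoordSystem 4 M} {s : M → P} {U : Set M}
  (h : SectionCoord B c s U)
include h

lemma contMDiffOn_bundleParam :
    ContMDiffOn 𝓘(ℝ, Fin 5 → ℝ) (𝓡 5) ∞ (bundleParam c s) (basePoint 4 ⁻¹' c.dom) := by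
  have h1 : ContMDiffOn 𝓘(ℝ, Fin 5 → ℝ) 𝓘(ℝ, ℝ) ∞ (fun z : Fin 5 → ℝ => z 0)
      (basePoint 4 ⁻¹' c.dom) := by
    rw [contMDiffOn_iff_contDiffOn]
    exact (contDiff_apply ℝ ℝ 0).contDiffOn
  have h2 : ContMDiffOn 𝓘(ℝ, Fin 5 → ℝ) 𝓘(ℝ, Fin 4 → ℝ) ∞ (basePoint 4)
      (basePoint 4 ⁻¹' c.dom) := by
    rw [contMDiffOn_iff_contDiffOn]
    exact (basePoint 4).contDiff.contDiffOn
  exact B.smooth_vadd.comp_contMDiffOn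
    (h1.prodMk ((h.smooth.comp c.smooth h.mapsTo).comp h2 fun _ hz => hz))

lemma mdifferentiableAt_bundleParam {z : Fin 5 → ℝ} (hz : basePoint 4 z ∈ c.dom) :
    MDifferentiableAt 𝓘(ℝ, Fin 5 → ℝ) (𝓡 5) (bundleParam c s) z :=
  (h.contMDiffOn_bundleParam.contMDiffAt
    ((FiberRegular.isOpen_preimage c.isOpen_dom).mem_nhds hz)).mdifferentiableAt (by simp)

lemma proj_bundleParam {z : Fin 5 → ℝ} (hz : basePoint 4 z ∈ c.dom) :
    B.proj (bundleParam c s z) = c.param (basePoint 4 z) := by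
  rw [bundleParam, ← (B.proj_eq_iff (s (c.param (basePoint 4 z))) _).2 ⟨z 0, rfl⟩]
  exact h.proj _ (h.mapsTo hz)

lemma mfderiv_proj_bundleParam {z : Fin 5 → ℝ} (hz : basePoint 4 z ∈ c.dom) (v : Fin 5 → ℝ) :
    (mfderiv (𝓡 5) (𝓡 4) B.proj (bundleParam c s z)
      (mfderiv 𝓘(ℝ, Fin 5 → ℝ) (𝓡 5) (bundleParam c s) z v) : EuclideanSpace ℝ (Fin 4)) =
    mfderiv 𝓘(ℝ, Fin 4 → ℝ) (𝓡 4) c.param (basePoint 4 z) (basePoint 4 v : Fin 4 → ℝ) := by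
  have hB : MDifferentiableAt (𝓡 5) (𝓡 4) B.proj (bundleParam c s z) :=
    B.smooth_proj.contMDiffAt.mdifferentiableAt (by simp)
  have h1 := hB.hasMFDerivAt.comp z (h.mdifferentiableAt_bundleParam hz).hasMFDerivAt
  have h2 := (c.mdifferentiableAt hz).hasMFDerivAt.comp z
    (basePoint 4).hasFDerivAt.hasMFDerivAt
  have h3 : B.proj ∘ bundleParam c s =ᶠ[𝓝 z] c.param ∘ basePoint 4 := by
    filter_upwards [(FiberRegular.isOpen_preimage c.isOpen_dom).mem_nhds hz] with w hw
    exact h.proj_bundleParam hw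
  have h4 := hasMFDerivAt_unique (h1.congr_of_eventuallyEq h3.symm) h2
  exact congrArg (fun L : (Fin 5 → ℝ) →L[ℝ] EuclideanSpace ℝ (Fin 4) => L v) h4

lemma mfderiv_bundleParam_single_zero {y : ℝ} {x : Fin 4 → ℝ} (hx : x ∈ c.dom) :
    (mfderiv 𝓘(ℝ, Fin 5 → ℝ) (𝓡 5) (bundleParam c s) (fiberPoint y x)
      (Pi.single 0 1 : Fin 5 → ℝ) : EuclideanSpace ℝ (Fin 5)) =
    fundamentalField (bundleParam c s (fiberPoint y x)) := by
  set p := bundleParam c s (fiberPoint y x) with hp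
  have hg : MDifferentiableAt 𝓘(ℝ, ℝ) (𝓡 5) (fun t : ℝ => t +ᵥ p) 0 :=
    (B.smooth_vadd.comp (contMDiff_id.prodMk contMDiff_const)).contMDiffAt.mdifferentiableAt
      (by simp)
  -- The chain rule for t ↦ t - y asks for the derivative at `y - y`, which equals 0 only
  -- propositionally. Hence the generalization over `w`.
  have hg' : ∀ w : ℝ, w = 0 → HasMFDerivAt 𝓘(ℝ, ℝ) (𝓡 5) (fun t : ℝ => t +ᵥ p) w
      (mfderiv 𝓘(ℝ, ℝ) (𝓡 5) (fun t : ℝ => t +ᵥ p) 0 : ℝ →L[ℝ] EuclideanSpace ℝ (Fin 5)) := by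
    rintro _ rfl
    exact hg.hasMFDerivAt
  have h1 := HasMFDerivAt.comp (f := fun t : ℝ => id t - y) y (hg' (y - y) (sub_self y))
    ((hasDerivAt_id y).sub_const y).hasFDerivAt.hasMFDerivAt
  have h2 := (h.mdifferentiableAt_bundleParam (z := fiberPoint y x) hx).hasMFDerivAt.comp y
    (hasDerivAt_fiberPoint y x).hasFDerivAt.hasMFDerivAt
  have h3 : bundleParam c s ∘ (fun t => fiberPoint t x) =
      (fun t : ℝ => t +ᵥ p) ∘ fun t => id t - y := by
    ext t
    simp [hp, bundleParam, vadd_vadd]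
  rw [h3] at h2
  have h4 := hasMFDerivAt_unique h2 h1
  have h5 := congrArg (fun L : ℝ →L[ℝ] EuclideanSpace ℝ (Fin 5) => L 1) h4
  change mfderiv 𝓘(ℝ, Fin 5 → ℝ) (𝓡 5) (bundleParam c s) (fiberPoint y x)
    ((1 : ℝ) • (Pi.single 0 1 : Fin 5 → ℝ)) =
      mfderiv 𝓘(ℝ, ℝ) (𝓡 5) (fun t : ℝ => t +ᵥ p) 0 ((1 : ℝ) • (1 : ℝ)) at h5
  rwa [one_smul, one_smul] at h5

/-- At fixed y the parametrization is the translate by y of the section. The differential of the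
translation is kept as a separate factor so that invariance of the connection can remove it. -/
lemma mfderiv_bundleParam_single_succ {y : ℝ} {x : Fin 4 → ℝ} (hx : x ∈ c.dom) (i : Fin 4) :
    (mfderiv 𝓘(ℝ, Fin 5 → ℝ) (𝓡 5) (bundleParam c s) (fiberPoint y x)
      (Pi.single i.succ 1 : Fin 5 → ℝ) : EuclideanSpace ℝ (Fin 5)) =
    mfderiv (𝓡 5) (𝓡 5) (fun p' : P => y +ᵥ p') (s (c.param x))
      (mfderiv (𝓡 4) (𝓡 5) s (c.param x) (c.basisVec i x)) := by
  have hy : MDifferentiableAt (𝓡 5) (𝓡 5) (fun p' : P => y +ᵥ p') (s (c.param x)) :=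
    (B.smooth_vadd.comp (contMDiff_const.prodMk contMDiff_id)).contMDiffAt.mdifferentiableAt
      (by simp)
  have hs : MDifferentiableAt (𝓡 4) (𝓡 5) s (c.param x) :=
    (h.smooth.contMDiffAt (h.isOpen.mem_nhds (h.mapsTo hx))).mdifferentiableAt (by simp)
  have h1 := hy.hasMFDerivAt.comp x
    (hs.hasMFDerivAt.comp x (c.mdifferentiableAt hx).hasMFDerivAt)
  have h2 := (h.mdifferentiableAt_bundleParam (z := fiberPoint y x) hx).hasMFDerivAt.comp x
    (hasFDerivAt_fiberPoint y x).hasMFDerivAt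
  have h4 := hasMFDerivAt_unique h2 h1
  have h5 := congrArg (fun L : (Fin 4 → ℝ) →L[ℝ] EuclideanSpace ℝ (Fin 5) =>
    L (Pi.single i 1)) h4
  rw [← baseIncl_single]
  exact h5

/-- A vector in the kernel projects to zero on the base, so it is a multiple of ∂_y. Its image is
that multiple of the fundamental field, on which the connection form is 1, so the multiple is zero.
Surjectivity follows by dimension. -/
lemma mfderiv_bundleParam_bijective {conn : OneForm 5 P} (hconn : IsConnectionForm conn)
    {y : ℝ} {x : Fin 4 → ℝ} (hx : x ∈ c.dom) :
    Function.Bijective (mfderiv 𝓘(ℝ, Fin 5 → ℝ) (𝓡 5) (bundleParam c s) (fiberPoint y x)) := by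
  let L : (Fin 5 → ℝ) →L[ℝ] EuclideanSpace ℝ (Fin 5) :=
    mfderiv 𝓘(ℝ, Fin 5 → ℝ) (𝓡 5) (bundleParam c s) (fiberPoint y x)
  have hinj : Function.Injective L := by
    rw [injective_iff_map_eq_zero]
    intro v hv
    have h1 := h.mfderiv_proj_bundleParam (z := fiberPoint y x) hx v
    change (mfderiv (𝓡 5) (𝓡 4) B.proj (bundleParam c s (fiberPoint y x)) (L v)
      : EuclideanSpace ℝ (Fin 4)) = _ at h1
    rw [hv] at h1
    have h2 : basePoint 4 v = 0 := by
      refine (c.bijective_mfderiv x hx).1 ?_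
      refine h1.symm.trans ?_
      exact (map_zero (mfderiv (𝓡 5) (𝓡 4) B.proj (bundleParam c s (fiberPoint y x)))).trans
        (map_zero (mfderiv 𝓘(ℝ, Fin 4 → ℝ) (𝓡 4) c.param x)).symm
    have h3 : v = v 0 • (Pi.single 0 1 : Fin 5 → ℝ) := by
      conv_lhs => rw [← fiberPoint_basePoint v, h2, fiberPoint_eq, map_zero, add_zero]
    have h4 : L v = v 0 • L (Pi.single 0 1) := by
      conv_lhs => rw [h3, map_smul]
    have h5 : L (Pi.single 0 1) = fundamentalField (bundleParam c s (fiberPoint y x)) :=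
      h.mfderiv_bundleParam_single_zero hx
    have h6 := hconn.apply_fundamentalField (bundleParam c s (fiberPoint y x))
    rw [hv, h5] at h4
    have h7 := congrArg (conn (bundleParam c s (fiberPoint y x))) h4
    rw [h3]
    have h8 : v 0 = 0 := by
      have h9 := (map_zero (conn (bundleParam c s (fiberPoint y x)))).symm.trans h7
      have h10 := h9.trans (map_smul (conn (bundleParam c s (fiberPoint y x))) (v 0)
        (fundamentalField (bundleParam c s (fiberPoint y x))))
      rw [h6] at h10
      simpa using h10.symm
    rw [h8, zero_smul]
  refine ⟨hinj, ?_⟩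
  exact (LinearMap.injective_iff_surjective_of_finrank_eq_finrank (f := L.toLinearMap)
    (by simp)).1 hinj

/-- The coordinates `(y, x)` of the bundle near the fiber coordinate `y₀`. -/
def coord {conn : OneForm 5 P} (hconn : IsConnectionForm conn) (y₀ : ℝ) : CoordSystem 5 P where
  -- The window in y is open of width 2π, so two fiber coordinates in it differ by less than a full
  -- period of U(1). This makes the parametrization injective.
  dom := basePoint 4 ⁻¹' c.dom ∩ {z | |z 0 - y₀| < Real.pi}
  isOpen_dom := (FiberRegular.isOpen_preimage c.isOpen_dom).inter
    (isOpen_lt (by fun_prop) continuous_const)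
  param := bundleParam c s
  smooth := h.contMDiffOn_bundleParam.mono Set.inter_subset_left
  injOn := by
    rintro z ⟨hz, hz0⟩ w ⟨hw, hw0⟩ hzw
    have h1 : basePoint 4 z = basePoint 4 w := by
      refine c.injOn hz hw ?_
      rw [← h.proj_bundleParam hz, ← h.proj_bundleParam hw, hzw]
    have h2 : z 0 = w 0 := by
      simp only [bundleParam, h1] at hzw
      have h3 : (z 0 - w 0) +ᵥ s (c.param (basePoint 4 w)) = s (c.param (basePoint 4 w)) := by
        rw [sub_eq_neg_add, ← vadd_vadd, hzw, vadd_vadd, neg_add_cancel, zero_vadd]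
      have h4 := (B.vadd_eq_iff _ _).1 h3
      have hlt : |z 0 - w 0| < 2 * Real.pi := by
        have := abs_sub_le (z 0) y₀ (w 0)
        rw [abs_sub_comm y₀] at this
        simp only [Set.mem_ofPred_eq] at hz0 hw0
        linarith
      cases G with
      | T1 => exact sub_eq_zero.1 (by simpa [StructureGroup.periods] using h4)
      | U1 =>
        obtain ⟨k, hk⟩ := AddSubgroup.mem_zmultiples_iff.1 h4
        rw [← hk, zsmul_eq_mul, abs_mul, abs_of_pos Real.two_pi_pos] at hlt
        have h5 : |(k : ℝ)| < 1 := by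
          by_contra hcon
          push Not at hcon
          nlinarith [Real.pi_pos]
        have h6 : k = 0 := by
          rw [← Int.cast_abs] at h5
          exact Int.abs_lt_one_iff.1 (by exact_mod_cast h5)
        rw [h6, zero_smul] at hk
        exact sub_eq_zero.1 hk.symm
    rw [← fiberPoint_basePoint z, ← fiberPoint_basePoint w, h1, h2]
  bijective_mfderiv := fun z hz => by
    rw [← fiberPoint_basePoint z]
    exact h.mfderiv_bundleParam_bijective hconn hz.1

lemma conn_comp_zero {conn : OneForm 5 P} (hconn : IsConnectionForm conn) (y₀ y : ℝ)
    {x : Fin 4 → ℝ} (hx : x ∈ c.dom) : conn.comp (h.coord hconn y₀) 0 (fiberPoint y x) = 1 := by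
  refine Eq.trans ?_ (hconn.apply_fundamentalField (bundleParam c s (fiberPoint y x)))
  exact congrArg (conn (bundleParam c s (fiberPoint y x))) (h.mfderiv_bundleParam_single_zero hx)

/-- Invariance removes the translation by y and leaves the pullback by the section. In particular
the components do not depend on y. -/
lemma conn_comp_succ {conn : OneForm 5 P} (hconn : IsConnectionForm conn) {β : ℝ} (hβ : β ≠ 0)
    (y₀ y : ℝ) {x : Fin 4 → ℝ} (hx : x ∈ c.dom) (i : Fin 4) :
    conn.comp (h.coord hconn y₀) i.succ (fiberPoint y x) =
      β * (gaugePotential β conn s).comp c i x := by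
  refine Eq.trans (congrArg (conn (bundleParam c s (fiberPoint y x)))
    (h.mfderiv_bundleParam_single_succ (y := y) hx i)) ?_
  refine (hconn.invariant y (s (c.param x)) _).trans ?_
  rw [OneForm.comp, gaugePotential, LinearMap.smul_apply, smul_eq_mul, mul_inv_cancel_left₀ hβ]
  rfl

/-- Smoothness of the connection is known only through its components in coordinate systems of the
bundle. The potential is β⁻¹ times such components along the slice y = 0. -/
lemma contDiffOn_gaugePotential {conn : OneForm 5 P} (hconn : IsConnectionForm conn) {β : ℝ}
    (hβ : β ≠ 0) (i : Fin 4) : ContDiffOn ℝ ∞ ((gaugePotential β conn s).comp c i) c.dom := by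
  have h1 := hconn.smooth (h.coord hconn 0) i.succ
  have h2 : ContDiff ℝ ∞ fun x : Fin 4 → ℝ => fiberPoint 0 x := by
    simp only [fiberPoint_eq]
    exact contDiff_const.add (baseIncl 4).contDiff
  have h3 := contDiffOn_const (c := β⁻¹).mul (h1.comp h2.contDiffOn (s := c.dom) fun x hx =>
    ⟨hx, by simpa using Real.pi_pos⟩)
  refine h3.congr fun x hx => ?_
  simp only [Function.comp_apply]
  rw [h.conn_comp_succ hconn hβ 0 0 hx, inv_mul_cancel_left₀ hβ]

lemma kkMetric_comp {conn : OneForm 5 P} (hconn : IsConnectionForm conn) {β : ℝ}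
    (hβ : β ≠ 0) (σ : ℝ) (g₀ : BilinField 4 M) (a : M → ℝ) (y₀ y : ℝ) {x : Fin 4 → ℝ}
    (hx : x ∈ c.dom) :
    (kkMetric B σ g₀ a conn).comp (h.coord hconn y₀) (fiberPoint y x) =
      kkMatrix σ (a (c.param x)) (fun i => β * (gaugePotential β conn s).comp c i x)
        (g₀.comp c x) := by
  set p := bundleParam c s (fiberPoint y x) with hp
  have hproj : B.proj p = c.param x := h.proj_bundleParam (z := fiberPoint y x) hx
  -- The base point `B.proj p` is only propositionally equal to `c.param x`. The tangent vectors are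
  -- viewed in the common model space so that the form can be transported between the two points.
  have hg : ∀ m : M, m = c.param x → ∀ v w : EuclideanSpace ℝ (Fin 4),
      g₀ m v w = g₀ (c.param x) v w := by
    rintro _ rfl v w
    rfl
  have hd : ∀ i : Fin 5, (mfderiv (𝓡 5) (𝓡 4) B.proj p
      ((h.coord hconn y₀).basisVec i (fiberPoint y x)) : EuclideanSpace ℝ (Fin 4)) =
      mfderiv 𝓘(ℝ, Fin 4 → ℝ) (𝓡 4) c.param x (basePoint 4 (Pi.single i 1) : Fin 4 → ℝ) :=
    fun i => h.mfderiv_proj_bundleParam (z := fiberPoint y x) hx _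
  have hc : ∀ i : Fin 5, conn.comp (h.coord hconn y₀) i (fiberPoint y x) =
      fiberPoint 1 (fun i => β * (gaugePotential β conn s).comp c i x) i := by
    intro i
    induction i using Fin.cases with
    | zero => exact h.conn_comp_zero hconn y₀ y hx
    | succ i => exact h.conn_comp_succ hconn hβ y₀ y hx i
  ext i j
  have h1 : (kkMetric B σ g₀ a conn).comp (h.coord hconn y₀) (fiberPoint y x) i j =
      σ * g₀ (B.proj p)
        (mfderiv (𝓡 5) (𝓡 4) B.proj p ((h.coord hconn y₀).basisVec i (fiberPoint y x)))
        (mfderiv (𝓡 5) (𝓡 4) B.proj p ((h.coord hconn y₀).basisVec j (fiberPoint y x)))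
      - a (B.proj p) ^ 2 * (conn.comp (h.coord hconn y₀) i (fiberPoint y x)
        * conn.comp (h.coord hconn y₀) j (fiberPoint y x)) := rfl
  have h2 : g₀ (B.proj p)
        (mfderiv (𝓡 5) (𝓡 4) B.proj p ((h.coord hconn y₀).basisVec i (fiberPoint y x)))
        (mfderiv (𝓡 5) (𝓡 4) B.proj p ((h.coord hconn y₀).basisVec j (fiberPoint y x))) =
      g₀ (c.param x)
        (mfderiv 𝓘(ℝ, Fin 4 → ℝ) (𝓡 4) c.param x (basePoint 4 (Pi.single i 1) : Fin 4 → ℝ))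
        (mfderiv 𝓘(ℝ, Fin 4 → ℝ) (𝓡 4) c.param x (basePoint 4 (Pi.single j 1) : Fin 4 → ℝ)) :=
    (hg _ hproj _ _).trans (congrArg₂ (fun v w : EuclideanSpace ℝ (Fin 4) =>
      g₀ (c.param x) v w) (hd i) (hd j))
  rw [h1, h2, hc, hc, hproj, kkMatrix, Matrix.of_apply]
  congr 2
  let T : (Fin 4 → ℝ) →L[ℝ] EuclideanSpace ℝ (Fin 4) :=
    mfderiv 𝓘(ℝ, Fin 4 → ℝ) (𝓡 4) c.param x
  let b : LinearMap.BilinForm ℝ (EuclideanSpace ℝ (Fin 4)) := g₀ (c.param x)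
  induction i using Fin.cases with
  | zero =>
    rw [basePoint_single_zero]
    change b (T 0) _ = 0
    rw [map_zero, map_zero]
    rfl
  | succ i =>
    induction j using Fin.cases with
    | zero =>
      rw [basePoint_single_zero]
      change b _ (T 0) = 0
      rw [map_zero, map_zero]
    | succ j =>
      rw [basePoint_single_succ, basePoint_single_succ]
      rfl

end SectionCoord

end BundleCoordinates

/-! ### From the bundle equation to the charged equation -/

section Reduction

variable {n : ℕ} {G : StructureGroup} {D : Set (Fin n → ℝ)}

/-- The derivative of `u` in the direction of the horizontal lift of `∂_i`. -/
def horizD (β : ℝ) (A : Fin n → (Fin n → ℝ) → ℝ) (u : (Fin (n + 1) → ℝ) → ℂ) (i : Fin n)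
    (z : Fin (n + 1) → ℝ) : ℂ :=
  pd i.succ u z + ((-(β * A i (basePoint n z)) : ℝ) : ℂ) * pd 0 u z

/-- The horizontal flux `Σ_j K^{ij} D_j u`. -/
def horizFlux (β : ℝ) (A : Fin n → (Fin n → ℝ) → ℝ) (K : Fin n → Fin n → (Fin n → ℝ) → ℝ)
    (u : (Fin (n + 1) → ℝ) → ℂ) (i : Fin n) (z : Fin (n + 1) → ℝ) : ℂ :=
  ∑ j, (K i j (basePoint n z) : ℂ) * horizD β A u j z

variable {β hbar q k : ℝ} {κ : ℂ} {A : Fin n → (Fin n → ℝ) → ℝ}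
  {K : Fin n → Fin n → (Fin n → ℝ) → ℝ} {u : (Fin (n + 1) → ℝ) → ℂ}

lemma FiberRegular.horizD (hD : IsOpen D) (hA : ∀ i, ContDiffOn ℝ 1 (A i) D)
    (hpu : ∀ i, FiberRegular G D (pd i u)) (i : Fin n) :
    FiberRegular G D (KaluzaKlein.horizD β A u i) :=
  (hpu i.succ).add hD ((hpu 0).base_mul hD (h := fun x => ((-(β * A i x) : ℝ) : ℂ))
    (contDiffOn_ofReal (contDiffOn_const.mul (hA i)).neg))

lemma FiberRegular.horizFlux (hD : IsOpen D) (hA : ∀ i, ContDiffOn ℝ 1 (A i) D)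
    (hK : ∀ i j, ContDiffOn ℝ 1 (K i j) D) (hpu : ∀ i, FiberRegular G D (pd i u)) (i : Fin n) :
    FiberRegular G D (KaluzaKlein.horizFlux β A K u i) :=
  FiberRegular.sum hD fun j _ => (FiberRegular.horizD hD hA hpu j).base_mul hD
    (h := fun x => (K i j x : ℂ)) (contDiffOn_ofReal (hK i j))

lemma fiberIntegrableAt_horizD (hD : IsOpen D) (hu : FiberRegular G D u) {x : Fin n → ℝ}
    (hx : x ∈ D) (i : Fin n) : FiberIntegrableAt G k (horizD β A u i) x :=
  (hu.integrableAt_pd hD hx i.succ).add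
    ((hu.integrableAt_pd hD hx 0).base_mul fun x => ((-(β * A i x) : ℝ) : ℂ))

/-- Since ∂_y acts as ik and ħβk = q, the term -ħβA_i ∂_y becomes -iqA_i. This is minimal coupling.
-/
lemma fiberCoeff_horizD (hD : IsOpen D) (hu : FiberRegular G D u) {x : Fin n → ℝ} (hx : x ∈ D)
    (hk : ∀ p ∈ G.periods, Complex.exp (-(Complex.I * k * p)) = 1) (hq : hbar * β * k = q)
    (i : Fin n) :
    hbar * fiberCoeff G κ k (horizD β A u i) x = gaugeD hbar q A (fiberCoeff G κ k u) i x := by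
  have h1 : fiberCoeff G κ k (horizD β A u i) x = _ :=
    fiberCoeff_add (hu.integrableAt_pd hD hx i.succ)
      ((hu.integrableAt_pd hD hx 0).base_mul fun x => ((-(β * A i x) : ℝ) : ℂ))
  rw [h1, fiberCoeff_base_mul (fun x => ((-(β * A i x) : ℝ) : ℂ)), fiberCoeff_pd_zero hD hu hx hk,
    gaugeD, pd_fiberCoeff hD hu hx, ← hq]
  push_cast
  ring

lemma fiberCoeff_horizFlux (hD : IsOpen D) (hu : FiberRegular G D u) {x : Fin n → ℝ} (hx : x ∈ D)
    (hk : ∀ p ∈ G.periods, Complex.exp (-(Complex.I * k * p)) = 1) (hq : hbar * β * k = q)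
    (i : Fin n) :
    hbar * fiberCoeff G κ k (horizFlux β A K u i) x =
      ∑ j, (K i j x : ℂ) * gaugeD hbar q A (fiberCoeff G κ k u) j x := by
  have h1 : fiberCoeff G κ k (horizFlux β A K u i) x = _ :=
    fiberCoeff_sum fun j _ => (fiberIntegrableAt_horizD hD hu hx j).base_mul
      fun x => (K i j x : ℂ)
  rw [h1, Finset.mul_sum]
  refine Finset.sum_congr rfl fun j _ => ?_
  rw [fiberCoeff_base_mul (fun x => (K i j x : ℂ)), mul_left_comm, fiberCoeff_horizD hD hu hx hk hq]

/-- The Fourier coefficients of a solution of the Kaluza-Klein equation satisfy the charged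
equation on the base. -/
lemma gaugeDiv_fiberCoeff (hD : IsOpen D) (hu : FiberRegular G D u)
    (hpu : ∀ i, FiberRegular G D (pd i u)) (hA : ∀ i, ContDiffOn ℝ 1 (A i) D)
    (hK : ∀ i j, ContDiffOn ℝ 1 (K i j) D)
    (hk : ∀ p ∈ G.periods, Complex.exp (-(Complex.I * k * p)) = 1) (hq : hbar * β * k = q)
    {b₁ b₂ : (Fin n → ℝ) → ℝ}
    (heq : ∀ z, basePoint n z ∈ D → (∑ i, horizD β A (horizFlux β A K u i) i z)
      + (b₁ (basePoint n z) : ℂ) * pd 0 (pd 0 u) z + (b₂ (basePoint n z) : ℂ) * u z = 0)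
    {x : Fin n → ℝ} (hx : x ∈ D) :
    gaugeDiv hbar q A (fun i z => ∑ j, (K i j z : ℂ) *
        gaugeD hbar q A (fiberCoeff G κ k u) j z) x
      + hbar ^ 2 * (b₂ x - b₁ x * k ^ 2) * fiberCoeff G κ k u x = 0 := by
  -- The flux is again regular along the fibers, so the rule for horizontal derivatives can be
  -- applied a second time, to its divergence.
  have hV := fun i => FiberRegular.horizFlux (β := β) hD hA hK hpu i
  have i1 : FiberIntegrableAt G k (fun z => ∑ i, horizD β A (horizFlux β A K u i) i z) x :=
    FiberIntegrableAt.sum fun i _ => fiberIntegrableAt_horizD hD (hV i) hx i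
  have i2 : FiberIntegrableAt G k (fun z => (b₁ (basePoint n z) : ℂ) * pd 0 (pd 0 u) z) x :=
    ((hpu 0).integrableAt_pd hD hx 0).base_mul fun x => (b₁ x : ℂ)
  have i3 : FiberIntegrableAt G k (fun z => (b₂ (basePoint n z) : ℂ) * u z) x :=
    (hu.integrableAt hx).base_mul fun x => (b₂ x : ℂ)
  have h1 := fiberCoeff_congr (G := G) (κ := κ) (k := k)
    (u := fun z => (∑ i, horizD β A (horizFlux β A K u i) i z)
      + (b₁ (basePoint n z) : ℂ) * pd 0 (pd 0 u) z + (b₂ (basePoint n z) : ℂ) * u z)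
    (v := fun _ => 0) fun y => heq (fiberPoint y x) hx
  rw [fiberCoeff_add (i1.add i2) i3, fiberCoeff_add i1 i2,
    fiberCoeff_sum fun i _ => fiberIntegrableAt_horizD hD (hV i) hx i,
    fiberCoeff_base_mul (fun x => (b₁ x : ℂ)), fiberCoeff_base_mul (fun x => (b₂ x : ℂ)),
    fiberCoeff_pd_zero hD (hpu 0) hx hk, fiberCoeff_pd_zero hD hu hx hk] at h1
  have h2 : fiberCoeff G κ k (fun _ : Fin (n + 1) → ℝ => 0) x = 0 := by simp [fiberCoeff]
  rw [h2] at h1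
  have h3 : gaugeDiv hbar q A (fun i z => ∑ j, (K i j z : ℂ) *
      gaugeD hbar q A (fiberCoeff G κ k u) j z) x = (hbar : ℂ) ^ 2 *
      ∑ i, fiberCoeff G κ k (horizD β A (horizFlux β A K u i) i) x := by
    rw [gaugeDiv, Finset.mul_sum]
    refine Finset.sum_congr rfl fun i _ => ?_
    have h4 : (fun z => ∑ j, (K i j z : ℂ) * gaugeD hbar q A (fiberCoeff G κ k u) j z) =ᶠ[𝓝 x]
        fun z => hbar * fiberCoeff G κ k (horizFlux β A K u i) z := by
      filter_upwards [hD.mem_nhds hx] with z hz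
      exact (fiberCoeff_horizFlux hD hu hz hk hq i).symm
    have h5 := fiberCoeff_horizD (κ := κ) (A := A) hD (hV i) hx hk hq i
    rw [pow_two, mul_assoc, h5, gaugeD, gaugeD, pd_congr h4,
      ← fiberCoeff_horizFlux hD hu hx hk hq i,
      pd_const_mul (hasFDerivAt_fiberCoeff hD (hV i) hx).2.differentiableAt]
    ring
  rw [h3]
  -- The vertical term appears as b₁ (ik)². The multiple of `Complex.I_sq` turns it into -b₁ k².
  linear_combination (hbar : ℂ) ^ 2 * h1 -
    (hbar : ℂ) ^ 2 * b₁ x * k ^ 2 * fiberCoeff G κ k u x * Complex.I_sq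

end Reduction

/-! ### Criteria for regularity along the fibers -/

section Regularity

variable {n : ℕ} {G : StructureGroup} {D : Set (Fin n → ℝ)} {u : (Fin (n + 1) → ℝ) → ℂ}

/-- The splitting of `ℝⁿ⁺¹` into base and fiber. -/
def fiberSplit (n : ℕ) : (Fin (n + 1) → ℝ) ≃ₗᵢ[ℝ] (Fin n → ℝ) × ℝ where
  toFun z := (basePoint n z, z 0)
  map_add' _ _ := rfl
  map_smul' _ _ := rfl
  invFun p := fiberPoint p.2 p.1
  left_inv := fiberPoint_basePoint
  right_inv _ := rfl
  norm_map' z := by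
    refine le_antisymm (max_le ?_ (norm_le_pi_norm z 0)) ?_
    · exact (pi_norm_le_iff_of_nonneg (norm_nonneg _)).2 fun i => norm_le_pi_norm z i.succ
    · refine (pi_norm_le_iff_of_nonneg (norm_nonneg _)).2 fun i => ?_
      induction i using Fin.cases with
      | zero => exact le_max_right _ _
      | succ i => exact (norm_le_pi_norm (basePoint n z) i).trans (le_max_left _ _)

/-- The integrability hypothesis on Ψ is stated on the product of base and fiber. The splitting is a
linear isometry for the sup norms, so the bounds transfer without constants. -/
lemma norm_iteratedFDeriv_fiberPoint (u : (Fin (n + 1) → ℝ) → ℂ) (j : ℕ) (y : ℝ)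
    (x : Fin n → ℝ) :
    ‖iteratedFDeriv ℝ j (fun z : (Fin n → ℝ) × ℝ => u (fiberPoint z.2 z.1)) (x, y)‖ =
      ‖iteratedFDeriv ℝ j u (fiberPoint y x)‖ :=
  (fiberSplit n).symm.norm_iteratedFDeriv_comp_right u (x, y) j

/-- A small closed ball times a closed interval is compact. For U(1) the resulting constants are
integrable over one period and serve as dominating functions. -/
lemma exists_bound_of_continuousOn (hD : IsOpen D) {E : Type*} [NormedAddCommGroup E]
    {f : (Fin (n + 1) → ℝ) → E} (hf : ContinuousOn f (basePoint n ⁻¹' D)) {x₀ : Fin n → ℝ}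
    (hx₀ : x₀ ∈ D) (l r : ℝ) :
    ∃ C, ∀ᶠ x in 𝓝 x₀, ∀ y ∈ Set.Ioc l r, ‖f (fiberPoint y x)‖ ≤ C := by
  obtain ⟨ε, hε, hball⟩ := Metric.nhds_basis_closedBall.mem_iff.1 (hD.mem_nhds hx₀)
  have hK : IsCompact ((fun p : ℝ × (Fin n → ℝ) => fiberPoint p.1 p.2) ''
      (Set.Icc l r ×ˢ Metric.closedBall x₀ ε)) :=
    (isCompact_Icc.prod (isCompact_closedBall x₀ ε)).image continuous_fiberPoint
  obtain ⟨C, hC⟩ := hK.exists_bound_of_continuousOn (hf.mono (by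
    rintro _ ⟨p, hp, rfl⟩
    exact hball hp.2))
  refine ⟨C, ?_⟩
  filter_upwards [Metric.closedBall_mem_nhds x₀ hε] with x hx y hy
  exact hC _ ⟨(y, x), ⟨⟨hy.1.le, hy.2⟩, hx⟩, rfl⟩

lemma pd_periodic (hD : IsOpen D) {p : ℝ}
    (h : ∀ x ∈ D, ∀ y : ℝ, u (fiberPoint (y + p) x) = u (fiberPoint y x)) (i : Fin (n + 1))
    {x : Fin n → ℝ} (hx : x ∈ D) (y : ℝ) :
    pd i u (fiberPoint (y + p) x) = pd i u (fiberPoint y x) := by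
  have h1 : ∀ z : Fin (n + 1) → ℝ, z + p • Pi.single 0 1 = fiberPoint (z 0 + p) (basePoint n z) := by
    intro z
    ext j
    induction j using Fin.cases <;> simp
  have h2 : (fun z => u (z + p • Pi.single 0 1)) =ᶠ[𝓝 (fiberPoint y x)] u := by
    filter_upwards [(FiberRegular.isOpen_preimage hD).mem_nhds
      (show fiberPoint y x ∈ basePoint n ⁻¹' D from hx)] with z hz
    rw [h1, h _ hz, fiberPoint_basePoint]
  have h3 := h2.fderiv_eq (𝕜 := ℝ)
  rw [fderiv_comp_add_right, h1] at h3
  rw [pd, pd, ← h3]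
  rfl

lemma norm_fderiv_pd_le {z : Fin (n + 1) → ℝ} (hu : DifferentiableAt ℝ (fderiv ℝ u) z)
    (i : Fin (n + 1)) : ‖fderiv ℝ (pd i u) z‖ ≤ ‖fderiv ℝ (fderiv ℝ u) z‖ := by
  have h1 : fderiv ℝ (pd i u) z = (fderiv ℝ (fderiv ℝ u) z).flip (Pi.single i 1) := by
    have := (hu.hasFDerivAt.clm_apply (hasFDerivAt_const (Pi.single i (1 : ℝ)) z)).fderiv
    change fderiv ℝ (fun y => fderiv ℝ u y (Pi.single i 1)) z = _
    simpa using this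
  rw [h1]
  refine ((fderiv ℝ (fderiv ℝ u) z).flip.le_opNorm _).trans ?_
  rw [ContinuousLinearMap.opNorm_flip, Pi.norm_single, norm_one, mul_one]

/-- A periodic `C²` function whose derivatives of order at most two are dominated is, together with
its partial derivatives, regular along the fibers. -/
lemma fiberRegular_of_dominated (hD : IsOpen D) (hu : ContDiffOn ℝ 2 u (basePoint n ⁻¹' D))
    (hper : ∀ p ∈ G.periods, ∀ x ∈ D, ∀ y : ℝ, u (fiberPoint (y + p) x) = u (fiberPoint y x))
    (hdom : ∀ x₀ ∈ D, ∃ b : ℝ → ℝ, IntegrableOn b G.fiberDomain ∧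
      ∀ᶠ x in 𝓝 x₀, ∀ y ∈ G.fiberDomain, ‖u (fiberPoint y x)‖ ≤ b y ∧
        ‖fderiv ℝ u (fiberPoint y x)‖ ≤ b y ∧ ‖fderiv ℝ (fderiv ℝ u) (fiberPoint y x)‖ ≤ b y) :
    FiberRegular G D u ∧ ∀ i, FiberRegular G D (pd i u) := by
  have hO := FiberRegular.isOpen_preimage hD
  constructor
  · refine ⟨hu.of_le (by norm_num), fun x₀ hx₀ => ?_, hper⟩
    obtain ⟨b, hb, hbu⟩ := hdom x₀ hx₀
    exact ⟨b, hb, hbu.mono fun x hx y hy => ⟨(hx y hy).1, (hx y hy).2.1⟩⟩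
  · intro i
    refine ⟨contDiffOn_pd hO hu (by norm_num) i, fun x₀ hx₀ => ?_,
      fun p hp x hx y => pd_periodic hD (hper p hp) i hx y⟩
    obtain ⟨b, hb, hbu⟩ := hdom x₀ hx₀
    refine ⟨b, hb, ?_⟩
    filter_upwards [hbu, hD.mem_nhds hx₀] with x hx hxD y hy
    constructor
    · refine ((fderiv ℝ u (fiberPoint y x)).le_opNorm _).trans ?_
      rw [Pi.norm_single, norm_one, mul_one]
      exact (hx y hy).2.1
    · refine (norm_fderiv_pd_le ?_ i).trans (hx y hy).2.2
      exact ((hu.fderiv_of_isOpen (m := 1) hO (by norm_num)).contDiffAt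
        (hO.mem_nhds hxD)).differentiableAt one_ne_zero

end Regularity

/-! ### Regularity of the Klein-Gordon field -/

section BundleField

variable {M P : Type*}
  [TopologicalSpace M] [ChartedSpace (EuclideanSpace ℝ (Fin 4)) M]
  [TopologicalSpace P] [ChartedSpace (EuclideanSpace ℝ (Fin 5)) P] [AddAction ℝ P]
  {G : StructureGroup} {B : PrincipalBundle M P G} {c : CoordSystem 4 M} {s : M → P} {U : Set M}

lemma SectionCoord.contDiffOn_field (h : SectionCoord B c s U) {Ψ : P → ℂ}
    (hΨ : ContMDiff (𝓡 5) 𝓘(ℝ, ℂ) 2 Ψ) :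
    ContDiffOn ℝ 2 (fun z => Ψ (bundleParam c s z)) (basePoint 4 ⁻¹' c.dom) :=
  contMDiffOn_iff_contDiffOn.1 (hΨ.comp_contMDiffOn (h.contMDiffOn_bundleParam.of_le
    ENat.LEInfty.out))

lemma SectionCoord.fiberRegular_field (h : SectionCoord B c s U) {Ψ : P → ℂ}
    (hΨ : ContMDiff (𝓡 5) 𝓘(ℝ, ℂ) 2 Ψ) (hint : FiberIntegrable G s U Ψ) :
    FiberRegular G c.dom (fun z => Ψ (bundleParam c s z)) ∧
      ∀ i, FiberRegular G c.dom (pd i fun z => Ψ (bundleParam c s z)) := by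
  have hC := h.contDiffOn_field hΨ
  refine fiberRegular_of_dominated c.isOpen_dom hC ?_ ?_
  · intro p hp x _ y
    have : p +ᵥ s (c.param x) = s (c.param x) := (B.vadd_eq_iff _ _).2 hp
    simp only [bundleParam, fiberPoint_zero, basePoint_fiberPoint, ← vadd_vadd, this]
  · intro x₀ hx₀
    have hO := FiberRegular.isOpen_preimage (n := 4) c.isOpen_dom
    cases G with
    | T1 =>
      obtain ⟨b, hb, hbx⟩ := hint c h.mapsTo x₀ hx₀
      refine ⟨b, hb.integrableOn, hbx.mono fun x hx y _ => ?_⟩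
      have hx' : ∀ j ≤ 2, ‖iteratedFDeriv ℝ j (fun z => Ψ (bundleParam c s z)) (fiberPoint y x)‖
          ≤ b y := fun j hj => by
        rw [← norm_iteratedFDeriv_fiberPoint]
        exact hx y j hj
      refine ⟨?_, ?_, ?_⟩
      · simpa using hx' 0 (by norm_num)
      · simpa [norm_iteratedFDeriv_one] using hx' 1 (by norm_num)
      · have := hx' 2 le_rfl
        rwa [← norm_iteratedFDeriv_fderiv, norm_iteratedFDeriv_one] at this
    | U1 =>
      have hf := hC.fderiv_of_isOpen (m := 1) hO (by norm_num)
      have hff := hf.continuousOn_fderiv_of_isOpen hO le_rfl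
      obtain ⟨C₀, hC₀⟩ := exists_bound_of_continuousOn c.isOpen_dom hC.continuousOn hx₀ 0
        (2 * Real.pi)
      obtain ⟨C₁, hC₁⟩ := exists_bound_of_continuousOn c.isOpen_dom hf.continuousOn hx₀ 0
        (2 * Real.pi)
      obtain ⟨C₂, hC₂⟩ := exists_bound_of_continuousOn c.isOpen_dom hff hx₀ 0 (2 * Real.pi)
      refine ⟨fun _ => max C₀ (max C₁ C₂), continuous_const.integrableOn_Ioc, ?_⟩
      filter_upwards [hC₀, hC₁, hC₂] with x h0 h1 h2 y hy
      exact ⟨(h0 y hy).trans (le_max_left _ _),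
        (h1 y hy).trans ((le_max_left _ _).trans (le_max_right _ _)),
        (h2 y hy).trans ((le_max_right _ _).trans (le_max_right _ _))⟩

end BundleField

/-! ### The Klein-Gordon equation in adapted coordinates -/

section KaluzaKleinEquation

lemma pd_zero_base_mul {n : ℕ} {h : (Fin n → ℝ) → ℝ} {v : (Fin (n + 1) → ℝ) → ℂ}
    {z : Fin (n + 1) → ℝ} (hh : DifferentiableAt ℝ h (basePoint n z))
    (hv : DifferentiableAt ℝ v z) :
    pd 0 (fun w => (h (basePoint n w) : ℂ) * v w) z = (h (basePoint n z) : ℂ) * pd 0 v z := by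
  have h1 : DifferentiableAt ℝ (fun w => ((h (basePoint n w) : ℝ) : ℂ)) z :=
    differentiableAt_ofReal (hh.comp z (basePoint n).differentiableAt)
  rw [pd_mul h1 hv, pd_zero_comp_basePoint (h := fun x => (h x : ℂ)) (differentiableAt_ofReal hh),
    zero_mul, zero_add]

lemma contDiffOn_kkMatrix {n : ℕ} {k : WithTop ℕ∞} {D : Set (Fin n → ℝ)} {σ : ℝ}
    {a : (Fin n → ℝ) → ℝ} {b : Fin n → (Fin n → ℝ) → ℝ}
    {g : (Fin n → ℝ) → Matrix (Fin n) (Fin n) ℝ} (ha : ContDiffOn ℝ k a D)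
    (hb : ∀ i, ContDiffOn ℝ k (b i) D) (hg : ∀ i j, ContDiffOn ℝ k (fun x => g x i j) D)
    (i j : Fin (n + 1)) :
    ContDiffOn ℝ k (fun z => kkMatrix σ (a (basePoint n z)) (fun i => b i (basePoint n z))
      (g (basePoint n z)) i j) (basePoint n ⁻¹' D) := by
  have hc : ∀ {f : (Fin n → ℝ) → ℝ}, ContDiffOn ℝ k f D →
      ContDiffOn ℝ k (fun z => f (basePoint n z)) (basePoint n ⁻¹' D) := fun hf =>
    hf.comp (basePoint n).contDiff.contDiffOn fun _ hz => hz
  have hp : ∀ i : Fin (n + 1), ContDiffOn ℝ k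
      (fun z => fiberPoint 1 (fun i => b i (basePoint n z)) i) (basePoint n ⁻¹' D) := by
    intro i
    induction i using Fin.cases with
    | zero => exact contDiffOn_const
    | succ i => exact hc (hb i)
  refine (contDiffOn_const.mul ?_).sub (((hc ha).pow 2).mul ((hp i).mul (hp j)))
  induction i using Fin.cases with
  | zero => exact contDiffOn_const
  | succ i =>
    induction j using Fin.cases with
    | zero => exact contDiffOn_const
    | succ j => exact hc (hg i j)

lemma kkMatrix_isSymm {n : ℕ} {σ a : ℝ} {b : Fin n → ℝ} {g : Matrix (Fin n) (Fin n) ℝ}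
    (hg : g.IsSymm) : (kkMatrix σ a b g).IsSymm := by
  ext i j
  simp only [Matrix.transpose_apply, kkMatrix, Matrix.of_apply, mul_comm (fiberPoint 1 b i)]
  congr 2
  induction i using Fin.cases with
  | zero => induction j using Fin.cases <;> rfl
  | succ i =>
    induction j using Fin.cases with
    | zero => rfl
    | succ j => exact hg.apply i j

/-- The shear by `b` has determinant one, and the sign σ enters only as σ⁴ = 1. -/
lemma sqrt_abs_det_kkMatrix {σ a : ℝ} (hσ : σ ^ 2 = 1) (ha : 0 < a) (b : Fin 4 → ℝ)
    (g : Matrix (Fin 4) (Fin 4) ℝ) : √|(kkMatrix σ a b g).det| = a * √|g.det| := by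
  have h : |(kkMatrix σ a b g).det| = a ^ 2 * |g.det| := by
    rw [det_kkMatrix, show σ ^ 4 = (σ ^ 2) ^ 2 by ring, hσ, one_pow, one_mul, abs_mul, abs_neg,
      abs_of_nonneg (sq_nonneg a)]
  rw [h, Real.sqrt_mul (sq_nonneg a), Real.sqrt_sq ha.le]

variable {M P : Type*}
  [TopologicalSpace M] [ChartedSpace (EuclideanSpace ℝ (Fin 4)) M]
  [TopologicalSpace P] [ChartedSpace (EuclideanSpace ℝ (Fin 5)) P] [AddAction ℝ P]
  {G : StructureGroup} {B : PrincipalBundle M P G} {c : CoordSystem 4 M} {s : M → P} {U : Set M}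

/-- The Klein-Gordon equation on the bundle, split into horizontal and vertical parts. -/
lemma SectionCoord.horizontal_equation (h : SectionCoord B c s U) {conn : OneForm 5 P}
    (hconn : IsConnectionForm conn) {β : ℝ} (hβ : β ≠ 0) {σ : ℝ} (hσ : σ ^ 2 = 1)
    {g₀ : BilinField 4 M} (hg₀ : IsLorentzMetric g₀) {a : M → ℝ}
    (ha : ContMDiff (𝓡 4) 𝓘(ℝ, ℝ) ∞ a) (ha_pos : ∀ x, 0 < a x) {hbar μ : ℝ} (hbar0 : hbar ≠ 0)
    {Ψ : P → ℂ} (hΨ : SolvesNeutralKG hbar (kkMetric B σ g₀ a conn) μ Ψ)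
    (hreg : ∀ i, FiberRegular G c.dom (pd i fun z => Ψ (bundleParam c s z)))
    {z : Fin 5 → ℝ} (hz : basePoint 4 z ∈ c.dom) :
    (∑ i, horizD β ((gaugePotential β conn s).comp c)
      (horizFlux β ((gaugePotential β conn s).comp c)
        (fun i j x => σ * a (c.param x) * invDensity (g₀.comp c) i j x)
        (fun z => Ψ (bundleParam c s z)) i) i z)
      + ((fun x => -(√|(g₀.comp c x).det| / a (c.param x))) (basePoint 4 z) : ℝ) *
        pd 0 (pd 0 fun z => Ψ (bundleParam c s z)) z
      + ((fun x => μ * (a (c.param x) * √|(g₀.comp c x).det|) / hbar ^ 2) (basePoint 4 z) : ℝ) *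
        Ψ (bundleParam c s z) = 0 := by
  set F : (Fin 5 → ℝ) → ℂ := fun z => Ψ (bundleParam c s z) with hF
  set A := (gaugePotential β conn s).comp c with hA
  set K : Fin 4 → Fin 4 → (Fin 4 → ℝ) → ℝ :=
    fun i j x => σ * a (c.param x) * invDensity (g₀.comp c) i j x with hK
  -- The window in y is centred at the point under consideration, so a single window suffices there.
  let C := h.coord hconn (z 0)
  set g := (kkMetric B σ g₀ a conn).comp C with hg
  let a' : (Fin 4 → ℝ) → ℝ := fun x => a (c.param x)
  let w₀ : (Fin 4 → ℝ) → ℝ := fun x => √|(g₀.comp c x).det|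
  have hzC : z ∈ C.dom := ⟨hz, by simpa using Real.pi_pos⟩
  have hO := C.isOpen_dom
  have hg₀d : ∀ x ∈ c.dom, (g₀.comp c x).det ≠ 0 := fun x hx => hg₀.det_comp_ne_zero c hx
  have hg₀s : ∀ i j, ContDiffOn ℝ 1 (fun x => g₀.comp c x i j) c.dom := fun i j =>
    (hg₀.smooth c i j).of_le ENat.LEInfty.out
  have has : ContDiffOn ℝ 1 a' c.dom := (c.contDiffOn_comp le_rfl ha).of_le ENat.LEInfty.out
  have hAs : ∀ i, ContDiffOn ℝ 1 (A i) c.dom := fun i =>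
    (h.contDiffOn_gaugePotential hconn hβ i).of_le ENat.LEInfty.out
  have hw₀s : ContDiffOn ℝ 1 w₀ c.dom := contDiffOn_sqrt_abs_det (k := 1) hg₀s hg₀d
  have hKs : ∀ i j, ContDiffOn ℝ 1 (K i j) c.dom := fun i j =>
    (contDiffOn_const.mul has).mul (contDiffOn_invDensity (k := 1) hg₀s hg₀d i j)
  have hgk : ∀ w ∈ C.dom, g w = kkMatrix σ (a' (basePoint 4 w))
      (fun i => β * A i (basePoint 4 w)) (g₀.comp c (basePoint 4 w)) := by
    intro w hw
    have := h.kkMetric_comp hconn hβ σ g₀ a (z 0) (w 0) (x := basePoint 4 w) hw.1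
    rwa [fiberPoint_basePoint] at this
  have hgs : ∀ i j, ContDiffOn ℝ 1 (fun w => g w i j) C.dom := fun i j =>
    ((contDiffOn_kkMatrix has (fun i => contDiffOn_const.mul (hAs i)) hg₀s i j).mono
      Set.inter_subset_left).congr fun w hw => by rw [hgk w hw]
  have hgd : ∀ w ∈ C.dom, (g w).det ≠ 0 := by
    intro w hw
    rw [hgk w hw, det_kkMatrix]
    have hσ0 : σ ≠ 0 := fun h0 => by norm_num [h0] at hσ
    exact mul_ne_zero (neg_ne_zero.2 (pow_ne_zero _ (ha_pos _).ne'))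
      (mul_ne_zero (pow_ne_zero _ hσ0) (hg₀d _ hw.1))
  have hgsymm : (g z).IsSymm := by
    rw [hgk z hzC]
    exact kkMatrix_isSymm (hg₀.isSymm_comp c _)
  have hFs : ContDiffOn ℝ 2 F C.dom := (h.contDiffOn_field hΨ.1).mono Set.inter_subset_left
  have hdens : ∀ w ∈ C.dom, ∀ i j, invDensity g i j w =
      a' (basePoint 4 w) * w₀ (basePoint 4 w) * kkInv σ (a' (basePoint 4 w))
        (fun i => β * A i (basePoint 4 w)) (g₀.comp c (basePoint 4 w)) i j := by
    intro w hw i j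
    rw [invDensity, hgk w hw, sqrt_abs_det_kkMatrix hσ (ha_pos _),
      kkMatrix_inv hσ (ha_pos _).ne' _ (hg₀d _ hw.1)]
  have hV : ∀ i, FiberRegular G c.dom (horizFlux β A K F i) := fun i =>
    FiberRegular.horizFlux c.isOpen_dom hAs hKs hreg i
  -- In the base directions the y-column of the inverse supplies exactly the -βA_j ∂_y that
  -- completes ∂_j to its horizontal lift.
  have hflux : ∀ i : Fin 4, (fun w => ∑ j, (invDensity g i.succ j w : ℂ) * pd j F w) =ᶠ[𝓝 z]
      horizFlux β A K F i := by
    intro i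
    filter_upwards [hO.mem_nhds hzC] with w hw
    simp only [hdens w hw]
    rw [Fin.sum_univ_succ]
    simp only [kkInv, Matrix.of_apply, Fin.cons_zero, Fin.cons_succ, horizFlux, horizD, hK,
      invDensity]
    have e1 : ((a' (basePoint 4 w) * w₀ (basePoint 4 w) * -(σ * ∑ j,
        (g₀.comp c (basePoint 4 w))⁻¹ i j * (β * A j (basePoint 4 w))) : ℝ) : ℂ) * pd 0 F w =
        ∑ j, ((σ * a (c.param (basePoint 4 w)) * (w₀ (basePoint 4 w) *
          (g₀.comp c (basePoint 4 w))⁻¹ i j) : ℝ) : ℂ) *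
            (((-(β * A j (basePoint 4 w)) : ℝ) : ℂ) * pd 0 F w) := by
      push_cast
      simp only [Finset.mul_sum, Finset.sum_mul, ← Finset.sum_neg_distrib]
      refine Finset.sum_congr rfl fun j _ => ?_
      simp only [a']
      ring
    rw [e1, ← Finset.sum_add_distrib]
    refine Finset.sum_congr rfl fun j _ => ?_
    simp only [a', w₀]
    push_cast
    ring
  -- In the y-direction the quadratic part of the corner entry and the mixed entries recombine into
  -- -βA_i times the horizontal flux. Only -a⁻² of the corner is left, which after the density a
  -- √|det g₀| gives -√|det g₀|/a.
  have hvert : (fun w => ∑ j, (invDensity g 0 j w : ℂ) * pd j F w) =ᶠ[𝓝 z]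
      fun w => ((fun x => -(w₀ x / a' x)) (basePoint 4 w) : ℝ) * pd 0 F w +
        ∑ i, ((fun x => -(β * A i x)) (basePoint 4 w) : ℝ) * horizFlux β A K F i w := by
    filter_upwards [hO.mem_nhds hzC] with w hw
    simp only [hdens w hw]
    rw [Fin.sum_univ_succ]
    simp only [kkInv, Matrix.of_apply, Fin.cons_zero, Fin.cons_succ, horizFlux, horizD, hK,
      invDensity]
    have ha0 : (a' (basePoint 4 w) : ℂ) ≠ 0 := Complex.ofReal_ne_zero.2 (ha_pos _).ne'
    have e1 : ((a' (basePoint 4 w) * w₀ (basePoint 4 w) * (-(a' (basePoint 4 w) ^ 2)⁻¹ +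
        σ * ∑ i, ∑ j, β * A i (basePoint 4 w) * (g₀.comp c (basePoint 4 w))⁻¹ i j *
          (β * A j (basePoint 4 w))) : ℝ) : ℂ) * pd 0 F w =
        ((-(w₀ (basePoint 4 w) / a' (basePoint 4 w)) : ℝ) : ℂ) * pd 0 F w +
        ∑ i, ∑ j, (a' (basePoint 4 w) * w₀ (basePoint 4 w) * (σ * (β * A i (basePoint 4 w) *
          (g₀.comp c (basePoint 4 w))⁻¹ i j * (β * A j (basePoint 4 w)))) : ℝ) * pd 0 F w := by
      simp only [← Finset.sum_mul, ← Finset.mul_sum, ← Complex.ofReal_sum]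
      push_cast
      field_simp
    have e2 : ∑ j : Fin 4, ((a' (basePoint 4 w) * w₀ (basePoint 4 w) * -(σ * ∑ i,
        β * A i (basePoint 4 w) * (g₀.comp c (basePoint 4 w))⁻¹ i j) : ℝ) : ℂ) * pd j.succ F w =
        ∑ i, ∑ j, ((a' (basePoint 4 w) * w₀ (basePoint 4 w) * -(σ * (β * A i (basePoint 4 w) *
          (g₀.comp c (basePoint 4 w))⁻¹ i j)) : ℝ) : ℂ) * pd j.succ F w := by
      rw [Finset.sum_comm]
      simp only [← Finset.sum_mul, ← Finset.mul_sum, ← Complex.ofReal_sum,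
        Finset.sum_neg_distrib]
    rw [e1, e2, add_assoc, ← Finset.sum_add_distrib]
    congr 1
    refine Finset.sum_congr rfl fun i _ => ?_
    rw [← Finset.sum_add_distrib, Finset.mul_sum]
    refine Finset.sum_congr rfl fun j _ => ?_
    simp only [a', w₀]
    push_cast
    ring
  have hbox := sqrt_det_mul_box hO hgs hgd hzC hgsymm hFs
  have hpde : (hbar : ℂ) ^ 2 * box g F z + μ * F z = 0 := hΨ.2 C z hzC
  have hd1 : ∀ {f : (Fin 4 → ℝ) → ℝ}, ContDiffOn ℝ 1 f c.dom →
      DifferentiableAt ℝ f (basePoint 4 z) := fun hf =>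
    (hf.contDiffAt (c.isOpen_dom.mem_nhds hz)).differentiableAt one_ne_zero
  have hb1 : DifferentiableAt ℝ (fun x => -(w₀ x / a' x)) (basePoint 4 z) :=
    hd1 (hw₀s.div has fun x _ => (ha_pos _).ne').neg
  have hb2 : ∀ i, DifferentiableAt ℝ (fun x => -(β * A i x)) (basePoint 4 z) := fun i =>
    hd1 (contDiffOn_const.mul (hAs i)).neg
  have hp0 : DifferentiableAt ℝ (pd 0 F) z := (hreg 0).differentiableAt c.isOpen_dom hz
  have hVd : ∀ i, DifferentiableAt ℝ (horizFlux β A K F i) z := fun i =>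
    (hV i).differentiableAt c.isOpen_dom hz
  have hbm : ∀ {f : (Fin 4 → ℝ) → ℝ} {v : (Fin 5 → ℝ) → ℂ},
      DifferentiableAt ℝ f (basePoint 4 z) → DifferentiableAt ℝ v z →
      DifferentiableAt ℝ (fun w => (f (basePoint 4 w) : ℂ) * v w) z := fun hf hv =>
    (differentiableAt_ofReal (hf.comp z (basePoint 4).differentiableAt)).mul hv
  -- Split the divergence into its y-part and its base part. The coefficients are functions of the
  -- base point, so ∂_y passes through them.
  rw [Fin.sum_univ_succ, pd_congr hvert,
    pd_add (hbm hb1 hp0) (DifferentiableAt.fun_sum fun i _ => hbm (hb2 i) (hVd i)),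
    pd_zero_base_mul hb1 hp0, pd_sum fun i _ => hbm (hb2 i) (hVd i)] at hbox
  simp only [fun i => pd_zero_base_mul (hb2 i) (hVd i), fun i => pd_congr (hflux i) i.succ] at hbox
  have hdet : √|(g z).det| = a' (basePoint 4 z) * w₀ (basePoint 4 z) := by
    rw [hgk z hzC, sqrt_abs_det_kkMatrix hσ (ha_pos _)]
  rw [hdet] at hbox
  have hsum : ∑ i, horizD β A (horizFlux β A K F i) i z =
      ∑ i, ((-(β * A i (basePoint 4 z)) : ℝ) : ℂ) * pd 0 (horizFlux β A K F i) z +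
      ∑ i : Fin 4, pd i.succ (horizFlux β A K F i) z := by
    rw [← Finset.sum_add_distrib]
    exact Finset.sum_congr rfl fun i _ => add_comm _ _
  have hbc : (hbar : ℂ) ≠ 0 := Complex.ofReal_ne_zero.2 hbar0
  have hfin : box g F z = -(μ / hbar ^ 2) * F z := by
    field_simp
    linear_combination hpde
  rw [hfin] at hbox
  rw [hsum]
  push_cast at hbox ⊢
  linear_combination -hbox

end KaluzaKleinEquation

/-! ### Conformal change to constant mass -/

section Conformal

lemma gaugeD_congr {n : ℕ} {hbar q : ℝ} {A : Fin n → (Fin n → ℝ) → ℝ} {f g : (Fin n → ℝ) → ℂ}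
    {x : Fin n → ℝ} (h : f =ᶠ[𝓝 x] g) (i : Fin n) :
    gaugeD hbar q A f i x = gaugeD hbar q A g i x := by
  rw [gaugeD, gaugeD, pd_congr h, h.self_of_nhds]

lemma gaugeD_ofReal_mul {n : ℕ} {hbar q : ℝ} {A : Fin n → (Fin n → ℝ) → ℝ} {r : (Fin n → ℝ) → ℝ}
    {f : (Fin n → ℝ) → ℂ} {x : Fin n → ℝ} (hr : DifferentiableAt ℝ r x)
    (hf : DifferentiableAt ℝ f x) (j : Fin n) :
    gaugeD hbar q A (fun z => (r z : ℂ) * f z) j x =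
      r x * gaugeD hbar q A f j x + hbar * pd j r x * f x := by
  rw [gaugeD, gaugeD, pd_mul (differentiableAt_ofReal hr) hf, pd_ofReal hr]
  ring

lemma gaugeDiv_const_mul {n : ℕ} {hbar q : ℝ} {A : Fin n → (Fin n → ℝ) → ℝ} (r : ℝ)
    {V : Fin n → (Fin n → ℝ) → ℂ} {x : Fin n → ℝ} (hV : ∀ i, DifferentiableAt ℝ (V i) x) :
    gaugeDiv hbar q A (fun i z => (r : ℂ) * V i z) x = r * gaugeDiv hbar q A V x := by
  simp only [gaugeDiv, gaugeD, Finset.mul_sum]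
  refine Finset.sum_congr rfl fun i _ => ?_
  rw [pd_const_mul (hV i)]
  ring

/-- In dimension four √|det g| scales by r² and g⁻¹ by r⁻¹, which leaves a single factor r. Both
conformal changes of the argument depend on this exponent. -/
lemma invDensity_smul {g : (Fin 4 → ℝ) → Matrix (Fin 4) (Fin 4) ℝ} {r : (Fin 4 → ℝ) → ℝ}
    {x : Fin 4 → ℝ} (hr : 0 < r x) (i j : Fin 4) :
    invDensity (fun z => r z • g z) i j x = r x * invDensity g i j x := by
  have h1 : |(r x • g x).det| = (r x ^ 2) ^ 2 * |(g x).det| := by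
    rw [Matrix.det_smul, Fintype.card_fin, abs_mul, abs_of_pos (pow_pos hr 4)]
    ring
  have h2 : (r x • g x)⁻¹ = (r x)⁻¹ • (g x)⁻¹ := by
    by_cases hd : IsUnit (g x).det
    · refine Matrix.inv_eq_left_inv ?_
      rw [smul_mul_smul_comm, inv_mul_cancel₀ hr.ne', Matrix.nonsing_inv_mul _ hd, one_smul]
    · rw [Matrix.nonsing_inv_apply_not_isUnit _ hd, smul_zero, Matrix.nonsing_inv_apply_not_isUnit]
      rw [isUnit_iff_ne_zero, not_not] at hd ⊢
      rw [Matrix.det_smul, hd, mul_zero]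
  rw [invDensity, invDensity, h1, h2, Real.sqrt_mul (sq_nonneg _), Real.sqrt_sq (sq_nonneg _),
    Matrix.smul_apply, smul_eq_mul]
  field_simp

lemma sqrt_abs_det_smul {g : Matrix (Fin 4) (Fin 4) ℝ} (r : ℝ) :
    √|(r • g).det| = r ^ 2 * √|g.det| := by
  have h1 : |(r • g).det| = (r ^ 2) ^ 2 * |g.det| := by
    rw [Matrix.det_smul, Fintype.card_fin, abs_mul, show r ^ 4 = (r ^ 2) ^ 2 by ring,
      abs_of_nonneg (sq_nonneg (r ^ 2))]
  rw [h1, Real.sqrt_mul (sq_nonneg _), Real.sqrt_sq (sq_nonneg _)]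

/-- Division of a charged field by a solution of the quartic field equation, which makes the mass
constant after the corresponding conformal change of the metric. -/
lemma gaugeBox_conformal {D : Set (Fin 4 → ℝ)} (hD : IsOpen D)
    {g : (Fin 4 → ℝ) → Matrix (Fin 4) (Fin 4) ℝ}
    (hg : ∀ i j, ContDiffOn ℝ 1 (fun z => g z i j) D) (hdet : ∀ z ∈ D, (g z).det ≠ 0)
    (hsymm : ∀ z ∈ D, (g z).IsSymm) {hbar q m : ℝ} (hm : 0 < m)
    {A : Fin 4 → (Fin 4 → ℝ) → ℝ} (hA : ∀ i, ContDiffOn ℝ 1 (A i) D)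
    {α : (Fin 4 → ℝ) → ℝ} (hα : ContDiffOn ℝ 2 α D) (hα0 : ∀ z ∈ D, α z ≠ 0)
    {ψ : (Fin 4 → ℝ) → ℂ} (hψ : ContDiffOn ℝ 2 ψ D) {x : Fin 4 → ℝ} (hx : x ∈ D) {W : ℝ}
    (hEL : hbar ^ 2 * ∑ i, pd i (fun z => ∑ j, invDensity g i j z * pd j α z) x =
      √|(g x).det| * (α x ^ 3 - W * α x))
    (hKG : gaugeDiv hbar q A (fun i z => ∑ j, (invDensity g i j z : ℂ) *
        gaugeD hbar q A (fun w => (α w : ℂ) * ψ w) j z) x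
      + √|(g x).det| * W * (α x * ψ x) = 0) :
    gaugeBox hbar q A (fun z => (α z ^ 2 / m ^ 2) • g z) ψ x + m ^ 2 * ψ x = 0 := by
  set H := invDensity g with hH
  set w : ℝ := √|(g x).det| with hw
  have hw0 : w ≠ 0 := (Real.sqrt_pos.2 (abs_pos.2 (hdet x hx))).ne'
  have hHs : ∀ i j, ContDiffOn ℝ 1 (H i j) D := contDiffOn_invDensity (k := 1) hg hdet
  let X : Fin 4 → (Fin 4 → ℝ) → ℂ := fun i z => ∑ j, (H i j z : ℂ) * gaugeD hbar q A ψ j z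
  let Y : Fin 4 → (Fin 4 → ℝ) → ℝ := fun i z => ∑ j, H i j z * pd j α z
  have hr0 : ∀ z ∈ D, 0 < α z ^ 2 / m ^ 2 := fun z hz => by
    have := hα0 z hz
    positivity
  have hα1 : ContDiffOn ℝ 1 α D := hα.of_le (by norm_num)
  have hψ1 : ContDiffOn ℝ 1 ψ D := hψ.of_le (by norm_num)
  have hr1 : ContDiffOn ℝ 1 (fun z => α z ^ 2 / m ^ 2) D := (hα1.pow 2).div_const _
  have hX : ∀ i, ContDiffOn ℝ 1 (X i) D := fun i => ContDiffOn.sum fun j _ =>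
    (contDiffOn_ofReal (hHs i j)).mul (contDiffOn_gaugeD hD hA hψ j)
  have hY : ∀ i, ContDiffOn ℝ 1 (Y i) D := fun i => ContDiffOn.sum fun j _ =>
    (hHs i j).mul (contDiffOn_pd hD hα (by norm_num) j)
  have diff : ∀ {F : Type} [NormedAddCommGroup F] [NormedSpace ℝ F] {f : (Fin 4 → ℝ) → F} {z},
      ContDiffOn ℝ 1 f D → z ∈ D → DifferentiableAt ℝ f z := fun hf hz =>
    (hf.contDiffAt (hD.mem_nhds hz)).differentiableAt one_ne_zero
  have hbox := sqrt_det_mul_gaugeBox (g := fun z => (α z ^ 2 / m ^ 2) • g z) (q := q)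
    (hbar := hbar) hD (fun i j => hr1.mul (hg i j))
    (fun z hz => by
      rw [Matrix.det_smul]
      exact mul_ne_zero (pow_ne_zero _ (hr0 z hz).ne') (hdet z hz)) hx
    ((hsymm x hx).smul _) hA hψ
  have e1 : ∀ i, (fun z => ∑ j, (invDensity (fun z => (α z ^ 2 / m ^ 2) • g z) i j z : ℂ) *
      gaugeD hbar q A ψ j z) =ᶠ[𝓝 x] fun z => ((α z ^ 2 / m ^ 2 : ℝ) : ℂ) * X i z := by
    intro i
    filter_upwards [hD.mem_nhds hx] with z hz
    simp only [X, Finset.mul_sum]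
    refine Finset.sum_congr rfl fun j _ => ?_
    rw [invDensity_smul (r := fun z => α z ^ 2 / m ^ 2) (hr0 z hz)]
    push_cast
    ring
  have e2 : ∀ i, (fun z => ∑ j, (H i j z : ℂ) *
      gaugeD hbar q A (fun w => (α w : ℂ) * ψ w) j z) =ᶠ[𝓝 x]
      fun z => (α z : ℂ) * X i z + (Y i z : ℂ) * (hbar * ψ z) := by
    intro i
    filter_upwards [hD.mem_nhds hx] with z hz
    simp only [X, Y, Finset.mul_sum, Complex.ofReal_sum, Finset.sum_mul, ← Finset.sum_add_distrib]
    refine Finset.sum_congr rfl fun j _ => ?_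
    rw [gaugeD_ofReal_mul (diff hα1 hz) (diff hψ1 hz)]
    push_cast
    ring
  have hψx := diff hψ1 hx
  have hαx := diff hα1 hx
  have hXx := fun i => diff (hX i) hx
  have hYx := fun i => diff (hY i) hx
  have hpr : ∀ i, pd i (fun z => α z ^ 2 / m ^ 2) x = 2 * α x * pd i α x / m ^ 2 := by
    intro i
    have : (fun z => α z ^ 2 / m ^ 2) = fun z => (m ^ 2)⁻¹ * (α z * α z) := by
      ext z; ring
    rw [this, pd_const_mul (hαx.fun_mul hαx), pd_mul hαx hαx]
    ring
  have h1 : gaugeDiv hbar q A (fun i z => ∑ j,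
      (invDensity (fun z => (α z ^ 2 / m ^ 2) • g z) i j z : ℂ) * gaugeD hbar q A ψ j z) x =
      (α x ^ 2 / m ^ 2) * gaugeDiv hbar q A X x +
        2 * hbar * α x / m ^ 2 * ∑ i, ((pd i α x : ℝ) : ℂ) * X i x := by
    simp only [gaugeDiv, Finset.mul_sum, ← Finset.sum_add_distrib]
    refine Finset.sum_congr rfl fun i _ => ?_
    rw [gaugeD_congr (e1 i), gaugeD_ofReal_mul (diff hr1 hx) (hXx i), hpr]
    push_cast
    ring
  -- The Leibniz rule for D_i(H^{ij} D_j(αψ)): only one factor carries the charge, so derivatives of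
  -- α are ordinary ones.
  have h2 : gaugeDiv hbar q A (fun i z => ∑ j, (H i j z : ℂ) *
        gaugeD hbar q A (fun w => (α w : ℂ) * ψ w) j z) x =
      α x * gaugeDiv hbar q A X x + hbar * ∑ i, ((pd i α x : ℝ) : ℂ) * X i x
      + hbar * ∑ i, (Y i x : ℂ) * gaugeD hbar q A ψ i x
      + hbar ^ 2 * ψ x * ∑ i, ((pd i (Y i) x : ℝ) : ℂ) := by
    simp only [gaugeDiv, Finset.mul_sum, ← Finset.sum_add_distrib]
    refine Finset.sum_congr rfl fun i _ => ?_
    rw [gaugeD_congr (e2 i)]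
    have e3 := gaugeD_ofReal_mul (hbar := hbar) (q := q) (A := A) hαx (hXx i) i
    have e4 := gaugeD_ofReal_mul (hbar := hbar) (q := q) (A := A) (hYx i)
      (hψx.const_mul (hbar : ℂ)) i
    have e5 := pd_add ((differentiableAt_ofReal hαx).fun_mul (hXx i))
      ((differentiableAt_ofReal (hYx i)).fun_mul (hψx.const_mul (hbar : ℂ))) i
    have e6 := pd_const_mul hψx (hbar : ℂ) i
    rw [gaugeD] at e3 e4
    rw [gaugeD, e5]
    simp only [gaugeD, e6] at e3 e4 ⊢
    linear_combination e3 + e4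
  -- Symmetry of the density makes the two cross terms equal. Their sum, times α, is the cross term
  -- of D_i(α² H^{ij} D_j ψ) found in `h1`.
  have h3 : ∑ i, (Y i x : ℂ) * gaugeD hbar q A ψ i x = ∑ i, ((pd i α x : ℝ) : ℂ) * X i x := by
    simp only [X, Y, Complex.ofReal_sum, Finset.sum_mul, Finset.mul_sum]
    rw [Finset.sum_comm]
    refine Finset.sum_congr rfl fun i _ => Finset.sum_congr rfl fun j _ => ?_
    rw [hH, invDensity_symm (hsymm x hx) j i]
    push_cast
    ring
  have hEL' : (hbar : ℂ) ^ 2 * ∑ i, ((pd i (Y i) x : ℝ) : ℂ) = w * (α x ^ 3 - W * α x) := by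
    exact_mod_cast congrArg (fun r : ℝ => (r : ℂ)) hEL
  rw [sqrt_abs_det_smul, h1] at hbox
  rw [h2, h3] at hKG
  have hm0 : (m : ℂ) ≠ 0 := Complex.ofReal_ne_zero.2 hm.ne'
  have hαc : (α x : ℂ) ≠ 0 := Complex.ofReal_ne_zero.2 (hα0 x hx)
  have hwc : (w : ℂ) ≠ 0 := Complex.ofReal_ne_zero.2 hw0
  push_cast at hbox
  rw [← hw] at hbox
  have hne : ((α x : ℂ) ^ 2 / m ^ 2) ^ 2 * w ≠ 0 :=
    mul_ne_zero (pow_ne_zero _ (div_ne_zero (pow_ne_zero _ hαc) (pow_ne_zero _ hm0))) hwc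
  refine (mul_eq_zero_iff_left hne).1 ?_
  rw [mul_add, hbox]
  -- Subtracting ψ times the Euler-Lagrange equation removes both W and the second derivatives of α.
  -- Only the quartic term of the action survives, as α⁴ψ.
  have hfin : (α x : ℂ) ^ 2 / m ^ 2 * gaugeDiv hbar q A X x +
      2 * hbar * α x / m ^ 2 * ∑ i, ((pd i α x : ℝ) : ℂ) * X i x = -(α x ^ 4 / m ^ 2) * w * ψ x := by
    field_simp
    linear_combination hKG - ψ x * hEL'
  rw [hfin]
  field_simp
  ring

end Conformal

/-! ### Charts as coordinate systems -/

section Charts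

variable {n : ℕ} {N : Type*} [TopologicalSpace N] [ChartedSpace (EuclideanSpace ℝ (Fin n)) N]
  [IsManifold (𝓡 n) ∞ N]

/-- The coordinate system of a chart, restricted to the part over `U`. -/
def chartCoord (p : N) {U : Set N} (hU : IsOpen U) : CoordSystem n N where
  dom := (EuclideanSpace.equiv (Fin n) ℝ).symm ⁻¹'
    ((chartAt (EuclideanSpace ℝ (Fin n)) p).target ∩
      (chartAt (EuclideanSpace ℝ (Fin n)) p).symm ⁻¹' U)
  isOpen_dom := ((chartAt (EuclideanSpace ℝ (Fin n)) p).isOpen_inter_preimage_symm hU).preimage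
    (EuclideanSpace.equiv (Fin n) ℝ).symm.continuous
  param z := (chartAt (EuclideanSpace ℝ (Fin n)) p).symm ((EuclideanSpace.equiv (Fin n) ℝ).symm z)
  smooth := (contMDiffOn_chart_symm (I := 𝓡 n) (x := p)).comp
    (contMDiff_iff_contDiff.2 (EuclideanSpace.equiv (Fin n) ℝ).symm.contDiff).contMDiffOn
    fun _ hz => hz.1
  injOn := fun z hz w hw h => (EuclideanSpace.equiv (Fin n) ℝ).symm.injective
    ((chartAt (EuclideanSpace ℝ (Fin n)) p).symm.injOn hz.1 hw.1 h)
  bijective_mfderiv := by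
    intro z hz
    set e := chartAt (EuclideanSpace ℝ (Fin n)) p with he
    set L := EuclideanSpace.equiv (Fin n) ℝ with hL
    have h1 : MDifferentiableAt 𝓘(ℝ, Fin n → ℝ) (𝓡 n) (fun z => e.symm (L.symm z)) z := by
      have h2 : ContMDiffAt (𝓡 n) (𝓡 n) ∞ e.symm (L.symm z) :=
        (contMDiffOn_chart_symm (I := 𝓡 n) (x := p)).contMDiffAt (e.open_target.mem_nhds hz.1)
      exact (h2.comp z (contMDiff_iff_contDiff.2 L.symm.contDiff).contMDiffAt).mdifferentiableAt
        (by simp)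
    have h2 : MDifferentiableAt (𝓡 n) 𝓘(ℝ, Fin n → ℝ) (fun q => L (e q)) (e.symm (L.symm z)) := by
      have h3 : ContMDiffAt (𝓡 n) (𝓡 n) ∞ e (e.symm (L.symm z)) :=
        (contMDiffOn_chart (I := 𝓡 n) (x := p)).contMDiffAt
          (e.open_source.mem_nhds (e.map_target hz.1))
      exact ((contMDiff_iff_contDiff.2 L.contDiff).contMDiffAt.comp _ h3).mdifferentiableAt
        (by simp)
    have h3 := HasMFDerivAt.comp z h2.hasMFDerivAt h1.hasMFDerivAt
    have h4 : (fun q => L (e q)) ∘ (fun z => e.symm (L.symm z)) =ᶠ[𝓝 z] id := by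
      have ho : IsOpen (L.symm ⁻¹' e.target) := e.open_target.preimage L.symm.continuous
      filter_upwards [ho.mem_nhds hz.1] with w hw
      simp only [Function.comp_apply, id]
      rw [e.right_inv hw, L.apply_symm_apply]
    have h5 := hasMFDerivAt_unique (h3.congr_of_eventuallyEq h4.symm) (hasMFDerivAt_id z)
    let T : (Fin n → ℝ) →L[ℝ] EuclideanSpace ℝ (Fin n) :=
      mfderiv 𝓘(ℝ, Fin n → ℝ) (𝓡 n) (fun z => e.symm (L.symm z)) z
    let S : EuclideanSpace ℝ (Fin n) →L[ℝ] (Fin n → ℝ) :=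
      mfderiv (𝓡 n) 𝓘(ℝ, Fin n → ℝ) (fun q => L (e q)) (e.symm (L.symm z))
    have h6 : ∀ v, S (T v) = v := fun v =>
      congrArg (fun R : (Fin n → ℝ) →L[ℝ] (Fin n → ℝ) => R v) h5
    have hinj : Function.Injective T := Function.LeftInverse.injective h6
    exact ⟨hinj, (LinearMap.injective_iff_surjective_of_finrank_eq_finrank (f := T.toLinearMap)
      (by simp)).1 hinj⟩

lemma mapsTo_chartCoord (p : N) {U : Set N} (hU : IsOpen U) :
    Set.MapsTo (chartCoord (n := n) p hU).param (chartCoord (n := n) p hU).dom U := fun _ hz => hz.2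

/-- A function which is `C^k` in every coordinate system of `U` is `C^k` on `U`. -/
lemma contMDiffOn_of_coord {U : Set N} (hU : IsOpen U) {F : Type*} [NormedAddCommGroup F]
    [NormedSpace ℝ F] {f : N → F} {k : WithTop ℕ∞} (hk : k ≤ ∞)
    (h : ∀ c : CoordSystem n N, Set.MapsTo c.param c.dom U →
      ContDiffOn ℝ k (fun z => f (c.param z)) c.dom) :
    ContMDiffOn (𝓡 n) 𝓘(ℝ, F) k f U := by
  intro p hp
  set e := chartAt (EuclideanSpace ℝ (Fin n)) p with he
  set L := EuclideanSpace.equiv (Fin n) ℝ with hL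
  have hps : p ∈ e.source := mem_chart_source _ p
  have h1 := h (chartCoord (n := n) p hU) (mapsTo_chartCoord (n := n) p hU)
  have hmem : L (e p) ∈ (chartCoord (n := n) p hU).dom := by
    constructor
    · change L.symm (L (e p)) ∈ e.target
      rw [L.symm_apply_apply]
      exact e.map_source hps
    · change e.symm (L.symm (L (e p))) ∈ U
      rwa [L.symm_apply_apply, e.left_inv hps]
  have h2 : ContMDiffAt 𝓘(ℝ, Fin n → ℝ) 𝓘(ℝ, F) k (fun z => f ((chartCoord (n := n) p hU).param z))
      (L (e p)) :=
    contMDiffAt_iff_contDiffAt.2 (h1.contDiffAt ((chartCoord (n := n) p hU).isOpen_dom.mem_nhds hmem))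
  have h3 : ContMDiffAt (𝓡 n) (𝓡 n) k e p :=
    ((contMDiffOn_chart (I := 𝓡 n) (x := p)).contMDiffAt (e.open_source.mem_nhds hps)).of_le hk
  have h4 : ContMDiffAt (𝓡 n) 𝓘(ℝ, Fin n → ℝ) k (fun q => L (e q)) p :=
    (contMDiff_iff_contDiff.2 L.contDiff).contMDiffAt.comp p h3
  refine ContMDiffAt.contMDiffWithinAt ((ContMDiffAt.comp (f := fun q => L (e q)) p h2
    h4).congr_of_eventuallyEq ?_)
  filter_upwards [e.open_source.mem_nhds hps] with q hq
  have : (chartCoord (n := n) p hU).param (L (e q)) = q := by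
    change e.symm (L.symm (L (e q))) = q
    rw [L.symm_apply_apply, e.left_inv hq]
  simp only [Function.comp_apply, this]

end Charts

end KaluzaKlein

end

/-! ### Assembly of the proof -/

theorem theorem2
    {M P : Type*}
    [TopologicalSpace M] [ChartedSpace (EuclideanSpace ℝ (Fin 4)) M] [IsManifold (𝓡 4) ∞ M]
    [TopologicalSpace P] [ChartedSpace (EuclideanSpace ℝ (Fin 5)) P] [IsManifold (𝓡 5) ∞ P]
    [AddAction ℝ P]
    -- the principal bundle `π : P → M`, with structure group `ℝ` or `U(1)`
    (G : StructureGroup) (B : PrincipalBundle M P G)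
    -- the constants
    (hbar β m a₀ ε σ : ℝ) (hhbar : 0 < hbar) (hβ : β ≠ 0) (hm : 0 < m) (ha₀ : 0 < a₀)
    (hε : ε = -1 ∨ ε = 0 ∨ ε = 1) (hσ : σ = -1 ∨ σ = 1)
    -- the metric `σ g₀ - a² conn²` on `P`
    (g₀ : BilinField 4 M) (hg₀ : IsLorentzMetric g₀)
    (a : M → ℝ) (ha : ContMDiff (𝓡 4) 𝓘(ℝ, ℝ) ∞ a) (ha_pos : ∀ x, 0 < a x)
    (conn : OneForm 5 P) (hconn : IsConnectionForm conn)
    -- the Klein-Gordon field on `P`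
    (Ψ : P → ℂ) (hΨ : SolvesNeutralKG hbar (kkMetric B σ g₀ a conn) (ε * m ^ 2) Ψ)
    -- the Einstein metric on `M`
    (gE : BilinField 4 M) (hgE : gE = fun x => (a x / a₀) • g₀ x)
    -- the conformal factors
    (α : ℝ → M → ℝ)
    (hα : ∀ q ∈ G.charges hbar β, ContMDiff (𝓡 4) 𝓘(ℝ, ℝ) 2 (α q))
    (hα_ne : ∀ q ∈ G.charges hbar β, ∀ x, α q x ≠ 0)
    (hα_stat : ∀ q ∈ G.charges hbar β,
      IsStationaryPoint hbar gE
        (fun x => σ * (a₀ / a x) * (ε * m ^ 2 + q ^ 2 / (β ^ 2 * a x ^ 2))) (α q))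
    -- a local section, which fixes the fiber coordinate `y` and the potential `A`
    (U : Set M) (hU : IsOpen U) (s : M → P) (hs : ContMDiffOn (𝓡 4) (𝓡 5) ∞ s U)
    (hs_sec : ∀ x ∈ U, B.proj (s x) = x)
    -- the Fourier expansion of `Ψ` along the fiber
    (ψ : ℝ → M → ℂ)
    (hΨ_int : FiberIntegrable G s U Ψ)
    (hψ : IsFiberFourierExpansion G hbar β s U Ψ (fun q x => ψ q x * α q x)) :
    ∀ q ∈ G.charges hbar β,
      SolvesChargedKGOn hbar q m (gaugePotential β conn s)
        (fun x => (α q x ^ 2 / m ^ 2) • gE x) U (ψ q) := by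
  have hc : hbar * β ≠ 0 := mul_ne_zero hhbar.ne' hβ
  have hσ2 : σ ^ 2 = 1 := by rcases hσ with rfl | rfl <;> norm_num
  intro q hq
  set k : ℝ := q / (hbar * β) with hk
  have hkq : hbar * β * k = q := mul_div_cancel₀ q hc
  have hkp : ∀ p ∈ G.periods, Complex.exp (-(Complex.I * k * p)) = 1 := fun p hp =>
    exp_charge_period hc hq hp
  set A := gaugePotential β conn s with hA
  have hα0 : ∀ x, (α q x : ℂ) ≠ 0 := fun x => Complex.ofReal_ne_zero.2 (hα_ne q hq x)
  have key : ∀ c : CoordSystem 4 M, Set.MapsTo c.param c.dom U →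
      ContDiffOn ℝ 2 (fun z => ψ q (c.param z)) c.dom ∧ ∀ x ∈ c.dom,
        gaugeDiv hbar q (A.comp c) (fun i z => ∑ j,
            ((σ * a (c.param z) * invDensity (g₀.comp c) i j z : ℝ) : ℂ) *
            gaugeD hbar q (A.comp c) (fun w => (α q (c.param w) : ℂ) * ψ q (c.param w)) j z) x
          + a (c.param x) * √|(g₀.comp c x).det| *
            (ε * m ^ 2 + q ^ 2 / (β ^ 2 * a (c.param x) ^ 2)) *
            (α q (c.param x) * ψ q (c.param x)) = 0 := by
    intro c hcU
    have h : SectionCoord B c s U := ⟨hU, hs, hs_sec, hcU⟩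
    obtain ⟨hF, hpF⟩ := h.fiberRegular_field hΨ.1 hΨ_int
    set F : (Fin 5 → ℝ) → ℂ := fun z => Ψ (bundleParam c s z) with hFdef
    set κ := G.coeffNorm hbar β
    have hcoeff : ∀ x ∈ c.dom,
        (α q (c.param x) : ℂ) * ψ q (c.param x) = fiberCoeff G κ k F x := by
      intro x hx
      obtain ⟨h1, h2, h3⟩ := hψ (c.param x) (hcU hx)
      have h4 : IntegrableOn (fun y => F (fiberPoint y x)) G.fiberDomain := by
        -- At k = 0 the phase is 1, so convergence of the Fourier integral is plain integrability
        -- along the fiber.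
        simpa [FiberIntegrableAt] using hF.integrableAt (k := 0) hx
      rw [mul_comm]
      exact fourier_inversion hc G h1 h2 h4 h3 hq
    have hαc := c.contDiffOn_comp ENat.LEInfty.out (hα q hq)
    have hdiff : ContDiffOn ℝ 2 (fun z => ψ q (c.param z)) c.dom := by
      -- As α has no zeros, ψ is the C² Fourier coefficient divided by α.
      have h1 := (contDiffOn_ofReal hαc).inv (fun z _ => hα0 (c.param z))
      refine (h1.mul (contDiffOn_two_fiberCoeff (κ := κ) (k := k) c.isOpen_dom hF hpF)).congr
        fun z hz => ?_
      rw [← hcoeff z hz]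
      exact (inv_mul_cancel_left₀ (hα0 _) _).symm
    refine ⟨hdiff, fun x hx => ?_⟩
    have hAs : ∀ i, ContDiffOn ℝ 1 (A.comp c i) c.dom := fun i =>
      (h.contDiffOn_gaugePotential hconn hβ i).of_le ENat.LEInfty.out
    have hKs : ∀ i j, ContDiffOn ℝ 1
        (fun z => σ * a (c.param z) * invDensity (g₀.comp c) i j z) c.dom := fun i j =>
      (contDiffOn_const.mul ((c.contDiffOn_comp le_rfl ha).of_le ENat.LEInfty.out)).mul
        (contDiffOn_invDensity (k := 1) (fun i j => (hg₀.smooth c i j).of_le ENat.LEInfty.out)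
          (fun z hz => hg₀.det_comp_ne_zero c hz) i j)
    have h1 := gaugeDiv_fiberCoeff (κ := κ) c.isOpen_dom hF hpF hAs hKs hkp hkq
      (b₁ := fun x => -(√|(g₀.comp c x).det| / a (c.param x)))
      (b₂ := fun x => ε * m ^ 2 * (a (c.param x) * √|(g₀.comp c x).det|) / hbar ^ 2)
      (fun z hz => h.horizontal_equation hconn hβ hσ2 hg₀ ha ha_pos hhbar.ne' hΨ hpF hz) hx
    have h2 : ∀ z ∈ c.dom, (fun w => (α q (c.param w) : ℂ) * ψ q (c.param w)) =ᶠ[𝓝 z]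
        fiberCoeff G κ k F := fun z hz => by
      filter_upwards [c.isOpen_dom.mem_nhds hz] with w hw using hcoeff w hw
    have h4 : gaugeDiv hbar q (A.comp c) (fun i z => ∑ j,
            ((σ * a (c.param z) * invDensity (g₀.comp c) i j z : ℝ) : ℂ) *
            gaugeD hbar q (A.comp c) (fun w => (α q (c.param w) : ℂ) * ψ q (c.param w)) j z) x =
        gaugeDiv hbar q (A.comp c) (fun i z => ∑ j,
            ((σ * a (c.param z) * invDensity (g₀.comp c) i j z : ℝ) : ℂ) *
            gaugeD hbar q (A.comp c) (fiberCoeff G κ k F) j z) x := by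
      refine Finset.sum_congr rfl fun i _ => gaugeD_congr ?_ i
      filter_upwards [c.isOpen_dom.mem_nhds hx] with z hz
      exact Finset.sum_congr rfl fun j _ => by rw [gaugeD_congr (h2 z hz)]
    rw [h4, hcoeff x hx]
    -- With k = q/(ħβ), the term -ħ² b₁ k² equals a √|det g₀| q²/(β²a²): the momentum along the
    -- fiber contributes to the mass term.
    refine Eq.trans ?_ h1
    have ha0 : (a (c.param x) : ℂ) ≠ 0 := Complex.ofReal_ne_zero.2 (ha_pos _).ne'
    have hβ0 : (β : ℂ) ≠ 0 := Complex.ofReal_ne_zero.2 hβ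
    have hh0 : (hbar : ℂ) ≠ 0 := Complex.ofReal_ne_zero.2 hhbar.ne'
    rw [hk]
    push_cast
    field_simp
    ring
  refine ⟨contMDiffOn_of_coord hU ENat.LEInfty.out fun c hcU => (key c hcU).1,
    fun c hcU x hx => ?_⟩
  obtain ⟨hψc, hKG⟩ := key c hcU
  have h : SectionCoord B c s U := ⟨hU, hs, hs_sec, hcU⟩
  have hr : ∀ z, 0 < a (c.param z) / a₀ := fun z => div_pos (ha_pos _) ha₀
  have hgEc : gE.comp c = fun z => (a (c.param z) / a₀) • g₀.comp c z := by
    subst hgE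
    rfl
  have has : ContDiffOn ℝ ∞ (fun z => a (c.param z)) c.dom := c.contDiffOn_comp le_rfl ha
  have hgEs : ∀ i j, ContDiffOn ℝ 1 (fun z => gE.comp c z i j) c.dom := fun i j => by
    simp only [hgEc]
    exact ((has.div_const _).mul (hg₀.smooth c i j)).of_le ENat.LEInfty.out
  have hgEd : ∀ z ∈ c.dom, (gE.comp c z).det ≠ 0 := fun z hz => by
    simp only [hgEc]
    rw [Matrix.det_smul]
    exact mul_ne_zero (pow_ne_zero _ (hr z).ne') (hg₀.det_comp_ne_zero c hz)
  have hgEsymm : ∀ z ∈ c.dom, (gE.comp c z).IsSymm := fun z _ => by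
    simp only [hgEc]
    exact (hg₀.isSymm_comp c z).smul _
  have hαc := c.contDiffOn_comp ENat.LEInfty.out (hα q hq)
  have hW : ContinuousOn (fun z => σ * (a₀ / a (c.param z)) *
      (ε * m ^ 2 + q ^ 2 / (β ^ 2 * a (c.param z) ^ 2))) c.dom := by
    have hac := has.continuousOn
    exact (continuousOn_const.mul (continuousOn_const.div hac fun z _ => (ha_pos _).ne')).mul
      (continuousOn_const.add (continuousOn_const.div (continuousOn_const.mul (hac.pow 2))
        fun z _ => mul_ne_zero (pow_ne_zero _ hβ) (pow_ne_zero _ (ha_pos _).ne')))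
  have hEL := (hα_stat q hq).euler_lagrange c hgEs hgEd hgEsymm hW hαc hx
  have hAs : ∀ i, ContDiffOn ℝ 1 (A.comp c i) c.dom := fun i =>
    (h.contDiffOn_gaugePotential hconn hβ i).of_le ENat.LEInfty.out
  refine gaugeBox_conformal c.isOpen_dom hgEs hgEd hgEsymm hm hAs hαc
    (fun z _ => hα_ne q hq _) hψc hx hEL ?_
  have hσ0 : σ ≠ 0 := fun h0 => by simp [h0] at hσ2
  have hΦ : ContDiffOn ℝ 2 (fun w => (α q (c.param w) : ℂ) * ψ q (c.param w)) c.dom :=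
    (contDiffOn_ofReal hαc).mul hψc
  have hV : ∀ i, DifferentiableAt ℝ (fun z => ∑ j, (invDensity (gE.comp c) i j z : ℂ) *
      gaugeD hbar q (A.comp c) (fun w => (α q (c.param w) : ℂ) * ψ q (c.param w)) j z) x :=
    fun i => ((ContDiffOn.sum fun j _ => (contDiffOn_ofReal (contDiffOn_invDensity (k := 1)
      hgEs hgEd i j)).mul (contDiffOn_gaugeD c.isOpen_dom hAs hΦ j)).contDiffAt
        (c.isOpen_dom.mem_nhds hx)).differentiableAt one_ne_zero
  -- The Einstein metric is chosen so that the weight a is absorbed: its density is a/a₀ times that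
  -- of g₀, which leaves the constant σa₀.
  have hfactor : ∀ i z, ∑ j, ((σ * a (c.param z) * invDensity (g₀.comp c) i j z : ℝ) : ℂ) *
        gaugeD hbar q (A.comp c) (fun w => (α q (c.param w) : ℂ) * ψ q (c.param w)) j z =
      ((σ * a₀ : ℝ) : ℂ) * ∑ j, (invDensity (gE.comp c) i j z : ℂ) *
        gaugeD hbar q (A.comp c) (fun w => (α q (c.param w) : ℂ) * ψ q (c.param w)) j z := by
    intro i z
    rw [Finset.mul_sum]
    refine Finset.sum_congr rfl fun j _ => ?_
    rw [hgEc, invDensity_smul (r := fun z => a (c.param z) / a₀) (hr z), ← mul_assoc,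
      ← Complex.ofReal_mul]
    congr 2
    field_simp
  have hx' := hKG x hx
  simp only [hfactor] at hx'
  rw [gaugeDiv_const_mul (σ * a₀) hV] at hx'
  have hdetE : √|(gE.comp c x).det| = (a (c.param x) / a₀) ^ 2 * √|(g₀.comp c x).det| := by
    rw [hgEc]
    exact sqrt_abs_det_smul _
  have hσa : ((σ * a₀ : ℝ) : ℂ) ≠ 0 := Complex.ofReal_ne_zero.2 (mul_ne_zero hσ0 ha₀.ne')
  -- After multiplication by σa₀ the mass terms agree, because σ² = 1 and √|det g_E| = (a/a₀)² √|det
  -- g₀| cancel the prefactor σa₀/a of W down to a √|det g₀|.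
  refine (mul_eq_zero_iff_left hσa).1 ?_
  rw [← hx', mul_add, hdetE]
  congr 1
  have ha0 : (a (c.param x) : ℂ) ≠ 0 := Complex.ofReal_ne_zero.2 (ha_pos _).ne'
  have hβ0 : (β : ℂ) ≠ 0 := Complex.ofReal_ne_zero.2 hβ
  have ha₀c : (a₀ : ℂ) ≠ 0 := Complex.ofReal_ne_zero.2 ha₀.ne'
  have hσc : (σ : ℂ) ^ 2 = 1 := by exact_mod_cast congrArg (fun r : ℝ => (r : ℂ)) hσ2
  push_cast
  field_simp
  rw [hσc]
  ring
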